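/- **Volumes of balls under projection.** *Setting.* Let $G$ be a real reductive group, i.e. a Hausdorff topological group with a continuous homomorphism $p:G\to GL(n,\mathbb R)$ that is a finite covering of an open subgroup of a real algebraic subgroup of $GL(n,\mathbb R)$ stable under transposition; identify its Lie algebra $\mathfrak g$ with a subalgebra of $\mathfrak{gl}(n,\mathbb R)$. Let $H\subset G$ be a closed subgroup with finitely many connected components and real algebraic Lie algebra $\mathfrak h$, let $Z=G/H$ and $z_0=H\in Z$. Assume that $Z$ is unimodular, i.e. it carries a nonzero $G$-invariant Radon measure $\operatorname{vol}_Z$; fix Haar measures $\operatorname{vol}_G$ on $G$ and $\operatorname{vol}_H$ on $H$. Assume that $Z$ is real spherical, with the following choices. Let $\mathfrak a\subset\mathfrak g$ be a maximal split abelian subspace, with restricted roots $\Sigma$ and root spaces $\mathfrak g^\alpha$, let $\Sigma^+$ be a positive system, and let $P=Z_G(\mathfrak a)N$ be the corresponding minimal parabolic subgroup; assume that $P\cdot z_0$ is open in $Z$, i.e. $\mathfrak g=\mathfrak h+\mathfrak p$. Let $Q=LU\supset P$ be a parabolic subgroup, $L=Z_G(y_0)$ with $y_0\in\mathfrak a$,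 $\mathfrak u=\bigoplus_{\alpha\in\Sigma_{\mathfrak u}}\mathfrak g^\alpha$ with $\Sigma_{\mathfrak u}=\{\alpha\in\Sigma\mid\alpha(y_0)>0\}$, such that $QH=PH$ and $L_{\rm n}\subset Q\cap H\subset L$, where $L_{\rm n}$ is the analytic subgroup whose Lie algebra is the sum of the non-compact simple ideals of $\mathfrak l$. Let $\bar{\mathfrak u}=\bigoplus_{\alpha\in\Sigma_{\mathfrak u}}\mathfrak g^{-\alpha}$, let $\mathfrak l_H^\perp$ be the orthocomplement of $\mathfrak l\cap\mathfrak h$ in $\mathfrak l$ for the form $\operatorname{tr}(XY)$, and let $T:\bar{\mathfrak u}\to\mathfrak l_H^\perp\oplus\mathfrak u$ be the linear map with $\mathfrak h=(\mathfrak l\cap\mathfrak h)\oplus\{\bar X+T(\bar X)\mid\bar X\in\bar{\mathfrak u}\}$, with components $T_{\alpha,\beta}:\mathfrak g^{-\alpha}\to\mathfrak g^\beta$ ($\alpha\in\Sigma_{\mathfrak u}$, $\beta\in\{0\}\cup\Sigma_{\mathfrak u}$). Put $\mathcal M=\{\alpha+\beta\mid T_{\alpha,\beta}\ne0\}$ and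 $$\mathfrak a_Z^-=\{Y\in\mathfrak a\mid \sigma(Y)\le0\ \ \forall\sigma\in\mathcal M\},\qquad A_Z^-=\exp(\mathfrak a_Z^-)$$ (equivalently, $\sigma(Y)\le 0$ for all $\sigma$ in a set of spherical roots, i.e. of linearly independent generators $S$ of the convex cone spanned by $\mathcal M$ with $\mathcal M\subset\mathbb N_0[S]$). Let $\rho(Y)=\frac12\operatorname{tr}(\operatorname{ad}Y|_{\mathfrak u})$ and $a^{\lambda}=e^{\lambda(Y)}$ for $a=\exp Y$. Assume finally that $Z$ is wavefront: $\mathfrak a^-+(\mathfrak a\cap\mathfrak h)=\mathfrak a_Z^-$, where $\mathfrak a^-=\{Y\in\mathfrak a\mid\alpha(Y)\le0\ \ \forall\alpha\in\Sigma^+\}$. *Claim.* Let $B_1$ be a compact neighborhood of $\mathbf 1$ in $G$. For $E\subset B_1$ measurable and $a\in A_Z^-$ let $E_a\subset B_1^2=B_1\cdot B_1$ be the inverse image of $Ea\cdot z_0$ under the map $B_1^2\to B_1^2a\cdot z_0$, $b\mapsto ba\cdot z_0$. Then: 1. There is a constant $C>0$ such that $$\operatorname{vol}_Z(Ea\cdot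 z_0)\le C\,a^{-2\rho}\operatorname{vol}_G(E_a)\qquad\text{for all }a\in A_Z^-\text{ and all measurable }E\subset B_1.$$ 2. There is a constant $C'>0$ such that $$\operatorname{vol}_H\big(\operatorname{Ad}(a)^{-1}B_1\cap H\big)\ge C'\,a^{2\rho}\qquad\text{for all }a\in A_Z^-,$$ where $\operatorname{Ad}(a)^{-1}B_1=a^{-1}B_1a$. -/

import Mathlib

open MeasureTheory
open scoped Pointwise Topology

noncomputable section

namespace RealSpherical

attribute [local instance 100] LieRing.ofAssociativeRing

/-- The Lie algebra `𝔤𝔩(n, ℝ)`, with the commutator bracket. -/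
abbrev Mat (n : ℕ) : Type := Matrix (Fin n) (Fin n) ℝ

/-! ### Real reductive groups and their Lie algebras -/

/-- A real algebraic subgroup of `GL(n, ℝ)`: the common zeros in `GL(n, ℝ)` of a set of real
polynomials in the matrix entries. -/
def IsRealAlgebraic {n : ℕ} (S : Subgroup (GL (Fin n) ℝ)) : Prop :=
  ∃ F : Set (MvPolynomial (Fin n × Fin n) ℝ), ∀ g : GL (Fin n) ℝ,
    g ∈ S ↔ ∀ f ∈ F, MvPolynomial.eval (fun ij => (g : Mat n) ij.1 ij.2) f = 0

/-- The (Hausdorff topological) group `G` is a real reductive group by means of `p`: the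
homomorphism `p` is a finite covering of an open subgroup of a real algebraic subgroup of
`GL(n, ℝ)` that is stable under transposition. -/
def IsRealReductive {n : ℕ} {G : Type*} [Group G] [TopologicalSpace G]
    (p : G →* GL (Fin n) ℝ) : Prop :=
  Continuous p ∧ Finite p.ker ∧
    ∃ S : Subgroup (GL (Fin n) ℝ), IsRealAlgebraic S ∧
      (∀ g ∈ S, ∃ g' ∈ S, (g' : Mat n) = (g : Mat n).transpose) ∧
      (∀ x, p x ∈ S) ∧
      (∀ U : Set G, IsOpen U →
        ∃ V : Set (GL (Fin n) ℝ), IsOpen V ∧ p '' U = V ∩ (S : Set (GL (Fin n) ℝ)))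

/-- The Lie algebra `{X | exp(tX) ∈ S for all t ∈ ℝ}` of a subgroup `S` of `GL(n, ℝ)`. For the
(closed) subgroups to which this is applied, that set is itself a Lie subalgebra, so passing to
the span adds nothing. -/
def lieAlg {n : ℕ} (S : Subgroup (GL (Fin n) ℝ)) : LieSubalgebra ℝ (Mat n) :=
  LieSubalgebra.lieSpan ℝ (Mat n)
    {X | ∀ t : ℝ, ∃ s ∈ S, (s : Mat n) = NormedSpace.exp (t • X)}

/-- The Lie algebra of a subgroup `S` of `G`, identified with its image in `𝔤𝔩(n, ℝ)` under the
differential of `p` (which is injective, the kernel of `p` being finite). -/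
def lieOf {n : ℕ} {G : Type*} [Group G] (p : G →* GL (Fin n) ℝ)
    (S : Subgroup G) : LieSubalgebra ℝ (Mat n) := lieAlg (S.map p)

open Classical in
/-- The exponential map of `G`: `gexp p X = c 1`, where `c : ℝ → G` is the continuous
one-parameter subgroup with `p (c t) = exp(tX)` (which exists, and is unique, for `X` in the Lie
algebra of `G`). -/
def gexp {n : ℕ} {G : Type*} [Group G] [TopologicalSpace G] (p : G →* GL (Fin n) ℝ)
    (X : Mat n) : G :=
  if h : ∃ c : ContinuousMonoidHom (Multiplicative ℝ) G,
      ∀ t : ℝ, (p (c (Multiplicative.ofAdd t)) : Mat n) = NormedSpace.exp (t • X)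
  then h.choose (Multiplicative.ofAdd 1) else 1

/-- The analytic subgroup of `G` with Lie algebra `V`: the subgroup generated by `exp V`. -/
def analyticSubgroup {n : ℕ} {G : Type*} [Group G] [TopologicalSpace G] (p : G →* GL (Fin n) ℝ)
    (V : Submodule ℝ (Mat n)) : Subgroup G :=
  Subgroup.closure (gexp p '' (V : Set (Mat n)))

/-- The centralizer of `s` in `G` under the adjoint action `Ad(g) X = p(g) X p(g)⁻¹`. -/
def centralizerOf {n : ℕ} {G : Type*} [Group G] (p : G →* GL (Fin n) ℝ)
    (s : Set (Mat n)) : Subgroup G where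
  carrier := {g | ∀ X ∈ s, (p g : Mat n) * X = X * (p g : Mat n)}
  one_mem' := by intro X _; simp
  mul_mem' := by
    intro g h hg hh X hX
    simp only [map_mul, Units.val_mul]
    rw [mul_assoc, hh X hX, ← mul_assoc, hg X hX, mul_assoc]
  inv_mem' := by
    intro g hg X hX
    rw [map_inv, Units.inv_mul_eq_iff_eq_mul, ← mul_assoc, hg X hX, mul_assoc, Units.mul_inv,
      mul_one]

/-! ### Restricted roots and parabolic subgroups -/

/-- A split abelian subspace of the Lie algebra `𝔤`: a subspace consisting of commuting elements
that are diagonalizable over `ℝ`. -/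
def IsSplitAbelian {n : ℕ} (𝔤 : LieSubalgebra ℝ (Mat n)) (𝔟 : Submodule ℝ (Mat n)) : Prop :=
  𝔟 ≤ 𝔤.toSubmodule ∧
    (∀ X ∈ 𝔟, ∃ (g : GL (Fin n) ℝ) (d : Fin n → ℝ),
      X = (g : Mat n) * Matrix.diagonal d * ((g⁻¹ : GL (Fin n) ℝ) : Mat n)) ∧
    (∀ X ∈ 𝔟, ∀ Y ∈ 𝔟, ⁅X, Y⁆ = 0)

/-- `𝔞` is a maximal split abelian subspace of the Lie algebra of `G` (the Lie algebra of the
group `A` of an Iwasawa decomposition `G = KAN`). -/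
def IsMaximalSplit {n : ℕ} {G : Type*} [Group G] (p : G →* GL (Fin n) ℝ)
    (𝔞 : Submodule ℝ (Mat n)) : Prop :=
  Maximal (IsSplitAbelian (lieOf p ⊤)) 𝔞

/-- The space `𝔤^α = {X ∈ 𝔤 | [Y, X] = α(Y) X for all Y ∈ 𝔞}`. -/
def rootSpace {n : ℕ} {G : Type*} [Group G] (p : G →* GL (Fin n) ℝ)
    (𝔞 : Submodule ℝ (Mat n)) (α : Module.Dual ℝ 𝔞) : Submodule ℝ (Mat n) where
  carrier := {X | X ∈ lieOf p ⊤ ∧ ∀ Y : 𝔞, ⁅(Y : Mat n), X⁆ = α Y • X}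
  zero_mem' := ⟨zero_mem _, fun Y => by simp⟩
  add_mem' := fun hX hX' => ⟨add_mem hX.1 hX'.1, fun Y => by
    rw [lie_add, hX.2 Y, hX'.2 Y, smul_add]⟩
  smul_mem' := fun c X hX => ⟨(lieOf p ⊤).smul_mem c hX.1, fun Y => by
    rw [lie_smul, hX.2 Y, smul_comm]⟩

/-- The restricted roots `Σ = Σ(𝔞, 𝔤)`. -/
def roots {n : ℕ} {G : Type*} [Group G] (p : G →* GL (Fin n) ℝ)
    (𝔞 : Submodule ℝ (Mat n)) : Set (Module.Dual ℝ 𝔞) :=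
  {α | α ≠ 0 ∧ rootSpace p 𝔞 α ≠ ⊥}

/-- The roots that are positive on `Y`. -/
def rootsPos {n : ℕ} {G : Type*} [Group G] (p : G →* GL (Fin n) ℝ)
    (𝔞 : Submodule ℝ (Mat n)) (Y : 𝔞) : Set (Module.Dual ℝ 𝔞) :=
  {α | α ∈ roots p 𝔞 ∧ 0 < α Y}

/-- The sum of the root spaces `𝔤^α` over the roots `α` that are positive on `Y`: the nilradical
of the parabolic subalgebra attached to `Y`. -/
def nilradical {n : ℕ} {G : Type*} [Group G] (p : G →* GL (Fin n) ℝ)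
    (𝔞 : Submodule ℝ (Mat n)) (Y : 𝔞) : Submodule ℝ (Mat n) :=
  ⨆ α ∈ rootsPos p 𝔞 Y, rootSpace p 𝔞 α

/-- The sum of the root spaces `𝔤^{-α}` over the roots `α` that are positive on `Y`. -/
def oppNilradical {n : ℕ} {G : Type*} [Group G] (p : G →* GL (Fin n) ℝ)
    (𝔞 : Submodule ℝ (Mat n)) (Y : 𝔞) : Submodule ℝ (Mat n) :=
  ⨆ α ∈ rootsPos p 𝔞 Y, rootSpace p 𝔞 (-α)

/-- The minimal parabolic subgroup `P = MAN` attached to the positive system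
`Σ⁺ = {α ∈ Σ | α(x₀) > 0}` of a regular element `x₀ ∈ 𝔞`; here `MA = Z_G(𝔞)` and `N` is the
analytic subgroup with Lie algebra `𝔫 = ⨁_{α ∈ Σ⁺} 𝔤^α`. -/
def minParabolic {n : ℕ} {G : Type*} [Group G] [TopologicalSpace G] (p : G →* GL (Fin n) ℝ)
    (𝔞 : Submodule ℝ (Mat n)) (x₀ : 𝔞) : Subgroup G :=
  centralizerOf p (𝔞 : Set (Mat n)) ⊔ analyticSubgroup p (nilradical p 𝔞 x₀)

/-- The Levi subgroup `L = Z_G(y₀)` of the parabolic subgroup attached to `y₀ ∈ 𝔞`. -/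
def levi {n : ℕ} {G : Type*} [Group G] (p : G →* GL (Fin n) ℝ)
    (𝔞 : Submodule ℝ (Mat n)) (y₀ : 𝔞) : Subgroup G :=
  centralizerOf p {(y₀ : Mat n)}

/-- The parabolic subgroup `Q = LU` attached to `y₀ ∈ 𝔞`, with `L = Z_G(y₀)` and `U` the analytic
subgroup with Lie algebra `𝔲 = ⨁_{α(y₀) > 0} 𝔤^α`. Every parabolic subgroup with a Levi subgroup
containing `exp 𝔞` is obtained in this way, from a generic `y₀` in the intersection of `𝔞` with the
centre of `𝔩`. -/
def parabolic {n : ℕ} {G : Type*} [Group G] [TopologicalSpace G] (p : G →* GL (Fin n) ℝ)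
    (𝔞 : Submodule ℝ (Mat n)) (y₀ : 𝔞) : Subgroup G :=
  levi p 𝔞 y₀ ⊔ analyticSubgroup p (nilradical p 𝔞 y₀)

/-- The sum `𝔩_n` of all non-compact simple ideals of the Lie algebra `𝔩`; a simple ideal is
compact when its Killing form is negative definite. -/
def noncompactPart {n : ℕ} (𝔩 : LieSubalgebra ℝ (Mat n)) : Submodule ℝ (Mat n) :=
  ⨆ (I : LieIdeal ℝ 𝔩) (_ : LieAlgebra.IsSimple ℝ I)
    (_ : ¬ ∀ x : I, x ≠ 0 → killingForm ℝ I x x < 0),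
    I.toSubmodule.map 𝔩.toSubmodule.subtype

/-! ### Real spherical spaces, the compression cone and the wavefront property -/

/-- The choices made for a real spherical space `Z = G/H`: a maximal split abelian subspace `𝔞`,
an element `x₀ ∈ 𝔞` defining a minimal parabolic subgroup `P` and an element `y₀ ∈ 𝔞` defining a
parabolic subgroup `Q = LU`, such that
* `P · z₀` is open in `Z`, that is `𝔤 = 𝔥 + 𝔭`;
* `P ⊆ Q` and `QH = PH`;
* `L_n ⊆ Q ∩ H ⊆ L`, where `L_n` is the analytic subgroup with Lie algebra `𝔩_n`. -/
structure IsAdapted {n : ℕ} {G : Type*} [Group G] [TopologicalSpace G] (p : G →* GL (Fin n) ℝ)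
    (H : Subgroup G) (𝔞 : Submodule ℝ (Mat n)) (x₀ y₀ : 𝔞) : Prop where
  maximal_split : IsMaximalSplit p 𝔞
  regular : ∀ α ∈ roots p 𝔞, α x₀ ≠ 0
  open_orbit : (lieOf p H).toSubmodule ⊔ (lieOf p (minParabolic p 𝔞 x₀)).toSubmodule =
    (lieOf p ⊤).toSubmodule
  dominant : ∀ α ∈ rootsPos p 𝔞 x₀, 0 ≤ α y₀
  orbit_eq : (parabolic p 𝔞 y₀ : Set G) * (H : Set G) = (minParabolic p 𝔞 x₀ : Set G) * (H : Set G)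
  noncompact_le : analyticSubgroup p (noncompactPart (lieOf p (levi p 𝔞 y₀))) ≤
    parabolic p 𝔞 y₀ ⊓ H
  inf_le : parabolic p 𝔞 y₀ ⊓ H ≤ levi p 𝔞 y₀

/-- `𝔩_H^⊥`: the orthogonal complement of `𝔩 ∩ 𝔥` in `𝔩` for the invariant form `tr(XY)`. -/
def leviPerp {n : ℕ} {G : Type*} [Group G] (p : G →* GL (Fin n) ℝ)
    (H : Subgroup G) (𝔞 : Submodule ℝ (Mat n)) (y₀ : 𝔞) : Submodule ℝ (Mat n) where
  carrier := {Y | Y ∈ lieOf p (levi p 𝔞 y₀) ∧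
    ∀ X, X ∈ lieOf p (levi p 𝔞 y₀) → X ∈ lieOf p H → (Y * X).trace = 0}
  zero_mem' := ⟨zero_mem _, fun X _ _ => by simp⟩
  add_mem' := fun hY hY' => ⟨add_mem hY.1 hY'.1, fun X hX hX' => by
    rw [add_mul, Matrix.trace_add, hY.2 X hX hX', hY'.2 X hX hX', add_zero]⟩
  smul_mem' := fun c Y hY => ⟨(lieOf p _).smul_mem c hY.1, fun X hX hX' => by
    rw [Matrix.smul_mul, Matrix.trace_smul, hY.2 X hX hX', smul_zero]⟩

/-- The graph of the linear map `T : 𝔲̄ → 𝔩_H^⊥ ⊕ 𝔲` determined by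
`𝔥 = (𝔩 ∩ 𝔥) ⊕ {X̄ + T(X̄) | X̄ ∈ 𝔲̄}`: the relation `T(X̄) = Y`. -/
def IsTValue {n : ℕ} {G : Type*} [Group G] (p : G →* GL (Fin n) ℝ)
    (H : Subgroup G) (𝔞 : Submodule ℝ (Mat n)) (y₀ : 𝔞) (X Y : Mat n) : Prop :=
  X ∈ oppNilradical p 𝔞 y₀ ∧ Y ∈ leviPerp p H 𝔞 y₀ ⊔ nilradical p 𝔞 y₀ ∧ X + Y ∈ lieOf p H

/-- `T_{α,β} ≠ 0`: for some `X ∈ 𝔤^{-α}` the component of `T(X)` in `𝔤^β` is a nonzero `Y_β`. -/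
def TComponentNeZero {n : ℕ} {G : Type*} [Group G] (p : G →* GL (Fin n) ℝ)
    (H : Subgroup G) (𝔞 : Submodule ℝ (Mat n)) (y₀ : 𝔞) (α β : Module.Dual ℝ 𝔞) : Prop :=
  ∃ X ∈ rootSpace p 𝔞 (-α), ∃ Y, IsTValue p H 𝔞 y₀ X Y ∧
    ∃ Yβ ∈ rootSpace p 𝔞 β, Yβ ≠ 0 ∧
      Y - Yβ ∈ ⨆ γ ∈ {γ : Module.Dual ℝ 𝔞 | γ ≠ β}, rootSpace p 𝔞 γ

/-- The set `ℳ = {α + β | T_{α,β} ≠ 0}`, where `α ∈ Σ_𝔲` and `β ∈ {0} ∪ Σ_𝔲`. -/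
def weightSet {n : ℕ} {G : Type*} [Group G] (p : G →* GL (Fin n) ℝ)
    (H : Subgroup G) (𝔞 : Submodule ℝ (Mat n)) (y₀ : 𝔞) : Set (Module.Dual ℝ 𝔞) :=
  {σ | ∃ α ∈ rootsPos p 𝔞 y₀, ∃ β ∈ insert 0 (rootsPos p 𝔞 y₀),
    TComponentNeZero p H 𝔞 y₀ α β ∧ σ = α + β}

/-- `S` is a set of spherical roots: a linearly independent set of generators of the convex cone
generated by `ℳ`, with `ℳ ⊆ ℕ₀[S]`. -/
def IsSphericalRootSet {n : ℕ} {G : Type*} [Group G] (p : G →* GL (Fin n) ℝ)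
    (H : Subgroup G) (𝔞 : Submodule ℝ (Mat n)) (y₀ : 𝔞) (S : Set (Module.Dual ℝ 𝔞)) : Prop :=
  LinearIndepOn ℝ id S ∧
    Submodule.span NNReal S = Submodule.span NNReal (weightSet p H 𝔞 y₀) ∧
    weightSet p H 𝔞 y₀ ⊆ AddSubmonoid.closure S

/-- The compression cone `𝔞_Z^-`, as a cone in `𝔞` (invariant under translation by `𝔞_H`): the
elements on which every element of `ℳ`, equivalently every spherical root, is `≤ 0`. -/
def compressionCone {n : ℕ} {G : Type*} [Group G] (p : G →* GL (Fin n) ℝ)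
    (H : Subgroup G) (𝔞 : Submodule ℝ (Mat n)) (y₀ : 𝔞) : Set 𝔞 :=
  {Y | ∀ σ ∈ weightSet p H 𝔞 y₀, σ Y ≤ 0}

theorem compressionCone_eq {n : ℕ} {G : Type*} [Group G] (p : G →* GL (Fin n) ℝ)
    (H : Subgroup G) (𝔞 : Submodule ℝ (Mat n)) (y₀ : 𝔞) (S : Set (Module.Dual ℝ 𝔞))
    (hS : IsSphericalRootSet p H 𝔞 y₀ S) :
    compressionCone p H 𝔞 y₀ = {Y | ∀ σ ∈ S, σ Y ≤ 0} := by
  have key : ∀ (M M' : Set (Module.Dual ℝ 𝔞)) (Y : 𝔞),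
      M' ⊆ Submodule.span NNReal M → (∀ σ ∈ M, σ Y ≤ 0) → ∀ σ ∈ M', σ Y ≤ 0 := by
    intro M M' Y hM h σ hσ
    refine Submodule.span_induction (p := fun σ _ => σ Y ≤ 0) h (by simp) ?_ ?_ (hM hσ)
    · intro x y _ _ hx hy
      simpa using add_nonpos hx hy
    · intro c x _ hx
      exact mul_nonpos_of_nonneg_of_nonpos c.2 hx
  ext Y
  exact ⟨key _ _ Y (hS.2.1 ▸ Submodule.subset_span), key _ _ Y (hS.2.1 ▸ Submodule.subset_span)⟩

/-- The closure `𝔞^-` of the negative Weyl chamber. -/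
def negChamber {n : ℕ} {G : Type*} [Group G] (p : G →* GL (Fin n) ℝ)
    (𝔞 : Submodule ℝ (Mat n)) (x₀ : 𝔞) : Set 𝔞 :=
  {Y | ∀ α ∈ rootsPos p 𝔞 x₀, α Y ≤ 0}

/-- The wavefront property `𝔞^- + 𝔞_H = 𝔞_Z^-`, where `𝔞_H = 𝔞 ∩ 𝔥`. -/
def IsWavefront {n : ℕ} {G : Type*} [Group G] (p : G →* GL (Fin n) ℝ)
    (H : Subgroup G) (𝔞 : Submodule ℝ (Mat n)) (x₀ y₀ : 𝔞) : Prop :=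
  negChamber p 𝔞 x₀ + {Y : 𝔞 | (Y : Mat n) ∈ lieOf p H} = compressionCone p H 𝔞 y₀

theorem lie_mem_nilradical {n : ℕ} {G : Type*} [Group G] (p : G →* GL (Fin n) ℝ)
    (𝔞 : Submodule ℝ (Mat n)) (y₀ Y : 𝔞) (X : Mat n) (hX : X ∈ nilradical p 𝔞 y₀) :
    LieModule.toEnd ℝ (Mat n) (Mat n) (Y : Mat n) X ∈ nilradical p 𝔞 y₀ := by
  suffices h : nilradical p 𝔞 y₀ ≤
      (nilradical p 𝔞 y₀).comap (LieModule.toEnd ℝ (Mat n) (Mat n) (Y : Mat n)) from h hX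
  refine iSup₂_le fun α hα X hX => ?_
  rw [Submodule.mem_comap, LieModule.toEnd_apply_apply, hX.2 Y]
  exact Submodule.smul_mem _ _
    ((le_iSup₂ (f := fun α (_ : α ∈ rootsPos p 𝔞 y₀) => rootSpace p 𝔞 α) α hα) hX)

/-- `ρ(Y) = ½ tr(ad Y |_𝔲)`. -/
def rho {n : ℕ} {G : Type*} [Group G] (p : G →* GL (Fin n) ℝ)
    (𝔞 : Submodule ℝ (Mat n)) (y₀ Y : 𝔞) : ℝ :=
  (1 / 2) * LinearMap.trace ℝ (nilradical p 𝔞 y₀)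
    ((LieModule.toEnd ℝ (Mat n) (Mat n) (Y : Mat n)).restrict (lie_mem_nilradical p 𝔞 y₀ Y))

/-! ### The sets in the volume estimate -/

/-- The set `E a · z₀ ⊆ Z = G/H`. -/
def orbitSet {G : Type*} [Group G] (H : Subgroup G) (E : Set G) (a : G) : Set (G ⧸ H) :=
  (fun b : G => ((b * a : G) : G ⧸ H)) '' E

/-- The set `E_a ⊆ B₁² = B₁ · B₁`: the inverse image of `E a · z₀` under the map
`B₁² → B₁² a · z₀, b ↦ b a · z₀`. -/
def pullbackSet {G : Type*} [Group G] (H : Subgroup G) (B₁ E : Set G) (a : G) : Set G :=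
  {b | b ∈ B₁ * B₁ ∧ ((b * a : G) : G ⧸ H) ∈ orbitSet H E a}

end RealSpherical

end

noncomputable section

open MeasureTheory NormedSpace Filter
open scoped Pointwise Topology Matrix.Norms.Operator

namespace RealSpherical

/-! ### The matrix exponential -/

section Generic

variable {𝔸 : Type*} [NormedRing 𝔸] [NormedAlgebra ℝ 𝔸] [CompleteSpace 𝔸]

/-! The second estimate carries the weight; the first follows from it by integrating over the fibres
of `G → G/H`. Throughout, `a = exp Y`.

Lower bound in `H`. In exponential coordinates Haar measure is comparable with Lebesgue measure near
`0` (`exists_measure_gexp_comparable`). So it suffices to find an endomorphism `f` of `𝔥` with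
determinant `e^{2ρ(Y)}` such that both `f` and `Ad(a) ∘ f` are bounded independently of `Y`: then
`exp (f D)`, for a fixed small ball `D`, lies in `a⁻¹ B₁ a ∩ H` and has volume at least a constant
times `|det f|` (`exists_le_measure_conj_mem`). Assume first that `Y` centralizes `𝔩` and is
nonpositive on the roots of `𝔲`. Since `𝔤 = 𝔥 + 𝔮` and `𝔥 ∩ 𝔮 ⊆ 𝔩`, projecting `𝔥` onto `𝔲̄` is
surjective with kernel `𝔥 ∩ 𝔩`. Let `f` shrink the coordinates in `𝔲̄` by the inverse of `Ad(a)` and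
fix the kernel. Then `Ad(a)` undoes the shrinking on `𝔲̄`, fixes `𝔩` and does not expand `𝔲`, while
the determinant of `f` is the product of the factors `e^{-α(Y)}` over `𝔲̄`, that is `e^{2ρ(Y)}`
(`exists_bounded_end`).

Reduction to such `Y`. The wavefront property writes `Y = Z + Z'` with `Z` in the closed negative
chamber and `Z' ∈ 𝔞 ∩ 𝔥`. The part of `Z` that acts on the root vectors of `𝔩` is spanned by the
elements `[X, τX]`, with `τ` minus a Cartan involution; these lie in `𝔥` because `L_n ⊆ H`. Removing
this part preserves negativity on `𝔲`, since it averages a weight over a set on which the removed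
part has trace zero (`weight_sub_nonpos`). The remaining factor `h₀ = exp Y₂ ∈ H` changes neither
side: it conjugates the set inside `H`, where its modular function is `1` because `G/H` has an
invariant measure and `exp 𝔞` has modular function `1` in `G`; the identity `tr(ad Y₂|𝔥) = -2ρ(Y₂)`
then gives `ρ(Y₂) = 0` (`trace_lieOf`, `rho_eq_zero`).

Upper bound in `Z`. For `e ∈ E` the fibre of the right translate `E_a a` over `e a z₀` contains a
translate of `a⁻¹ B₁ a ∩ H`. Weil's formula and Markov's inequality therefore bound `vol_H(a⁻¹ B₁ a
∩ H) vol_Z(E a z₀)` by a constant times `vol_G(E_a)`.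

The Lie-theoretic background is built from matrices: the closed subgroup theorem, lifting of
one-parameter groups through `p`, the formula `Δ = |det Ad|`, and a Cartan involution adapted to
`𝔞`, obtained by minimizing the norm on the conjugation orbit of a regular element. -/

theorem hasDerivAt_exp_smul' (X : 𝔸) : HasDerivAt (fun t : ℝ => exp (t • X)) X 0 := by
  have h2 : HasDerivAt (fun t : ℝ => t • X) X 0 := by
    simpa using (hasDerivAt_id (0 : ℝ)).smul_const X
  have h1 : HasFDerivAt (exp : 𝔸 → 𝔸) (1 : 𝔸 →L[ℝ] 𝔸) ((0 : ℝ) • X) := by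
    rw [zero_smul]; exact hasStrictFDerivAt_exp_zero.hasFDerivAt
  exact h1.comp_hasDerivAt 0 h2

theorem hasDerivAt_exp_mul_exp' (X Y : 𝔸) :
    HasDerivAt (fun t : ℝ => exp (t • X) * exp (t • Y)) (X + Y) 0 := by
  have := (hasDerivAt_exp_smul' X).fun_mul (hasDerivAt_exp_smul' Y)
  simpa using this

theorem hasDerivAt_conj_exp' (X Y : 𝔸) :
    HasDerivAt (fun t : ℝ => exp (t • X) * Y * exp (-(t • X))) (X * Y - Y * X) 0 := by
  have h1 := (hasDerivAt_exp_smul' X).mul_const Y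
  have h2 := h1.fun_mul (hasDerivAt_exp_smul' (-X))
  simp only [smul_neg] at h2
  convert h2 using 1
  simp [sub_eq_add_neg]

/-- For complementary projections `P` and `Q` this makes `X ↦ exp (P X) * exp (Q X)` a chart at `0`,
the coordinates behind the closed subgroup theorem. -/
theorem hasStrictFDerivAt_exp_mul_exp' {P Q : 𝔸 →L[ℝ] 𝔸} (h : P + Q = 1) :
    HasStrictFDerivAt (fun X => exp (P X) * exp (Q X)) (1 : 𝔸 →L[ℝ] 𝔸) 0 := by
  have hP : HasStrictFDerivAt (exp : 𝔸 → 𝔸) (1 : 𝔸 →L[ℝ] 𝔸) (P 0) := by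
    rw [map_zero]; exact hasStrictFDerivAt_exp_zero
  have hQ : HasStrictFDerivAt (exp : 𝔸 → 𝔸) (1 : 𝔸 →L[ℝ] 𝔸) (Q 0) := by
    rw [map_zero]; exact hasStrictFDerivAt_exp_zero
  have := (hP.comp 0 P.hasStrictFDerivAt).fun_mul' (hQ.comp 0 Q.hasStrictFDerivAt)
  have hPQ : ∀ X, Q X + P X = X := fun X => by
    simpa [add_comm] using congrArg (fun f : 𝔸 →L[ℝ] 𝔸 => f X) h
  refine this.congr_fderiv ?_
  ext X
  simp [hPQ]

end Generic

attribute [local instance 100] LieRing.ofAssociativeRing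

instance Mat.instSecondCountable {n : ℕ} : SecondCountableTopology (Mat n) :=
  inferInstanceAs (SecondCountableTopology (Fin n → Fin n → ℝ))

section Exp

variable {n : ℕ}

/-- The exponential as an element of `GL(n, ℝ)`. -/
def expGL (X : Mat n) : GL (Fin n) ℝ where
  val := exp X
  inv := exp (-X)
  val_inv := by
    rw [← Matrix.exp_add_of_commute _ _ (Commute.neg_right (Commute.refl X)), add_neg_cancel,
      exp_zero]
  inv_val := by
    rw [← Matrix.exp_add_of_commute _ _ (Commute.neg_left (Commute.refl X)), neg_add_cancel,
      exp_zero]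

@[simp] theorem expGL_val (X : Mat n) : (expGL X : Mat n) = exp X := rfl

theorem expGL_zero : expGL (0 : Mat n) = 1 := Units.ext (by simp)

theorem expGL_add {X Y : Mat n} (h : Commute X Y) : expGL (X + Y) = expGL X * expGL Y :=
  Units.ext (Matrix.exp_add_of_commute X Y h)

theorem expGL_add_smul (X : Mat n) (s t : ℝ) :
    expGL ((s + t) • X) = expGL (s • X) * expGL (t • X) := by
  rw [add_smul]
  exact expGL_add (((Commute.refl X).smul_left s).smul_right t)

theorem expGL_neg (X : Mat n) : expGL (-X) = (expGL X)⁻¹ :=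
  Units.ext rfl

theorem expGL_nsmul (X : Mat n) (k : ℕ) : expGL (k • X) = expGL X ^ k :=
  Units.ext (by simpa using Matrix.exp_nsmul k X)

theorem expGL_zsmul (X : Mat n) (k : ℤ) : expGL (k • X) = expGL X ^ k := by
  obtain ⟨m, rfl | rfl⟩ := k.eq_nat_or_neg
  · simpa using expGL_nsmul X m
  · rw [neg_smul, expGL_neg, natCast_zsmul, expGL_nsmul, zpow_neg, zpow_natCast]

theorem expGL_conj (g : GL (Fin n) ℝ) (X : Mat n) :
    expGL ((g : Mat n) * X * ((g⁻¹ : GL (Fin n) ℝ) : Mat n)) = g * expGL X * g⁻¹ :=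
  Units.ext (exp_units_conj g X)

theorem continuous_exp_mat : Continuous (exp : Mat n → Mat n) :=
  exp_continuous (𝔸 := Mat n)

theorem continuous_expGL : Continuous (expGL : Mat n → GL (Fin n) ℝ) :=
  (Units.isOpenEmbedding_val (R := Mat n)).isInducing.continuous_iff.2 continuous_exp_mat

theorem continuous_expGL_smul (X : Mat n) : Continuous fun t : ℝ => expGL (t • X) :=
  continuous_expGL.comp (by fun_prop)

theorem hasStrictFDerivAt_exp_mat :
    HasStrictFDerivAt (exp : Mat n → Mat n) (1 : Mat n →L[ℝ] Mat n) 0 :=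
  hasStrictFDerivAt_exp_zero

/-- The exponential map is bi-Lipschitz near `0`. -/
theorem exists_exp_biLipschitz : ∃ r > 0, ∀ X ∈ Metric.ball (0 : Mat n) r,
    ∀ Y ∈ Metric.ball (0 : Mat n) r,
      ‖X - Y‖ ≤ 2 * ‖exp X - exp Y‖ ∧ ‖exp X - exp Y‖ ≤ 2 * ‖X - Y‖ := by
  have h := (hasStrictFDerivAt_exp_mat (n := n)).isLittleO.def (c := 1 / 2) (by norm_num)
  rw [nhds_prod_eq] at h
  obtain ⟨s, hs, hs'⟩ := (eventually_prod_self_iff (r := fun X Y : Mat n =>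
    ‖exp X - exp Y - (1 : Mat n →L[ℝ] Mat n) (X - Y)‖ ≤ 1 / 2 * ‖X - Y‖)).1 h
  obtain ⟨r, hr, hrs⟩ := Metric.eventually_nhds_iff_ball.1 hs
  refine ⟨r, hr, fun X hX Y hY => ?_⟩
  have h1 := hs' X (hrs X hX) Y (hrs Y hY)
  simp only [one_apply_eq_self] at h1
  have h2 := norm_sub_norm_le (X - Y) (exp X - exp Y)
  have h3 := norm_sub_norm_le (exp X - exp Y) (X - Y)
  rw [norm_sub_rev (X - Y)] at h2
  constructor <;> linarith

/-- A local logarithm. -/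
theorem exists_log : ∃ L : Mat n → Mat n, L 1 = 0 ∧
    HasStrictFDerivAt L (1 : Mat n →L[ℝ] Mat n) 1 ∧
    (∀ᶠ g in 𝓝 (1 : Mat n), exp (L g) = g) ∧ (∀ᶠ X in 𝓝 (0 : Mat n), L (exp X) = X) := by
  have hf : HasStrictFDerivAt (exp : Mat n → Mat n)
    (ContinuousLinearEquiv.refl ℝ (Mat n) : Mat n →L[ℝ] Mat n) 0 := hasStrictFDerivAt_exp_mat
  have h1 := hf.to_localInverse
  have h2 := hf.eventually_right_inverse
  have h3 := hf.eventually_left_inverse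
  have h4 := hf.localInverse_apply_image
  rw [exp_zero] at h1 h2 h4
  exact ⟨_, h4, h1, h2, h3⟩

end Exp

/-! ### Closed subgroups of `GL(n, ℝ)` -/

section ClosedSubgroup

variable {n : ℕ} {S : Subgroup (GL (Fin n) ℝ)}

/-- The set of `X` with `exp(tX) ∈ S` for all `t`. -/
def tangentSet (S : Subgroup (GL (Fin n) ℝ)) : Set (Mat n) := {X | ∀ t : ℝ, expGL (t • X) ∈ S}

theorem exists_mem_eq_exp_iff (X : Mat n) :
    (∃ s ∈ S, (s : Mat n) = exp X) ↔ expGL X ∈ S := by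
  constructor
  · rintro ⟨s, hs, h⟩
    rwa [← Units.ext (show (s : Mat n) = (expGL X : Mat n) from h)]
  · exact fun h => ⟨_, h, rfl⟩

theorem lieAlg_eq_span : lieAlg S = LieSubalgebra.lieSpan ℝ (Mat n) (tangentSet S) := by
  unfold lieAlg tangentSet
  simp only [exists_mem_eq_exp_iff]

/-- The integer powers `⌊t/ε⌋ • Z` converge to `tX`, their exponentials remain in `S`, and `S` is
closed. -/
theorem mem_tangentSet_of_tendsto (hS : IsClosed (S : Set (GL (Fin n) ℝ))) {ι : Type*}
    {l : Filter ι} [l.NeBot] {Z : ι → Mat n} {ε : ι → ℝ} {X : Mat n}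
    (hε : Tendsto ε l (𝓝[>] 0)) (hZ : ∀ᶠ i in l, expGL (Z i) ∈ S)
    (hX : Tendsto (fun i => (ε i)⁻¹ • Z i) l (𝓝 X)) : X ∈ tangentSet S := by
  intro t
  have hε0 := tendsto_nhdsWithin_iff.1 hε
  have h1 : Tendsto (fun i => (⌊t / ε i⌋ : ℝ) * ε i) l (𝓝 t) := by
    rw [tendsto_iff_norm_sub_tendsto_zero]
    refine squeeze_zero' (Eventually.of_forall fun _ => norm_nonneg _) ?_ hε0.1
    filter_upwards [hε0.2] with i hi
    have hi : 0 < ε i := hi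
    have h2 := Int.floor_le (t / ε i)
    have h3 := Int.lt_floor_add_one (t / ε i)
    rw [le_div_iff₀ hi] at h2
    rw [div_lt_iff₀ hi] at h3
    rw [Real.norm_eq_abs, abs_le]
    constructor <;> linarith
  have h2 : Tendsto (fun i => (⌊t / ε i⌋ : ℤ) • Z i) l (𝓝 (t • X)) := by
    refine (h1.smul hX).congr' ?_
    filter_upwards [hε0.2] with i hi
    have hi : 0 < ε i := hi
    rw [smul_smul, mul_assoc, mul_inv_cancel₀ hi.ne', mul_one, Int.cast_smul_eq_zsmul]
  refine hS.mem_of_tendsto ((continuous_expGL.tendsto _).comp h2) ?_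
  filter_upwards [hZ] with i hi
  simp only [Function.comp, expGL_zsmul]
  exact zpow_mem hi _

theorem zero_mem_tangentSet : (0 : Mat n) ∈ tangentSet S := fun t => by
  rw [smul_zero, expGL_zero]; exact one_mem S

theorem smul_mem_tangentSet (c : ℝ) {X : Mat n} (hX : X ∈ tangentSet S) :
    c • X ∈ tangentSet S := fun t => by
  rw [smul_smul]; exact hX _

/-- The curve `exp(tX) exp(tY)` lies in `S` and its logarithm has derivative `X + Y` at `0`, so its
rescaled logarithms converge to `X + Y`. -/
theorem add_mem_tangentSet (hS : IsClosed (S : Set (GL (Fin n) ℝ))) {X Y : Mat n}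
    (hX : X ∈ tangentSet S) (hY : Y ∈ tangentSet S) : X + Y ∈ tangentSet S := by
  obtain ⟨L, hL1, hLd, hL, -⟩ := exists_log (n := n)
  have hf : HasDerivAt (fun t : ℝ => exp (t • X) * exp (t • Y)) (X + Y) 0 :=
    hasDerivAt_exp_mul_exp' X Y
  have hg : HasDerivAt (fun t : ℝ => L (exp (t • X) * exp (t • Y))) (X + Y) 0 := by
    have : HasFDerivAt L (1 : Mat n →L[ℝ] Mat n)
        (exp ((0 : ℝ) • X) * exp ((0 : ℝ) • Y)) := by
      simpa using hLd.hasFDerivAt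
    exact this.comp_hasDerivAt (0 : ℝ) hf
  have hslope := hasDerivAt_iff_tendsto_slope.1 hg
  refine mem_tangentSet_of_tendsto hS (l := 𝓝[>] (0 : ℝ)) (ε := id) tendsto_id
    (Z := fun t => L (exp (t • X) * exp (t • Y))) ?_ ?_
  · have : Tendsto (fun t : ℝ => exp (t • X) * exp (t • Y)) (𝓝[>] 0) (𝓝 1) := by
      have := hf.continuousAt.tendsto
      simp only [zero_smul, exp_zero, mul_one] at this
      exact this.mono_left nhdsWithin_le_nhds
    filter_upwards [this.eventually hL] with t ht
    have : expGL (L (exp (t • X) * exp (t • Y))) = expGL (t • X) * expGL (t • Y) :=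
      Units.ext ht
    rw [this]
    exact mul_mem (hX t) (hY t)
  · refine (hslope.mono_left (nhdsWithin_mono _ fun t (ht : 0 < t) => ht.ne')).congr fun t => ?_
    simp [slope_def_module, hL1]

theorem conj_mem_tangentSet {g : GL (Fin n) ℝ} (hg : ∀ s ∈ S, g * s * g⁻¹ ∈ S) {X : Mat n}
    (hX : X ∈ tangentSet S) :
    (g : Mat n) * X * ((g⁻¹ : GL (Fin n) ℝ) : Mat n) ∈ tangentSet S := fun t => by
  have := expGL_conj g (t • X)
  rw [mul_smul_comm, smul_mul_assoc] at this
  rw [this]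
  exact hg _ (hX t)

/-- The tangent space of a closed subgroup, as a subspace. -/
def tangentSubmodule (hS : IsClosed (S : Set (GL (Fin n) ℝ))) : Submodule ℝ (Mat n) where
  carrier := tangentSet S
  zero_mem' := zero_mem_tangentSet
  add_mem' := add_mem_tangentSet hS
  smul_mem' c _ := smul_mem_tangentSet c

theorem hasDerivAt_conj_exp (X Y : Mat n) :
    HasDerivAt (fun t : ℝ => exp (t • X) * Y * exp (-(t • X))) ⁅X, Y⁆ 0 :=
  hasDerivAt_conj_exp' X Y

theorem lie_mem_of_conj_mem {V : Submodule ℝ (Mat n)} {X Y : Mat n}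
    (h : ∀ t : ℝ, exp (t • X) * Y * exp (-(t • X)) ∈ V) : ⁅X, Y⁆ ∈ V := by
  have h1 := hasDerivAt_iff_tendsto_slope.1 (hasDerivAt_conj_exp X Y)
  refine V.closed_of_finiteDimensional.mem_of_tendsto h1 (Eventually.of_forall fun t => ?_)
  rw [slope_def_module]
  exact V.smul_mem _ (V.sub_mem (h t) (h 0))

theorem lie_mem_tangentSet (hS : IsClosed (S : Set (GL (Fin n) ℝ))) {X Y : Mat n}
    (hX : X ∈ tangentSet S) (hY : Y ∈ tangentSet S) : ⁅X, Y⁆ ∈ tangentSet S := by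
  refine lie_mem_of_conj_mem (V := tangentSubmodule hS) fun t => ?_
  exact conj_mem_tangentSet (g := expGL (t • X))
    (fun s hs => mul_mem (mul_mem (hX t) hs) (inv_mem (hX t))) hY

theorem mem_lieAlg_iff (hS : IsClosed (S : Set (GL (Fin n) ℝ))) {X : Mat n} :
    X ∈ lieAlg S ↔ ∀ t : ℝ, expGL (t • X) ∈ S := by
  constructor
  · intro h
    let K : LieSubalgebra ℝ (Mat n) :=
      { tangentSubmodule hS with lie_mem' := fun {X Y} hX hY => lie_mem_tangentSet hS hX hY }
    have hK : lieAlg S ≤ K := by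
      rw [lieAlg_eq_span, LieSubalgebra.lieSpan_le]
      exact fun X hX => hX
    exact hK h
  · intro h
    rw [lieAlg_eq_span]
    exact LieSubalgebra.subset_lieSpan h

theorem conj_mem_lieAlg (hS : IsClosed (S : Set (GL (Fin n) ℝ))) {g : GL (Fin n) ℝ} (hg : g ∈ S)
    {X : Mat n} (hX : X ∈ lieAlg S) :
    (g : Mat n) * X * ((g⁻¹ : GL (Fin n) ℝ) : Mat n) ∈ lieAlg S := by
  rw [mem_lieAlg_iff hS] at hX ⊢
  exact conj_mem_tangentSet (fun s hs => mul_mem (mul_mem hg hs) (inv_mem hg)) hX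

/-- Von Neumann's closed subgroup theorem: near `1`, the elements of a closed subgroup are
exponentials of small elements of its Lie algebra. -/
theorem eventually_exists_expGL_eq (hS : IsClosed (S : Set (GL (Fin n) ℝ))) {U : Set (Mat n)}
    (hU : U ∈ 𝓝 0) :
    ∀ᶠ g in 𝓝 (1 : GL (Fin n) ℝ), g ∈ S → ∃ X ∈ lieAlg S, X ∈ U ∧ expGL X = g := by
  set V : Submodule ℝ (Mat n) := (lieAlg S).toSubmodule with hV
  obtain ⟨W, hW⟩ := Submodule.exists_isCompl V
  let P : Mat n →L[ℝ] Mat n := LinearMap.toContinuousLinearMap (V.projection W hW)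
  let Q : Mat n →L[ℝ] Mat n := 1 - P
  have hPQ : P + Q = 1 := add_sub_cancel P 1
  have hP : ∀ X, P X ∈ lieAlg S := fun X => Submodule.projection_apply_mem hW X
  have hQ : ∀ X, Q X ∈ W := fun X => Submodule.sub_projection_mem hW X
  -- Coordinates along `𝔰 = lieAlg S` and a complement `W`; the theorem says that elements of `S`
  -- near `1` have no `W`-coordinate.
  have hd : HasStrictFDerivAt (fun X : Mat n => exp (P X) * exp (Q X))
      (ContinuousLinearEquiv.refl ℝ (Mat n) : Mat n →L[ℝ] Mat n) 0 :=
    hasStrictFDerivAt_exp_mul_exp' hPQ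
  have hone : exp (P 0) * exp (Q 0) = (1 : Mat n) := by simp
  have h1 := hd.to_localInverse
  have h2 := hd.eventually_right_inverse
  have h4 := hd.localInverse_apply_image
  set Ψ : Mat n → Mat n := hd.localInverse _ _ _ with hΨ
  rw [hone] at h1 h2 h4
  have hcoe : Tendsto (fun g : GL (Fin n) ℝ => (g : Mat n)) (𝓝 1) (𝓝 1) :=
    (Units.continuous_val (M := Mat n)).tendsto 1
  have hΨ0 : Tendsto (fun g : GL (Fin n) ℝ => Ψ g) (𝓝 1) (𝓝 0) := by
    have := h1.continuousAt.tendsto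
    rw [h4] at this
    exact this.comp hcoe
  have hPΨ : Tendsto (fun g : GL (Fin n) ℝ => P (Ψ g)) (𝓝 1) (𝓝 0) := by
    have := (P.continuous.tendsto 0).comp hΨ0
    rwa [map_zero] at this
  have hQΨ : Tendsto (fun g : GL (Fin n) ℝ => Q (Ψ g)) (𝓝 1) (𝓝 0) := by
    have := (Q.continuous.tendsto 0).comp hΨ0
    rwa [map_zero] at this
  have hdec : ∀ᶠ g : GL (Fin n) ℝ in 𝓝 1, expGL (P (Ψ (g : Mat n))) * expGL (Q (Ψ (g : Mat n))) = g :=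
    (hcoe.eventually h2).mono fun g hg => Units.ext hg
  by_contra hcon
  have hfreq : ∃ᶠ g in 𝓝 (1 : GL (Fin n) ℝ), g ∈ S ∧ Q (Ψ g) ≠ 0 := by
    refine (Filter.not_eventually.1 hcon).mp ?_
    filter_upwards [hdec, hPΨ.eventually hU] with g hg hgU hbad
    rw [Classical.not_imp] at hbad
    refine ⟨hbad.1, fun h0 => hbad.2 ⟨P (Ψ g), hP _, hgU, ?_⟩⟩
    rw [h0, expGL_zero, mul_one] at hg
    exact hg
  rw [Filter.frequently_iff_neBot] at hfreq
  -- Otherwise elements of `S` with nonzero `W`-part accumulate at `1`. Along an ultrafilter the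
  -- normalized `W`-parts converge on the unit sphere, to a direction lying both in `W` and in
  -- `lieAlg S`.
  let u : Ultrafilter (GL (Fin n) ℝ) := Ultrafilter.of (𝓝 1 ⊓ 𝓟 {g | g ∈ S ∧ Q (Ψ g) ≠ 0})
  have hu : (u : Filter (GL (Fin n) ℝ)) ≤ 𝓝 1 ⊓ 𝓟 {g | g ∈ S ∧ Q (Ψ g) ≠ 0} :=
    Ultrafilter.of_le _
  have hu1 : (u : Filter (GL (Fin n) ℝ)) ≤ 𝓝 1 := hu.trans inf_le_left
  have hu2 : ∀ᶠ g in (u : Filter (GL (Fin n) ℝ)), g ∈ S ∧ Q (Ψ g) ≠ 0 :=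
    hu (Filter.mem_inf_of_right (mem_principal_self _))
  let D : GL (Fin n) ℝ → Mat n := fun g => ‖Q (Ψ g)‖⁻¹ • Q (Ψ g)
  have hDs : ∀ᶠ g in (u : Filter (GL (Fin n) ℝ)), D g ∈ Metric.sphere (0 : Mat n) 1 := by
    filter_upwards [hu2] with g hg
    have h0 : ‖Q (Ψ g)‖ ≠ 0 := norm_ne_zero_iff.2 hg.2
    rw [mem_sphere_zero_iff_norm, norm_smul, norm_inv, norm_norm, inv_mul_cancel₀ h0]
  obtain ⟨Z, hZ, hDZ⟩ := (isCompact_sphere (0 : Mat n) 1).ultrafilter_le_nhds (u.map D)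
    (le_principal_iff.2 hDs)
  have hDZ' : Tendsto D (u : Filter (GL (Fin n) ℝ)) (𝓝 Z) := hDZ
  have hZW : Z ∈ W := by
    refine W.closed_of_finiteDimensional.mem_of_tendsto (b := (u : Filter (GL (Fin n) ℝ)))
      (f := D) hDZ' (Eventually.of_forall fun g => W.smul_mem _ (hQ _))
  have hZV : Z ∈ lieAlg S := by
    rw [mem_lieAlg_iff hS]
    refine mem_tangentSet_of_tendsto hS (l := (u : Filter (GL (Fin n) ℝ)))
      (ε := fun g => ‖Q (Ψ g)‖) (Z := fun g => Q (Ψ g)) ?_ ?_ hDZ'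
    · refine tendsto_nhdsWithin_iff.2 ⟨?_, ?_⟩
      · simpa using (hQΨ.mono_left hu1).norm
      · filter_upwards [hu2] with g hg using norm_pos_iff.2 hg.2
    · filter_upwards [hu2, hu1 hdec] with g hg hg'
      have : expGL (Q (Ψ g)) = (expGL (P (Ψ g)))⁻¹ * g := by
        rw [eq_inv_mul_iff_mul_eq]; exact hg'
      rw [this]
      have h3 := (mem_lieAlg_iff hS).1 (hP (Ψ g)) 1
      rw [one_smul] at h3
      exact mul_mem (inv_mem h3) hg.1
  have : Z = 0 := by
    have := hW.disjoint.le_bot (show Z ∈ V ⊓ W from ⟨hZV, hZW⟩)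
    simpa using this
  rw [this] at hZ
  simp at hZ

end ClosedSubgroup

end RealSpherical
end

noncomputable section

open MeasureTheory NormedSpace Filter
open scoped Pointwise Topology Matrix.Norms.Operator

set_option linter.unusedSectionVars false

namespace RealSpherical

attribute [local instance 100] LieRing.ofAssociativeRing

/-! ### Homomorphisms to `GL(n, ℝ)` that are closed with finite kernel -/

/-- A continuous closed homomorphism to `GL(n, ℝ)` with finite kernel. -/
structure IsFiniteClosedHom {n : ℕ} {Γ : Type*} [Group Γ] [TopologicalSpace Γ]
    (q : Γ →* GL (Fin n) ℝ) : Prop where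
  continuous : Continuous q
  isClosedMap : IsClosedMap q
  finite_ker : Finite q.ker

instance GL.instSecondCountable {n : ℕ} : SecondCountableTopology (GL (Fin n) ℝ) :=
  (Units.isOpenEmbedding_val (R := Mat n)).isInducing.secondCountableTopology

/-! ### Lie algebras of images of subgroups. -/

section LieOf

variable {n : ℕ} {Γ : Type*} [Group Γ] {q : Γ →* GL (Fin n) ℝ}

theorem lieOf_top_eq : lieOf q ⊤ = lieAlg q.range := by
  rw [lieOf, MonoidHom.range_eq_map]

theorem lieOf_comp_subtype (H : Subgroup Γ) : lieOf (q.comp H.subtype) ⊤ = lieOf q H := by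
  rw [lieOf_top_eq, MonoidHom.range_comp, Subgroup.range_subtype, lieOf]

theorem lieOf_mono {H K : Subgroup Γ} (h : H ≤ K) : lieOf q H ≤ lieOf q K := by
  rw [lieOf, lieOf, lieAlg_eq_span, lieAlg_eq_span]
  exact LieSubalgebra.lieSpan_mono fun X hX t => Subgroup.map_mono h (hX t)

end LieOf

section FiniteClosedHom

variable {n : ℕ} {Γ : Type*} [Group Γ] [TopologicalSpace Γ] [IsTopologicalGroup Γ] [T2Space Γ]
  {q : Γ →* GL (Fin n) ℝ}

theorem IsFiniteClosedHom.isClosed_range (hq : IsFiniteClosedHom q) :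
    IsClosed (q.range : Set (GL (Fin n) ℝ)) := by
  rw [MonoidHom.coe_range]
  exact hq.isClosedMap.isClosed_range

/-- Near `1`, products are determined by their images. -/
theorem IsFiniteClosedHom.exists_separating (hq : IsFiniteClosedHom q) :
    ∃ U : Set Γ, IsOpen U ∧ 1 ∈ U ∧
      ∀ x ∈ U, ∀ y ∈ U, ∀ z ∈ U, q x * q y = q z → x * y = z := by
  have hfin : (q.ker : Set Γ).Finite := hq.finite_ker
  -- Finiteness of the kernel isolates `1` in it; `U` is so small that `x * y * z⁻¹` avoids the
  -- other kernel elements.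
  have hO : ((q.ker : Set Γ) \ {1})ᶜ ∈ 𝓝 (1 : Γ) :=
    (hfin.subset Set.sdiff_subset).isClosed.isOpen_compl.mem_nhds (by simp)
  have hcont : Tendsto (fun x : Γ × Γ × Γ => x.1 * x.2.1 * x.2.2⁻¹) (𝓝 (1, 1, 1)) (𝓝 1) := by
    have : Continuous (fun x : Γ × Γ × Γ => x.1 * x.2.1 * x.2.2⁻¹) := by fun_prop
    simpa using this.tendsto (1, 1, 1)
  have h := hcont hO
  rw [nhds_prod_eq, nhds_prod_eq] at h
  obtain ⟨A, hA, B, hB, hAB⟩ := mem_prod_iff.1 (mem_map.1 h)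
  obtain ⟨B1, hB1, B2, hB2, hBB⟩ := mem_prod_iff.1 hB
  obtain ⟨U, hUs, hUo, hU1⟩ := mem_nhds_iff.1 (inter_mem hA (inter_mem hB1 hB2))
  refine ⟨U, hUo, hU1, fun x hx y hy z hz hxyz => ?_⟩
  have h1 := hAB (show (x, y, z) ∈ A ×ˢ B from
    ⟨(hUs hx).1, hBB ⟨(hUs hy).2.1, (hUs hz).2.2⟩⟩)
  have h2 : x * y * z⁻¹ ∈ q.ker := by
    rw [MonoidHom.mem_ker, map_mul, map_mul, map_inv, hxyz, mul_inv_cancel]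
  by_contra hne
  exact h1 ⟨h2, fun h3 => hne (mul_inv_eq_one.1 h3)⟩

theorem injOn_of_separating {U : Set Γ} (hU1 : 1 ∈ U)
    (hU : ∀ x ∈ U, ∀ y ∈ U, ∀ z ∈ U, q x * q y = q z → x * y = z) : Set.InjOn q U := by
  intro x hx y hy hxy
  have := hU x hx 1 hU1 y hy (by rw [map_one, mul_one, hxy])
  rwa [mul_one] at this

/-- The complement of the open saturated set `U * ker q` has closed image, and that image misses
`1`. This substitutes for openness of `q` onto its range. -/
theorem IsFiniteClosedHom.eventually_exists_mem (hq : IsFiniteClosedHom q) {U : Set Γ}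
    (hU : U ∈ 𝓝 1) :
    ∀ᶠ g in 𝓝 (1 : GL (Fin n) ℝ), ∀ x, q x = g → ∃ u ∈ U, q u = g ∧ u⁻¹ * x ∈ q.ker := by
  obtain ⟨U', hU'U, hU'o, hU'1⟩ := mem_nhds_iff.1 hU
  have hopen : IsOpen (U' * (q.ker : Set Γ)) := hU'o.mul_right
  have hcl := hq.isClosedMap _ hopen.isClosed_compl
  have h1 : (1 : GL (Fin n) ℝ) ∉ q '' (U' * (q.ker : Set Γ))ᶜ := by
    rintro ⟨x, hx, hx1⟩
    exact hx ⟨1, hU'1, x, hx1, one_mul x⟩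
  filter_upwards [hcl.isOpen_compl.mem_nhds h1] with g hg x hx
  have : x ∈ U' * (q.ker : Set Γ) := by
    by_contra hx'
    exact hg ⟨x, hx', hx⟩
  obtain ⟨u, hu, k, hk, rfl⟩ := this
  have hk' : q k = 1 := hk
  refine ⟨u, hU'U hu, ?_, ?_⟩
  · rw [← hx, map_mul, hk', mul_one]
  · rw [inv_mul_cancel_left]; exact hk

/-- Lifting of one-parameter subgroups. -/
theorem IsFiniteClosedHom.exists_oneParameter (hq : IsFiniteClosedHom q) {X : Mat n}
    (hX : ∀ t : ℝ, expGL (t • X) ∈ q.range) :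
    ∃ c : ContinuousMonoidHom (Multiplicative ℝ) Γ,
      ∀ t : ℝ, q (c (Multiplicative.ofAdd t)) = expGL (t • X) := by
  obtain ⟨U, hUo, hU1, hU⟩ := hq.exists_separating
  have hinj := injOn_of_separating hU1 hU
  have hE : Tendsto (fun t : ℝ => expGL (t • X)) (𝓝 0) (𝓝 1) := by
    have := (continuous_expGL_smul X).tendsto 0
    rwa [zero_smul, expGL_zero] at this
  have hsmall : ∀ U' ∈ 𝓝 (1 : Γ), ∀ᶠ t in 𝓝 (0 : ℝ), ∃ u ∈ U', q u = expGL (t • X) := by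
    intro U' hU'
    filter_upwards [hE.eventually (hq.eventually_exists_mem hU')] with t ht
    obtain ⟨x, hx⟩ := hX t
    obtain ⟨u, hu, hu', -⟩ := ht x hx
    exact ⟨u, hu, hu'⟩
  obtain ⟨δ, hδ, hδU⟩ := Metric.eventually_nhds_iff_ball.1 (hsmall U (hUo.mem_nhds hU1))
  have hδU : ∀ t : ℝ, |t| < δ → ∃ u ∈ U, q u = expGL (t • X) := fun t ht =>
    hδU t (by rwa [Metric.mem_ball, Real.dist_eq, sub_zero])
  -- Lifts inside the separating neighbourhood form a local homomorphism `w` on `(-δ, δ)`, which is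
  -- then extended to the line by taking powers.
  choose! w hwU hwq using hδU
  have hadd : ∀ s t : ℝ, |s| < δ → |t| < δ → |s + t| < δ → w s * w t = w (s + t) := by
    intro s t hs ht hst
    refine hU _ (hwU s hs) _ (hwU t ht) _ (hwU _ hst) ?_
    rw [hwq s hs, hwq t ht, hwq _ hst, expGL_add_smul]
  have hw0 : w 0 = 1 := by
    have h0 : |(0 : ℝ)| < δ := by simpa using hδ
    have := hadd 0 0 h0 h0 (by simpa using hδ)
    rw [add_zero] at this
    exact mul_eq_left.1 this
  have hpow : ∀ (s : ℝ) (N : ℕ), (N : ℝ) * |s| < δ → w (N * s) = w s ^ N := by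
    intro s N
    induction N with
    | zero => intro _; simp [hw0]
    | succ N ih =>
      intro h
      have hs0 := abs_nonneg s
      have hN0 : (0 : ℝ) ≤ N := Nat.cast_nonneg N
      push_cast at h ⊢
      have h1 : (N : ℝ) * |s| < δ := by nlinarith
      rw [pow_succ, ← ih h1, hadd _ _ (by rw [abs_mul, Nat.abs_cast]; exact h1) (by nlinarith), add_mul,
        one_mul]
      rw [show (N : ℝ) * s + s = (N + 1 : ℝ) * s by ring, abs_mul, abs_of_nonneg (by positivity)]
      exact h
  -- Two subdivisions of `t` are compared through their common refinement into `N * M` pieces.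
  have hindep : ∀ (t : ℝ) (N M : ℕ), 0 < N → 0 < M → |t| < N * δ → |t| < M * δ →
      w (t / N) ^ N = w (t / M) ^ M := by
    have key : ∀ (t : ℝ) (N M : ℕ), 0 < N → 0 < M → |t| < N * δ →
        w (t / N) ^ N = w (t / (N * M : ℕ)) ^ (N * M) := by
      intro t N M hN hM h
      have hN' : (0 : ℝ) < N := Nat.cast_pos.2 hN
      have hM' : (0 : ℝ) < M := Nat.cast_pos.2 hM
      have h1 : t / N = M * (t / (N * M : ℕ)) := by push_cast; field_simp
      rw [h1, hpow, ← pow_mul, mul_comm N M]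
      rw [abs_div, Nat.abs_cast]
      push_cast
      rw [show (M : ℝ) * (|t| / (N * M)) = |t| / N by field_simp, div_lt_iff₀ hN', mul_comm]
      exact h
    intro t N M hN hM h1 h2
    rw [key t N M hN hM h1, key t M N hM hN h2, mul_comm N M]
  -- The added `1` makes `|t| < ν t * δ` strict, and `ν t` nonzero when `t = 0`.
  let ν : ℝ → ℕ := fun t => ⌊|t| / δ⌋₊ + 1
  have hν0 : ∀ t, 0 < ν t := fun t => Nat.succ_pos _
  have hν : ∀ t, |t| < ν t * δ := by
    intro t
    have := Nat.lt_floor_add_one (|t| / δ)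
    rw [div_lt_iff₀ hδ] at this
    simpa [ν] using this
  let c : ℝ → Γ := fun t => w (t / ν t) ^ ν t
  have hc : ∀ (t : ℝ) (N : ℕ), 0 < N → |t| < N * δ → c t = w (t / N) ^ N := fun t N hN h =>
    hindep t (ν t) N (hν0 t) hN (hν t) h
  have hcadd : ∀ s t, c (s + t) = c s * c t := by
    intro s t
    let N := ν s + ν t + ν (s + t)
    have hN : 0 < N := by have := hν0 s; omega
    have hN' : (0 : ℝ) < N := Nat.cast_pos.2 hN
    have hle : ∀ x, ν x ≤ N → |x| < N * δ := fun x hx =>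
      (hν x).trans_le (mul_le_mul_of_nonneg_right (Nat.cast_le.2 hx) hδ.le)
    have hs := hle s (by omega)
    have ht := hle t (by omega)
    have hst := hle (s + t) (by omega)
    have hd : ∀ x, |x| < N * δ → |x / N| < δ := fun x hx => by
      rw [abs_div, Nat.abs_cast, div_lt_iff₀ hN', mul_comm]; exact hx
    rw [hc s N hN hs, hc t N hN ht, hc _ N hN hst, add_div]
    have h1 := hadd (s / N) (t / N) (hd s hs) (hd t ht) (by rw [← add_div]; exact hd _ hst)
    have h2 := hadd (t / N) (s / N) (hd t ht) (hd s hs)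
      (by rw [← add_div, add_comm]; exact hd _ hst)
    rw [← h1]
    exact Commute.mul_pow (by rw [commute_iff_eq, h1, h2, add_comm]) N
  have hcq : ∀ t, q (c t) = expGL (t • X) := by
    intro t
    have h0 : (0 : ℝ) < ν t := Nat.cast_pos.2 (hν0 t)
    have hd : |t / ν t| < δ := by
      rw [abs_div, Nat.abs_cast, div_lt_iff₀ h0, mul_comm]; exact hν t
    simp only [c]
    rw [map_pow, hwq _ hd, ← expGL_nsmul, ← Nat.cast_smul_eq_nsmul ℝ, smul_smul,
      mul_div_cancel₀ _ h0.ne']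
  let c' : Multiplicative ℝ →* Γ := MonoidHom.mk' (fun t => c t.toAdd) fun s t => hcadd _ _
  have hc'cont : Continuous c' := by
    refine continuous_of_continuousAt_one c' ?_
    rw [ContinuousAt, map_one]
    intro U' hU'
    have h1 := hsmall (U' ∩ U) (inter_mem hU' (hUo.mem_nhds hU1))
    have h2 : ∀ᶠ t in 𝓝 (0 : ℝ), |t| < δ := by
      have := Metric.ball_mem_nhds (0 : ℝ) hδ
      filter_upwards [this] with t ht
      rwa [Metric.mem_ball, Real.dist_eq, sub_zero] at ht
    have h3 : ∀ᶠ t in 𝓝 (0 : ℝ), c t ∈ U' := by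
      filter_upwards [h1, h2] with t ⟨u, hu, hqu⟩ ht
      have : c t = w t := by
        have := hc t 1 one_pos (by simpa using ht)
        simpa using this
      rw [this, hinj (hwU t ht) hu.2 (by rw [hwq t ht, hqu])]
      exact hu.1
    exact h3
  exact ⟨⟨c', hc'cont⟩, hcq⟩

/-- Local injectivity of `q` gives agreement near `0`, and every `t` is a multiple of an arbitrarily
small one. Hence the choice made in `gexp` is harmless. -/
theorem IsFiniteClosedHom.oneParameter_unique (hq : IsFiniteClosedHom q)
    {c d : ContinuousMonoidHom (Multiplicative ℝ) Γ}
    (h : ∀ t, q (c t) = q (d t)) : c = d := by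
  obtain ⟨U, hUo, hU1, hU⟩ := hq.exists_separating
  have hinj := injOn_of_separating hU1 hU
  have hev : ∀ e : ContinuousMonoidHom (Multiplicative ℝ) Γ,
      ∀ᶠ t in 𝓝 (0 : ℝ), e (Multiplicative.ofAdd t) ∈ U := by
    intro e
    have h1 : Continuous fun t : ℝ => e (Multiplicative.ofAdd t) :=
      e.continuous_toFun.comp continuous_ofAdd
    exact h1.continuousAt.eventually_mem (by
      rw [ofAdd_zero, map_one]; exact hUo.mem_nhds hU1)
  obtain ⟨δ, hδ, hδU⟩ := Metric.eventually_nhds_iff_ball.1 ((hev c).and (hev d))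
  ext t
  obtain ⟨N, hN⟩ := exists_nat_gt (|t.toAdd| / δ)
  have hN0 : (0 : ℝ) < N := lt_of_le_of_lt (by positivity) hN
  have h1 : t = (Multiplicative.ofAdd (t.toAdd / N)) ^ N := by
    rw [← ofAdd_nsmul, nsmul_eq_mul, mul_div_cancel₀ _ hN0.ne', ofAdd_toAdd]
  have h2 := hδU (t.toAdd / N) (by
    rw [Metric.mem_ball, Real.dist_eq, sub_zero, abs_div, Nat.abs_cast, div_lt_iff₀ hN0]
    rwa [div_lt_iff₀ hδ, mul_comm] at hN)
  rw [h1, map_pow, map_pow, hinj h2.1 h2.2 (h _)]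

theorem gexp_eq (hq : IsFiniteClosedHom q) {X : Mat n}
    (c : ContinuousMonoidHom (Multiplicative ℝ) Γ)
    (hc : ∀ t : ℝ, q (c (Multiplicative.ofAdd t)) = expGL (t • X)) :
    gexp q X = c (Multiplicative.ofAdd 1) := by
  have h : ∃ c : ContinuousMonoidHom (Multiplicative ℝ) Γ,
      ∀ t : ℝ, (q (c (Multiplicative.ofAdd t)) : Mat n) = exp (t • X) :=
    ⟨c, fun t => congrArg Units.val (hc t)⟩
  rw [gexp, dif_pos h]
  congr 1
  refine hq.oneParameter_unique fun t => ?_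
  have h1 : (q (h.choose t) : Mat n) = exp (t.toAdd • X) := h.choose_spec t.toAdd
  have h2 : q (c t) = expGL (t.toAdd • X) := hc t.toAdd
  rw [h2]
  exact Units.ext h1

theorem IsFiniteClosedHom.mem_lieOf_iff (hq : IsFiniteClosedHom q) {X : Mat n} :
    X ∈ lieOf q ⊤ ↔ ∀ t : ℝ, expGL (t • X) ∈ q.range := by
  rw [lieOf_top_eq, mem_lieAlg_iff hq.isClosed_range]

theorem IsFiniteClosedHom.exists_gexp_smul (hq : IsFiniteClosedHom q) {X : Mat n}
    (hX : X ∈ lieOf q ⊤) :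
    ∃ c : ContinuousMonoidHom (Multiplicative ℝ) Γ,
      ∀ t : ℝ, q (c (Multiplicative.ofAdd t)) = expGL (t • X) ∧
        gexp q (t • X) = c (Multiplicative.ofAdd t) := by
  obtain ⟨c, hc⟩ := hq.exists_oneParameter (hq.mem_lieOf_iff.1 hX)
  refine ⟨c, fun t => ⟨hc t, ?_⟩⟩
  let m : ContinuousMonoidHom (Multiplicative ℝ) (Multiplicative ℝ) :=
    { toFun := fun s => Multiplicative.ofAdd (s.toAdd * t)
      map_one' := by simp
      map_mul' := fun a b => by rw [toAdd_mul, add_mul, ofAdd_add]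
      continuous_toFun := continuous_ofAdd.comp (continuous_toAdd.mul continuous_const) }
  have := gexp_eq hq (X := t • X) (c.comp m) fun s => by
    rw [smul_smul]; exact hc (s * t)
  rw [this]
  change c (Multiplicative.ofAdd (1 * t)) = _
  rw [one_mul]

theorem map_gexp (hq : IsFiniteClosedHom q) {X : Mat n} (hX : X ∈ lieOf q ⊤) :
    q (gexp q X) = expGL X := by
  obtain ⟨c, hc⟩ := hq.exists_gexp_smul hX
  have := hc 1
  rw [one_smul] at this
  rw [this.2, this.1]

theorem gexp_zsmul (hq : IsFiniteClosedHom q) {X : Mat n} (hX : X ∈ lieOf q ⊤) (k : ℤ) :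
    gexp q ((k : ℝ) • X) = gexp q X ^ k := by
  obtain ⟨c, hc⟩ := hq.exists_gexp_smul hX
  have := (hc 1).2
  rw [one_smul] at this
  rw [(hc k).2, this, ← map_zpow, ← ofAdd_zsmul, zsmul_eq_mul, mul_one]

theorem conj_gexp (hq : IsFiniteClosedHom q) {X : Mat n} (hX : X ∈ lieOf q ⊤) (a : Γ) :
    a * gexp q X * a⁻¹ = gexp q ((q a : Mat n) * X * (((q a)⁻¹ : GL (Fin n) ℝ) : Mat n)) := by
  obtain ⟨c, hc⟩ := hq.exists_gexp_smul hX
  let m : ContinuousMonoidHom (Multiplicative ℝ) Γ :=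
    { toFun := fun s => a * c s * a⁻¹
      map_one' := by simp
      map_mul' := fun s t => by simp [mul_assoc]
      continuous_toFun := (continuous_const.mul c.continuous_toFun).mul continuous_const }
  have h1 := (hc 1).2
  rw [one_smul] at h1
  rw [h1, gexp_eq hq m fun t => ?_]
  · rfl
  · change q (a * c _ * a⁻¹) = _
    rw [map_mul, map_mul, map_inv, (hc t).1, ← expGL_conj, mul_smul_comm, smul_mul_assoc]

theorem gexp_add (hq : IsFiniteClosedHom q) {X Y : Mat n} (hX : X ∈ lieOf q ⊤)
    (hY : Y ∈ lieOf q ⊤) (hXY : Commute X Y) : gexp q (X + Y) = gexp q X * gexp q Y := by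
  obtain ⟨c, hc⟩ := hq.exists_gexp_smul hX
  obtain ⟨d, hd⟩ := hq.exists_gexp_smul hY
  have hcomm : ∀ s t : ℝ, c (Multiplicative.ofAdd s) * d (Multiplicative.ofAdd t) =
      d (Multiplicative.ofAdd t) * c (Multiplicative.ofAdd s) := by
    intro s t
    rw [← mul_inv_eq_iff_eq_mul, ← (hd t).2, conj_gexp hq ((lieOf q ⊤).smul_mem t hY), (hc s).1]
    congr 1
    have h1 : Commute (expGL (s • X) : Mat n) (t • Y) := by
      have h2 : expGL (s • X) * expGL (0 : Mat n) = expGL (s • X) := by rw [expGL_zero, mul_one]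
      exact (((hXY.smul_left s).smul_right t).symm.exp_right).symm
    rw [h1.eq, mul_assoc, Units.mul_inv, mul_one]
  let m : ContinuousMonoidHom (Multiplicative ℝ) Γ :=
    { toFun := fun s => c s * d s
      map_one' := by simp
      map_mul' := fun s t => by
        have := hcomm t.toAdd s.toAdd
        simp only [ofAdd_toAdd] at this
        rw [map_mul, map_mul, mul_assoc, ← mul_assoc (c t), this]
        simp only [mul_assoc]
      continuous_toFun := c.continuous_toFun.mul d.continuous_toFun }
  have h1 := (hc 1).2
  have h2 := (hd 1).2
  rw [one_smul] at h1 h2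
  rw [h1, h2, gexp_eq hq m fun t => ?_]
  · rfl
  · change q (c _ * d _) = _
    rw [map_mul, (hc t).1, (hd t).1, smul_add, expGL_add ((hXY.smul_left t).smul_right t)]

/-- A discrete continuity argument along `exp(tX)`: after each short step the separation property
identifies the new point with the lift that lies in `U`, so the one-parameter group never changes
sheet. -/
theorem gexp_mem_of_forall (hq : IsFiniteClosedHom q) {U : Set Γ} (hUn : U ∈ 𝓝 1)
    (hU : ∀ x ∈ U, ∀ y ∈ U, ∀ z ∈ U, q x * q y = q z → x * y = z) {X : Mat n}
    (hX : X ∈ lieOf q ⊤) (h : ∀ t ∈ Set.Icc (0 : ℝ) 1, ∃ u ∈ U, q u = expGL (t • X)) :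
    gexp q X ∈ U := by
  have hU1 : (1 : Γ) ∈ U := mem_of_mem_nhds hUn
  have hinj := injOn_of_separating hU1 hU
  choose! v hvU hvq using h
  obtain ⟨c, hc⟩ := hq.exists_gexp_smul hX
  have h1 : Continuous fun t : ℝ => c (Multiplicative.ofAdd t) :=
    c.continuous_toFun.comp continuous_ofAdd
  have h2 : ∀ᶠ t in 𝓝 (0 : ℝ), c (Multiplicative.ofAdd t) ∈ U :=
    h1.continuousAt.eventually_mem (by rw [ofAdd_zero, map_one]; exact hUn)
  have h3 : Tendsto (fun N : ℕ => 1 / ((N : ℝ) + 1)) atTop (𝓝 0) :=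
    tendsto_one_div_add_atTop_nhds_zero_nat
  obtain ⟨N, hN⟩ := (h3.eventually h2).exists
  have hN0 : (0 : ℝ) < (N : ℝ) + 1 := by positivity
  set s : ℝ := 1 / ((N : ℝ) + 1) with hs
  have hs0 : 0 < s := by positivity
  have key : ∀ j : ℕ, j ≤ N + 1 → c (Multiplicative.ofAdd (j * s)) ∈ U := by
    intro j
    induction j with
    | zero => intro _; simpa using hU1
    | succ j ih =>
      intro hj
      have hj' : ((j + 1 : ℕ) : ℝ) * s ∈ Set.Icc (0 : ℝ) 1 := by
        refine ⟨by positivity, ?_⟩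
        rw [hs, mul_one_div, div_le_one hN0]
        exact_mod_cast hj
      have h4 : c (Multiplicative.ofAdd (((j + 1 : ℕ) : ℝ) * s)) =
          c (Multiplicative.ofAdd (j * s)) * c (Multiplicative.ofAdd s) := by
        rw [← map_mul, ← ofAdd_add]
        congr 2
        push_cast
        ring
      rw [h4, hU _ (ih (by omega)) _ hN _ (hvU _ hj')]
      · exact hvU _ hj'
      · rw [← map_mul, ← h4, (hc _).1, hvq _ hj']
  have h5 := key (N + 1) le_rfl
  have h6 := (hc 1).2
  rw [one_smul] at h6
  rw [h6]
  convert h5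
  rw [hs]
  push_cast
  rw [mul_one_div_cancel hN0.ne']

theorem IsFiniteClosedHom.eventually_gexp_mem (hq : IsFiniteClosedHom q) {U : Set Γ}
    (hU : U ∈ 𝓝 1) : ∀ᶠ X in 𝓝 (0 : Mat n), X ∈ lieOf q ⊤ → gexp q X ∈ U := by
  obtain ⟨W, hWo, hW1, hW⟩ := hq.exists_separating
  have hUW : U ∩ W ∈ 𝓝 (1 : Γ) := inter_mem hU (hWo.mem_nhds hW1)
  have hE : Tendsto (expGL : Mat n → GL (Fin n) ℝ) (𝓝 0) (𝓝 1) := by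
    have := (continuous_expGL (n := n)).tendsto 0
    rwa [expGL_zero] at this
  obtain ⟨r, hr, hrU⟩ := Metric.eventually_nhds_iff_ball.1
    (hE.eventually (hq.eventually_exists_mem hUW))
  filter_upwards [Metric.ball_mem_nhds (0 : Mat n) hr] with X hXr hX
  refine (gexp_mem_of_forall hq hUW (fun x hx y hy z hz => hW x hx.2 y hy.2 z hz.2) hX ?_).1
  intro t ht
  obtain ⟨x, hx⟩ := hq.mem_lieOf_iff.1 hX t
  have htX : t • X ∈ Metric.ball (0 : Mat n) r := by
    rw [mem_ball_zero_iff] at hXr ⊢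
    rw [norm_smul, Real.norm_eq_abs, abs_of_nonneg ht.1]
    exact (mul_le_of_le_one_left (norm_nonneg _) ht.2).trans_lt hXr
  obtain ⟨u, hu, hu', -⟩ := hrU (t • X) htX x hx
  exact ⟨u, hu, hu'⟩

/-- The closed subgroup theorem for the range of `q`, lifted through the neighbourhood on which `q`
is injective. -/
theorem IsFiniteClosedHom.eventually_exists_gexp (hq : IsFiniteClosedHom q) {U : Set (Mat n)}
    (hU : U ∈ 𝓝 0) : ∀ᶠ x in 𝓝 (1 : Γ), ∃ X ∈ lieOf q ⊤, X ∈ U ∧ gexp q X = x := by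
  obtain ⟨W, hWo, hW1, hW⟩ := hq.exists_separating
  have hinj := injOn_of_separating hW1 hW
  have h1 : Tendsto q (𝓝 1) (𝓝 1) := by
    have := hq.continuous.tendsto 1
    rwa [map_one] at this
  have h2 := hq.eventually_gexp_mem (hWo.mem_nhds hW1)
  filter_upwards [h1.eventually (eventually_exists_expGL_eq hq.isClosed_range (inter_mem hU h2)),
    hWo.mem_nhds hW1] with x hx hxW
  obtain ⟨X, hX, hXU, hXx⟩ := hx ⟨x, rfl⟩
  rw [← lieOf_top_eq] at hX
  exact ⟨X, hX, hXU.1, hinj (hXU.2 hX) hxW (by rw [map_gexp hq hX, hXx])⟩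

/-! ### Topology of the source -/

/-- Near `1` the map `q` is a topological embedding into the second countable group `GL(n, ℝ)`.
Countably many translates of this neighbourhood cover: lifts of a dense subset of the range,
corrected by the finite kernel. -/
theorem IsFiniteClosedHom.secondCountableTopology (hq : IsFiniteClosedHom q) :
    SecondCountableTopology Γ := by
  obtain ⟨U, hUo, hU1, hU⟩ := hq.exists_separating
  have hinj := injOn_of_separating hU1 hU
  have hUn := hUo.mem_nhds hU1
  have hind : Topology.IsInducing (fun u : U => q u) := by
    rw [Topology.isInducing_iff_nhds]
    intro u
    refine le_antisymm ?_ ?_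
    · exact ((hq.continuous.comp continuous_subtype_val).tendsto u).le_comap
    · intro A hA
      rw [nhds_subtype_eq_comap] at hA
      obtain ⟨A', hA', hAA'⟩ := mem_comap.1 hA
      have h1 : (fun x : Γ => (u : Γ) * x) ⁻¹' (A' ∩ U) ∈ 𝓝 (1 : Γ) := by
        refine (continuous_const_mul (u : Γ)).continuousAt.preimage_mem_nhds ?_
        rw [mul_one]
        exact inter_mem hA' (hUo.mem_nhds u.2)
      have h2 : Tendsto (fun g : GL (Fin n) ℝ => (q u)⁻¹ * g) (𝓝 (q u)) (𝓝 1) := by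
        have := (continuous_const_mul ((q u)⁻¹)).tendsto (q u)
        rwa [inv_mul_cancel] at this
      refine mem_comap.2 ⟨_, h2.eventually (hq.eventually_exists_mem h1), ?_⟩
      intro x hx
      obtain ⟨v, hv, hqv, -⟩ := hx ((u : Γ)⁻¹ * x) (by rw [map_mul, map_inv])
      have : (x : Γ) = u * v := hinj x.2 hv.2 (by rw [map_mul, hqv, mul_inv_cancel_left])
      exact hAA' (by rw [Set.mem_preimage, this]; exact hv.1)
  have hUsc : SecondCountableTopology U := hind.secondCountableTopology
  have hrange : SecondCountableTopology (q.range : Set (GL (Fin n) ℝ)) := inferInstance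
  obtain ⟨D, hDc, hDd⟩ := TopologicalSpace.exists_countable_dense (q.range : Set (GL (Fin n) ℝ))
  have hker : Finite q.ker := hq.finite_ker
  choose lift hlift using fun g : (q.range : Set (GL (Fin n) ℝ)) => g.2
  have hDcount : Countable D := hDc
  let T : D × q.ker → Γ ≃ₜ Γ := fun i =>
    (Homeomorph.mulLeft (lift i.1)).trans (Homeomorph.mulRight (i.2 : Γ))
  have hsc : ∀ i, SecondCountableTopology (T i '' U) := fun i =>
    ((T i).image U).symm.isInducing.secondCountableTopology
  refine TopologicalSpace.secondCountableTopology_of_countable_cover (U := fun i => T i '' U)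
    (fun i => (T i).isOpenMap _ hUo) ?_
  rw [Set.eq_univ_iff_forall]
  intro x
  have h2 : Tendsto (fun g : (q.range : Set (GL (Fin n) ℝ)) => (g : GL (Fin n) ℝ)⁻¹ * q x) (𝓝 ⟨q x, x, rfl⟩) (𝓝 1) := by
    have : Continuous (fun g : (q.range : Set (GL (Fin n) ℝ)) => (g : GL (Fin n) ℝ)⁻¹ * q x) := by fun_prop
    simpa using this.tendsto ⟨q x, x, rfl⟩
  obtain ⟨d, hdD, hd⟩ := hDd.inter_nhds_nonempty (h2.eventually (hq.eventually_exists_mem hUn))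
  obtain ⟨u, hu, hqu, hk⟩ := hd ((lift d)⁻¹ * x) (by rw [map_mul, map_inv, hlift])
  refine Set.mem_iUnion.2 ⟨(⟨d, hdD⟩, ⟨_, hk⟩), u, hu, ?_⟩
  change lift d * u * (u⁻¹ * ((lift d)⁻¹ * x)) = x
  group

/-! ### Closed subgroups -/

/-- This stability under closed subgroups is the point of the notion: every result about such
homomorphisms holds for `H` as well as for `G`. -/
theorem IsFiniteClosedHom.comp_subtype (hq : IsFiniteClosedHom q) {H : Subgroup Γ}
    (hH : IsClosed (H : Set Γ)) : IsFiniteClosedHom (q.comp H.subtype) where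
  continuous := hq.continuous.comp continuous_subtype_val
  isClosedMap := hq.isClosedMap.comp hH.isClosedEmbedding_subtypeVal.isClosedMap
  finite_ker := by
    have := hq.finite_ker
    refine Finite.of_injective (fun x : (q.comp H.subtype).ker => (⟨(x : H), x.2⟩ : q.ker)) ?_
    intro x y hxy
    exact Subtype.ext (Subtype.ext (congrArg (fun z : q.ker => (z : Γ)) hxy))

theorem coe_gexp_comp_subtype (hq : IsFiniteClosedHom q) {H : Subgroup Γ}
    (hH : IsClosed (H : Set Γ)) {X : Mat n} (hX : X ∈ lieOf q H) :
    ((gexp (q.comp H.subtype) X : H) : Γ) = gexp q X := by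
  have hqH := hq.comp_subtype hH
  rw [← lieOf_comp_subtype] at hX
  obtain ⟨c, hc⟩ := hqH.exists_gexp_smul hX
  let ι : ContinuousMonoidHom H Γ := ⟨H.subtype, continuous_subtype_val⟩
  rw [gexp_eq hq (ι.comp c) fun t => (hc t).1]
  have := (hc 1).2
  rw [one_smul] at this
  rw [this]
  rfl

end FiniteClosedHom

/-! ### Real reductive groups -/

theorem IsRealAlgebraic.isClosed {n : ℕ} {S : Subgroup (GL (Fin n) ℝ)} (hS : IsRealAlgebraic S) :
    IsClosed (S : Set (GL (Fin n) ℝ)) := by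
  obtain ⟨F, hF⟩ := hS
  have : (S : Set (GL (Fin n) ℝ)) = ⋂ f ∈ F, {g : GL (Fin n) ℝ |
      MvPolynomial.eval (fun ij => (g : Mat n) ij.1 ij.2) f = 0} := by
    ext g
    simp [hF g]
  rw [this]
  refine isClosed_biInter fun f _ => isClosed_eq ?_ continuous_const
  refine (MvPolynomial.continuous_eval f).comp (continuous_pi fun ij => ?_)
  exact Continuous.matrix_elem (Units.continuous_val (M := Mat n)) ij.1 ij.2

/-- The range is an open subgroup of the closed group `S`, hence closed. For a general closed set,
limit points are handled by saturating its complement with respect to the finite kernel. -/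
theorem IsRealReductive.isFiniteClosedHom {n : ℕ} {G : Type*} [Group G] [TopologicalSpace G]
    [IsTopologicalGroup G] {p : G →* GL (Fin n) ℝ} (hp : IsRealReductive p) :
    IsFiniteClosedHom p := by
  obtain ⟨hcont, hfin, S, hS, -, hpS, hopen⟩ := hp
  have hSc := hS.isClosed
  refine ⟨hcont, fun C hC => ?_, hfin⟩
  rw [← closure_subset_iff_isClosed]
  intro y hy
  have hyS : y ∈ S := by
    refine hSc.closure_subset_iff.2 ?_ hy
    rintro _ ⟨x, -, rfl⟩
    exact hpS x
  have hyG : ∃ x, p x = y := by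
    obtain ⟨V, hVo, hV⟩ := hopen Set.univ isOpen_univ
    have h1 : (1 : GL (Fin n) ℝ) ∈ V := by
      have : (1 : GL (Fin n) ℝ) ∈ p '' Set.univ := ⟨1, trivial, map_one p⟩
      rw [hV] at this
      exact this.1
    have h2 : (fun g : GL (Fin n) ℝ => g⁻¹ * y) ⁻¹' V ∈ 𝓝 y := by
      have : Continuous fun g : GL (Fin n) ℝ => g⁻¹ * y := by fun_prop
      exact this.continuousAt.preimage_mem_nhds (by
        rw [inv_mul_cancel]; exact hVo.mem_nhds h1)
    obtain ⟨_, hg, x, -, rfl⟩ := mem_closure_iff_nhds.1 hy _ h2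
    have h3 : (p x)⁻¹ * y ∈ p '' Set.univ := by
      rw [hV]
      exact ⟨hg, mul_mem (inv_mem (hpS x)) hyS⟩
    obtain ⟨z, -, hz⟩ := h3
    exact ⟨x * z, by rw [map_mul, hz, mul_inv_cancel_left]⟩
  obtain ⟨x, rfl⟩ := hyG
  by_contra hx
  -- The points none of whose kernel translates lie in `C`: an open set because the kernel is
  -- finite, with relatively open image disjoint from that of `C`.
  have hO : IsOpen {u : G | ∀ k : p.ker, u * k ∉ C} := by
    have : {u : G | ∀ k : p.ker, u * k ∉ C} = ⋂ k : p.ker, {u | u * (k : G) ∈ C}ᶜ := by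
      ext u; simp
    rw [this]
    exact isOpen_iInter_of_finite fun k =>
      (hC.preimage (continuous_mul_const (k : G))).isOpen_compl
  obtain ⟨V, hVo, hV⟩ := hopen _ hO
  have hxV : p x ∈ V := by
    have : p x ∈ p '' {u : G | ∀ k : p.ker, u * k ∉ C} := by
      refine ⟨x, fun k hk => hx ⟨x * k, hk, ?_⟩, rfl⟩
      rw [map_mul, k.2, mul_one]
    rw [hV] at this
    exact this.1
  obtain ⟨_, hcV, c, hc, rfl⟩ := mem_closure_iff_nhds.1 hy _ (hVo.mem_nhds hxV)
  have : p c ∈ p '' {u : G | ∀ k : p.ker, u * k ∉ C} := by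
    rw [hV]; exact ⟨hcV, hpS c⟩
  obtain ⟨u, hu, huc⟩ := this
  refine hu ⟨u⁻¹ * c, ?_⟩ (by rwa [mul_inv_cancel_left])
  rw [MonoidHom.mem_ker, map_mul, map_inv, huc, inv_mul_cancel]

end RealSpherical
end

noncomputable section

open MeasureTheory NormedSpace Filter
open scoped Pointwise Topology Matrix.Norms.Operator

set_option linter.unusedSectionVars false

namespace RealSpherical

/-! ### Comparison of Haar measure with Hausdorff measure -/

/-! ### Averaging a measure over left translates. -/

section Averaging

variable {Γ A : Type*} [Group Γ] [TopologicalSpace Γ] [IsTopologicalGroup Γ] [T2Space Γ]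
  [SecondCountableTopology Γ] [MeasurableSpace Γ] [BorelSpace Γ]
  [TopologicalSpace A] [T2Space A] [SecondCountableTopology A] [MeasurableSpace A] [BorelSpace A]
  (μ : Measure Γ) [μ.IsMulLeftInvariant] [SFinite μ] (σ : Measure A) {Q : Γ → A}
  {V E : Set Γ}

theorem measurableSet_translates (hQ : Continuous Q) (hV : IsCompact V) (hE : IsCompact E) :
    MeasurableSet {x : Γ × A | x.1 ∈ V ∧ x.2 ∈ Q '' (x.1 • E)} := by
  have : {x : Γ × A | x.1 ∈ V ∧ x.2 ∈ Q '' (x.1 • E)} =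
      (fun x : Γ × Γ => (x.1, Q (x.1 * x.2))) '' (V ×ˢ E) := by
    ext ⟨h, y⟩
    constructor
    · rintro ⟨hh, x, ⟨e, he, rfl⟩, hy⟩
      exact ⟨(h, e), ⟨hh, he⟩, Prod.ext rfl hy⟩
    · rintro ⟨⟨h', e⟩, ⟨hh, he⟩, heq⟩
      obtain ⟨rfl, rfl⟩ := Prod.mk.inj heq
      exact ⟨hh, _, ⟨e, he, rfl⟩, rfl⟩
  rw [this]
  exact ((hV.prod hE).image (by fun_prop)).measurableSet

/-- Tonelli for the set of pairs `(h, y)` with `h ∈ V` and `y ∈ Q(hE)`, whose slices in one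
direction are translates of `E` and in the other essentially translates of `E⁻¹`. -/
theorem lintegral_translates (hQ : Continuous Q) (hV : IsCompact V) (hE : IsCompact E)
    {T : Set A} (hT : σ T ≠ ⊤) :
    ∫⁻ h in V, (σ.restrict T) (Q '' (h • E)) ∂μ =
      ∫⁻ y in T, μ {h | h ∈ V ∧ y ∈ Q '' (h • E)} ∂σ := by
  have hfin : IsFiniteMeasure (σ.restrict T) := ⟨by simpa using hT.lt_top⟩
  have hS := measurableSet_translates hQ hV hE
  have h1 := Measure.prod_apply (μ := μ) (ν := σ.restrict T) hS
  have h2 := Measure.prod_apply_symm (μ := μ) (ν := σ.restrict T) hS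
  rw [h1] at h2
  rw [← lintegral_indicator hV.measurableSet]
  refine Eq.trans (lintegral_congr fun h => ?_) h2
  by_cases hh : h ∈ V
  · rw [Set.indicator_of_mem hh]
    congr 1
    ext y
    simp [hh]
  · rw [Set.indicator_of_notMem hh]
    simp [hh]

theorem slice_subset {W : Set Γ} (hW : Set.InjOn Q W) (hVE : V * E ⊆ W) {w : Γ} (hw : w ∈ W) :
    {h | h ∈ V ∧ Q w ∈ Q '' (h • E)} ⊆ w • E⁻¹ := by
  rintro h ⟨hh, x, ⟨e, he, rfl⟩, heq⟩
  have : h • e = w := hW (hVE (Set.mul_mem_mul hh he)) hw heq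
  rw [Set.mem_smul_set_iff_inv_smul_mem]
  simp only [← this, smul_eq_mul, Set.mem_inv]
  group
  exact he

/-- By injectivity of `Q` the set of `h` with `y ∈ Q(hE)` lies in a left translate of `E⁻¹`. So a
lower bound for `σ` on all translates of `E` becomes one for the Haar measure of `E⁻¹`. -/
theorem mul_measure_le_of_forall_le (hQ : Continuous Q) (hV : IsCompact V) (hE : IsCompact E)
    {W : Set Γ} (hW : Set.InjOn Q W) (hVE : V * E ⊆ W) (hfin : σ (Q '' (V * E)) ≠ ⊤)
    {c : ENNReal} (hc : ∀ h ∈ V, c ≤ σ (Q '' (h • E))) :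
    c * μ V ≤ σ (Q '' (V * E)) * μ E⁻¹ := by
  have hTm : MeasurableSet (Q '' (V * E)) := ((hV.mul hE).image hQ).measurableSet
  have h := lintegral_translates μ σ hQ hV hE hfin
  calc c * μ V = ∫⁻ _ in V, c ∂μ := by rw [setLIntegral_const]
    _ ≤ ∫⁻ h in V, (σ.restrict (Q '' (V * E))) (Q '' (h • E)) ∂μ := by
      refine setLIntegral_mono' hV.measurableSet fun h hh => ?_
      rw [Measure.restrict_eq_self]
      · exact hc h hh
      · refine Set.image_mono ?_
        rintro _ ⟨e, he, rfl⟩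
        exact Set.mul_mem_mul hh he
    _ = ∫⁻ y in Q '' (V * E), μ {h | h ∈ V ∧ y ∈ Q '' (h • E)} ∂σ := h
    _ ≤ ∫⁻ _ in Q '' (V * E), μ E⁻¹ ∂σ := by
      refine setLIntegral_mono' hTm ?_
      rintro _ ⟨w, hw, rfl⟩
      refine (measure_mono (slice_subset hW hVE (hVE hw))).trans_eq (measure_smul μ w _)
    _ = σ (Q '' (V * E)) * μ E⁻¹ := by rw [setLIntegral_const, mul_comm]

/-- For `y = Q w` with `w ∈ V₀` the whole translate `w • E⁻¹` consists of admissible `h`, which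
gives the opposite inequality. -/
theorem measure_mul_le_of_forall_le (hQ : Continuous Q) (hV : IsCompact V) (hE : IsCompact E)
    {V₀ : Set Γ} (hV₀ : IsCompact V₀) (hVE₀ : V₀ * E⁻¹ ⊆ V) (hfin : σ (Q '' V₀) ≠ ⊤)
    {c : ENNReal} (hc : ∀ h ∈ V, σ (Q '' (h • E)) ≤ c) :
    σ (Q '' V₀) * μ E⁻¹ ≤ c * μ V := by
  have hTm : MeasurableSet (Q '' V₀) := (hV₀.image hQ).measurableSet
  have h := lintegral_translates μ σ hQ hV hE hfin
  calc σ (Q '' V₀) * μ E⁻¹ = ∫⁻ _ in Q '' V₀, μ E⁻¹ ∂σ := by rw [setLIntegral_const, mul_comm]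
    _ ≤ ∫⁻ y in Q '' V₀, μ {h | h ∈ V ∧ y ∈ Q '' (h • E)} ∂σ := by
      refine setLIntegral_mono' hTm ?_
      rintro _ ⟨w, hw, rfl⟩
      rw [← measure_smul μ w E⁻¹]
      refine measure_mono ?_
      rintro _ ⟨e, he, rfl⟩
      refine ⟨hVE₀ (Set.mul_mem_mul hw he), w, ⟨e⁻¹, he, ?_⟩, rfl⟩
      simp
    _ = ∫⁻ h in V, (σ.restrict (Q '' V₀)) (Q '' (h • E)) ∂μ := h.symm
    _ ≤ ∫⁻ _ in V, c ∂μ := by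
      refine setLIntegral_mono' hV.measurableSet fun h hh => ?_
      exact (Measure.restrict_apply_le _ _).trans (hc h hh)
    _ = c * μ V := by rw [setLIntegral_const]

end Averaging

/-! ### Hausdorff measure and Lipschitz maps. -/

section Hausdorff

/-- A measure that transforms in a controlled way under Lipschitz maps: the Hausdorff measure. -/
theorem exists_measure_lipschitz (𝔸 : Type*) [NormedRing 𝔸] [MeasurableSpace 𝔸] [BorelSpace 𝔸]
    (d : ℕ) : ∃ σ : Measure 𝔸,
    (∀ (a : 𝔸) (K : NNReal) (s : Set 𝔸), ‖a‖ ≤ K → σ ((fun x => a * x) '' s) ≤ K ^ d * σ s) ∧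
    ∀ (F : (Fin d → ℝ) → 𝔸) (K : NNReal) (D : Set (Fin d → ℝ)),
      ((∀ v ∈ D, ∀ w ∈ D, ‖F v - F w‖ ≤ K * ‖v - w‖) → σ (F '' D) ≤ K ^ d * volume D) ∧
      ((∀ v ∈ D, ∀ w ∈ D, ‖v - w‖ ≤ K * ‖F v - F w‖) → volume D ≤ K ^ d * σ (F '' D)) := by
  have hvol : (volume : Measure (Fin d → ℝ)) = Measure.hausdorffMeasure (d : ℝ) := by
    have := hausdorffMeasure_pi_real (ι := Fin d)
    rw [Fintype.card_fin] at this
    exact this.symm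
  refine ⟨Measure.hausdorffMeasure (d : ℝ), fun a K s ha => ?_, fun F K D => ⟨fun h => ?_, fun h => ?_⟩⟩
  · have : LipschitzOnWith K (fun x => a * x) s := LipschitzOnWith.of_dist_le_mul fun x _ y _ => by
      rw [dist_eq_norm, dist_eq_norm, ← mul_sub]
      exact (norm_mul_le _ _).trans (mul_le_mul_of_nonneg_right ha (norm_nonneg _))
    have := this.hausdorffMeasure_image_le (Nat.cast_nonneg d)
    rwa [ENNReal.rpow_natCast] at this
  · have : LipschitzOnWith K F D := LipschitzOnWith.of_dist_le_mul fun x hx y hy => by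
      rw [dist_eq_norm, dist_eq_norm]; exact h x hx y hy
    have := this.hausdorffMeasure_image_le (Nat.cast_nonneg d)
    rw [hvol]
    rwa [ENNReal.rpow_natCast] at this
  · have hinj : Set.InjOn F D := fun v hv w hw hvw => by
      have := h v hv w hw
      rw [hvw, sub_self, norm_zero, mul_zero] at this
      exact sub_eq_zero.1 (norm_le_zero_iff.1 this)
    have hg : ∀ v ∈ D, Function.invFunOn F D (F v) = v := fun v hv => hinj.leftInvOn_invFunOn hv
    have : LipschitzOnWith K (Function.invFunOn F D) (F '' D) :=
      LipschitzOnWith.of_dist_le_mul (by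
        rintro _ ⟨x, hx, rfl⟩ _ ⟨y, hy, rfl⟩
        rw [dist_eq_norm, dist_eq_norm, hg x hx, hg y hy]; exact h x hx y hy)
    have h2 := this.hausdorffMeasure_image_le (Nat.cast_nonneg d)
    have h3 : Function.invFunOn F D '' (F '' D) = D := by
      rw [← Set.image_comp]
      exact Set.EqOn.image_eq_self hg
    rw [ENNReal.rpow_natCast, h3] at h2
    rwa [hvol]

theorem exists_norm_map_le {E F : Type*} [NormedAddCommGroup E] [NormedSpace ℝ E]
    [FiniteDimensional ℝ E] [NormedAddCommGroup F] [NormedSpace ℝ F] (L : E →ₗ[ℝ] F) :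
    ∃ M : NNReal, ∀ v, ‖L v‖ ≤ M * ‖v‖ :=
  ⟨‖LinearMap.toContinuousLinearMap L‖₊, fun v => (LinearMap.toContinuousLinearMap L).le_opNorm v⟩

theorem exists_norm_le_map {E F : Type*} [NormedAddCommGroup E] [NormedSpace ℝ E]
    [FiniteDimensional ℝ E] [NormedAddCommGroup F] [NormedSpace ℝ F] (L : E →ₗ[ℝ] F)
    (hL : Function.Injective L) : ∃ M : NNReal, 0 < M ∧ ∀ v, ‖v‖ ≤ M * ‖L v‖ := by
  obtain ⟨K, hK, h⟩ := L.exists_antilipschitzWith (LinearMap.ker_eq_bot.2 hL)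
  refine ⟨K, hK, fun v => ?_⟩
  have := h.le_mul_dist v 0
  rwa [map_zero, dist_zero_right, dist_zero_right] at this

end Hausdorff

instance Mat.instMeasurableSpace {n : ℕ} : MeasurableSpace (Mat n) := borel (Mat n)

instance Mat.instBorelSpace {n : ℕ} : BorelSpace (Mat n) := ⟨rfl⟩

instance Mat.instBorelSpaceNorm {n : ℕ} :
    @BorelSpace (Mat n) PseudoMetricSpace.toUniformSpace.toTopologicalSpace _ := ⟨rfl⟩

/-! ### Haar measure in exponential coordinates. -/

section Comparison

attribute [local instance 100] LieRing.ofAssociativeRing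

variable {n : ℕ} {Γ : Type*} [Group Γ] [TopologicalSpace Γ] [IsTopologicalGroup Γ] [T2Space Γ]
  {q : Γ →* GL (Fin n) ℝ}

theorem exists_exp_comp_biLipschitz {d : ℕ} (L : (Fin d → ℝ) →ₗ[ℝ] Mat n)
    (hL : Function.Injective L) : ∃ r > 0, ∃ K : NNReal, 0 < K ∧
      ∀ v ∈ Metric.ball (0 : Fin d → ℝ) r, ∀ w ∈ Metric.ball (0 : Fin d → ℝ) r,
        ‖v - w‖ ≤ K * ‖exp (L v) - exp (L w)‖ ∧ ‖exp (L v) - exp (L w)‖ ≤ K * ‖v - w‖ := by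
  obtain ⟨r, hr, hexp⟩ := exists_exp_biLipschitz (n := n)
  obtain ⟨K₁, hK₁, hanti⟩ := exists_norm_le_map L hL
  obtain ⟨K₂, hop⟩ := exists_norm_map_le L
  let L' := LinearMap.toContinuousLinearMap L
  have hcont : Tendsto L (𝓝 0) (𝓝 0) := by
    have := L'.continuous.tendsto 0
    rwa [map_zero] at this
  obtain ⟨r', hr', hrr⟩ := Metric.eventually_nhds_iff_ball.1
    (hcont.eventually (Metric.ball_mem_nhds _ hr))
  refine ⟨r', hr', 2 * K₁ + 2 * K₂, by positivity, fun v hv w hw => ?_⟩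
  obtain ⟨h1, h2⟩ := hexp _ (hrr v hv) _ (hrr w hw)
  have h3 := hanti (v - w)
  have h4 := hop (v - w)
  rw [map_sub] at h3 h4
  have hK : (0 : ℝ) ≤ K₁ := K₁.2
  have hK' : (0 : ℝ) ≤ K₂ := K₂.2
  push_cast
  constructor
  · nlinarith [norm_nonneg (exp (L v) - exp (L w))]
  · nlinarith [norm_nonneg (v - w)]

/-- In exponential coordinates Haar measure is comparable with Lebesgue measure near `0`. -/
theorem IsFiniteClosedHom.exists_measure_gexp_comparable (hq : IsFiniteClosedHom q)
    [LocallyCompactSpace Γ] [MeasurableSpace Γ] [BorelSpace Γ] (μ : Measure Γ) [μ.IsHaarMeasure]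
    {d : ℕ} (L : (Fin d → ℝ) →ₗ[ℝ] Mat n) (hL : Function.Injective L)
    (hrange : LinearMap.range L = (lieOf q ⊤).toSubmodule) :
    ∃ r > 0, ∃ C : ENNReal, C ≠ ⊤ ∧ ∀ D ⊆ Metric.ball (0 : Fin d → ℝ) r, IsCompact D →
      volume D ≤ C * μ ((fun v => gexp q (L v)) '' D) ∧
      μ ((fun v => gexp q (L v)) '' D) ≤ C * volume D := by
  have hsc := hq.secondCountableTopology
  obtain ⟨σ, hσmul, hσ⟩ := @exists_measure_lipschitz (Mat n) _ Mat.instMeasurableSpace Mat.instBorelSpaceNorm d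
  obtain ⟨r₁, hr₁, K, hK, hbi⟩ := exists_exp_comp_biLipschitz L hL
  have hmem : ∀ v, L v ∈ lieOf q ⊤ := fun v => by
    have : L v ∈ LinearMap.range L := ⟨v, rfl⟩
    rwa [hrange] at this
  set γ : (Fin d → ℝ) → Γ := fun v => gexp q (L v) with hγ
  let Q : Γ → Mat n := fun x => (q x : Mat n)
  have hQ : Continuous Q := Units.continuous_val.comp hq.continuous
  have hQγ : ∀ v, Q (γ v) = exp (L v) := fun v => congrArg Units.val (map_gexp hq (hmem v))
  have hQγ' : ∀ D, Q '' (γ '' D) = (fun v => exp (L v)) '' D := fun D => by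
    rw [← Set.image_comp]
    exact Set.image_congr fun v _ => hQγ v
  have hLcont : Tendsto L (𝓝 0) (𝓝 0) := by
    have := (LinearMap.toContinuousLinearMap L).continuous.tendsto 0
    rwa [map_zero] at this
  obtain ⟨W, hWo, hW1, hW⟩ := hq.exists_separating
  have hinjW : Set.InjOn Q W := fun x hx y hy hxy =>
    injOn_of_separating hW1 hW hx hy (Units.ext hxy)
  obtain ⟨K₁, hK₁, hanti⟩ := exists_norm_le_map L hL
  have hchart : ∀ᶠ x in 𝓝 (1 : Γ), ∃ v ∈ Metric.ball (0 : Fin d → ℝ) r₁, γ v = x := by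
    have hU : Metric.ball (0 : Mat n) (r₁ / K₁) ∈ 𝓝 0 :=
      Metric.ball_mem_nhds _ (div_pos hr₁ hK₁)
    filter_upwards [hq.eventually_exists_gexp hU] with x hx
    obtain ⟨X, hX, hXU, rfl⟩ := hx
    have hX' : X ∈ LinearMap.range L := by rw [hrange]; exact hX
    obtain ⟨v, rfl⟩ := hX'
    refine ⟨v, ?_, rfl⟩
    rw [mem_ball_zero_iff] at hXU ⊢
    rw [lt_div_iff₀ (NNReal.coe_pos.2 hK₁), mul_comm] at hXU
    exact (hanti v).trans_lt hXU
  have hpair : ∀ N ∈ 𝓝 (1 : Γ), ∃ V ∈ 𝓝 (1 : Γ), IsCompact V ∧ V * V ⊆ N := by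
    intro N hN
    obtain ⟨V, hV, hVN⟩ := exists_nhds_one_split hN
    obtain ⟨V', hV', hV'V, hV'c⟩ := local_compact_nhds hV
    refine ⟨V', hV', hV'c, ?_⟩
    rintro _ ⟨x, hx, y, hy, rfl⟩
    exact hVN x (hV'V hx) y (hV'V hy)
  obtain ⟨V, hV, hVc, hVN⟩ := hpair _ (inter_mem (hWo.mem_nhds hW1) hchart)
  obtain ⟨V₀, hV₀, hV₀c, hV₀V⟩ := hpair _ hV
  have hV₀V' : V₀ ⊆ V := fun x hx =>
    hV₀V ⟨x, hx, 1, mem_of_mem_nhds hV₀, mul_one x⟩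
  have hVW : V ⊆ W := fun x hx => (hVN ⟨x, hx, 1, mem_of_mem_nhds hV, mul_one x⟩).1
  have hsmall : ∀ᶠ v in 𝓝 (0 : Fin d → ℝ), γ v ∈ V₀ := by
    filter_upwards [hLcont.eventually (hq.eventually_gexp_mem hV₀)] with v hv using hv (hmem v)
  obtain ⟨r₂, hr₂, hr₂V⟩ := Metric.eventually_nhds_iff_ball.1 hsmall
  -- Left multiplication by `Q h` and its inverse are Lipschitz with a common constant for `h ∈ V`,
  -- so `σ` changes under these translations at most by the factor `M ^ d`.
  obtain ⟨M, hM⟩ : ∃ M : NNReal, ∀ h ∈ V, ‖Q h‖ ≤ M ∧ ‖Q h⁻¹‖ ≤ M := by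
    obtain ⟨M₁, hM₁⟩ := hVc.exists_bound_of_continuousOn (f := Q) hQ.continuousOn
    obtain ⟨M₂, hM₂⟩ := hVc.exists_bound_of_continuousOn (f := fun h => Q h⁻¹)
      (hQ.comp continuous_inv).continuousOn
    refine ⟨(max M₁ M₂).toNNReal, fun h hh => ⟨?_, ?_⟩⟩
    · exact (hM₁ h hh).trans ((le_max_left _ _).trans (Real.le_coe_toNNReal _))
    · exact (hM₂ h hh).trans ((le_max_right _ _).trans (Real.le_coe_toNNReal _))
  have hQmul : ∀ h x, Q (h * x) = Q h * Q x := fun h x => by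
    simp only [Q, map_mul, Units.val_mul]
  have hQsmul : ∀ h (E : Set Γ), Q '' (h • E) = (fun x => Q h * x) '' (Q '' E) := fun h E => by
    rw [← Set.image_smul, ← Set.image_comp, ← Set.image_comp]
    exact Set.image_congr fun x _ => hQmul h x
  set B : ENNReal := K ^ d * volume (Metric.ball (0 : Fin d → ℝ) r₁) with hB
  have hBtop : B ≠ ⊤ := ENNReal.mul_ne_top (by simp) measure_ball_lt_top.ne
  have hVVB : ∀ T ⊆ V * V, σ (Q '' T) ≤ B := by
    intro T hT
    refine le_trans (measure_mono ?_) ((hσ (fun v => exp (L v)) K _).1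
      fun v hv w hw => (hbi v hv w hw).2)
    rintro _ ⟨x, hx, rfl⟩
    obtain ⟨v, hv, rfl⟩ := (hVN (hT hx)).2
    exact ⟨v, hv, (hQγ v).symm⟩
  have hVVV : V ⊆ V * V := fun x hx => ⟨x, hx, 1, mem_of_mem_nhds hV, mul_one x⟩
  set r := min r₁ r₂ with hr
  have hr0 : 0 < r := lt_min hr₁ hr₂
  have hr1 : Metric.ball (0 : Fin d → ℝ) r ⊆ Metric.ball 0 r₁ :=
    Metric.ball_subset_ball (min_le_left _ _)
  have hr2 : ∀ v ∈ Metric.ball (0 : Fin d → ℝ) r, γ v ∈ V₀ := fun v hv =>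
    hr₂V v (Metric.ball_subset_ball (min_le_right _ _) hv)
  set s₀ := σ (Q '' V₀) with hs₀
  have hs₀top : s₀ ≠ ⊤ := ((hVVB V₀ (hV₀V'.trans hVVV)).trans_lt hBtop.lt_top).ne
  have hs₀0 : s₀ ≠ 0 := by
    intro h0
    have h1 := (hσ (fun v => exp (L v)) K (Metric.ball 0 r)).2
      fun v hv w hw => (hbi v (hr1 hv) w (hr1 hw)).1
    have h2 : (fun v => exp (L v)) '' Metric.ball 0 r ⊆ Q '' V₀ := by
      rintro _ ⟨v, hv, rfl⟩
      exact ⟨γ v, hr2 v hv, hQγ v⟩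
    rw [measure_mono_null h2 h0, mul_zero] at h1
    exact (Metric.measure_ball_pos volume (0 : Fin d → ℝ) hr0).not_ge h1
  have hμV0 : μ V ≠ 0 := (Measure.measure_pos_of_mem_nhds μ hV).ne'
  have hμVtop : μ V ≠ ⊤ := hVc.measure_lt_top.ne
  have hKd : (K : ENNReal) ^ d ≠ ⊤ := by simp
  have hMd : (M : ENNReal) ^ d ≠ ⊤ := by simp
  -- The constant is the sum of those for the two directions: `B` bounds `σ` near the identity, and
  -- `s₀` is the positive mass of the reference set.
  refine ⟨r, hr0, (K ^ d * (M ^ d * B)) / μ V + (M ^ d * K ^ d * μ V) / s₀,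
    ENNReal.add_ne_top.2 ⟨ENNReal.div_ne_top (by finiteness) hμV0,
      ENNReal.div_ne_top (by finiteness) hs₀0⟩, fun D hD hDc => ?_⟩
  have hnegD : -D ⊆ Metric.ball (0 : Fin d → ℝ) r := fun v hv => by
    have := hD hv
    rw [mem_ball_zero_iff, norm_neg] at this
    exact mem_ball_zero_iff.2 this
  set E := γ '' (-D) with hE
  have hEinv : E⁻¹ = γ '' D := by
    have hneg : ∀ v, γ (-v) = (γ v)⁻¹ := fun v => by
      have := gexp_zsmul hq (hmem v) (-1)
      simpa [hγ] using this
    ext x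
    rw [Set.mem_inv]
    constructor
    · rintro ⟨v, hv, hvx⟩
      exact ⟨-v, hv, by rw [hneg, hvx, inv_inv]⟩
    · rintro ⟨v, hv, rfl⟩
      exact ⟨-v, by simpa using hv, hneg v⟩
  have hEV₀ : E ⊆ V₀ := by
    rintro _ ⟨v, hv, rfl⟩
    exact hr2 v (hnegD hv)
  have hEc : IsCompact E := by
    -- Compactness without continuity of `gexp`: inside the compact `V`, where `Q` is injective, `E`
    -- is the preimage of a compact set of matrices.
    have h1 : E = V ∩ Q ⁻¹' ((fun v => exp (L v)) '' (-D)) := by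
      ext x
      constructor
      · intro hx
        refine ⟨hV₀V' (hEV₀ hx), ?_⟩
        rw [← hQγ']
        exact ⟨x, hx, rfl⟩
      · rintro ⟨hxV, v, hv, hvx⟩
        have hvx : exp (L v) = Q x := hvx
        refine ⟨v, hv, hinjW (hVW (hV₀V' (hr2 v (hnegD hv)))) (hVW hxV) ?_⟩
        rw [hQγ, hvx]
    rw [h1]
    refine hVc.inter_right (IsClosed.preimage hQ ?_)
    refine (hDc.neg.image ?_).isClosed
    exact continuous_exp_mat.comp (LinearMap.toContinuousLinearMap L).continuous
  have hvolE : volume D ≤ K ^ d * σ (Q '' E) := by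
    rw [← Measure.measure_neg volume D, hE, hQγ']
    exact (hσ _ K _).2 fun v hv w hw => (hbi v (hr1 (hnegD hv)) w (hr1 (hnegD hw))).1
  have hvolE' : σ (Q '' E) ≤ K ^ d * volume D := by
    rw [← Measure.measure_neg volume D, hE, hQγ']
    exact (hσ _ K _).1 fun v hv w hw => (hbi v (hr1 (hnegD hv)) w (hr1 (hnegD hw))).2
  have hVE : V * E ⊆ V * V := Set.mul_subset_mul_left (hEV₀.trans hV₀V')
  constructor
  · have h1 := mul_measure_le_of_forall_le μ σ hQ hVc hEc hinjW
      (hVE.trans (hVN.trans Set.inter_subset_left))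
      ((hVVB _ hVE).trans_lt hBtop.lt_top).ne (c := σ (Q '' E) / M ^ d) (fun h hh => by
        refine ENNReal.div_le_of_le_mul' ?_
        have h2 := hσmul (Q h⁻¹) M (Q '' (h • E)) (hM h hh).2
        rwa [← hQsmul, inv_smul_smul] at h2)
    rw [hEinv] at h1
    have h2 : σ (Q '' E) * μ V ≤ M ^ d * B * μ (γ '' D) := by
      -- If `M ^ d = 0` the quotient by it says nothing; multiplication by the identity matrix, of
      -- norm at most `M`, then shows that `σ (Q '' E) = 0`.
      by_cases hM0 : (M : ENNReal) ^ d = 0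
      · have h3 := hσmul 1 M (Q '' E) ?_
        · rw [hM0, zero_mul] at h3
          have h4 : σ (Q '' E) = 0 := by
            simpa using h3
          rw [h4, zero_mul]; exact zero_le
        · have := (hM 1 (mem_of_mem_nhds hV)).1
          simpa [Q] using this
      calc σ (Q '' E) * μ V = M ^ d * (σ (Q '' E) / M ^ d * μ V) := by
            rw [← mul_assoc, ENNReal.mul_div_cancel hM0 hMd]
        _ ≤ M ^ d * (σ (Q '' (V * E)) * μ (γ '' D)) := by gcongr
        _ ≤ M ^ d * (B * μ (γ '' D)) := by gcongr; exact hVVB _ hVE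
        _ = M ^ d * B * μ (γ '' D) := (mul_assoc _ _ _).symm
    calc volume D ≤ K ^ d * σ (Q '' E) := hvolE
      _ ≤ K ^ d * (M ^ d * B * μ (γ '' D) / μ V) := by
        gcongr
        rwa [ENNReal.le_div_iff_mul_le (Or.inl hμV0) (Or.inl hμVtop)]
      _ = (K ^ d * (M ^ d * B)) / μ V * μ (γ '' D) := by
        simp only [div_eq_mul_inv]; ring
      _ ≤ _ := by gcongr; exact le_self_add
  · have h1 := measure_mul_le_of_forall_le μ σ hQ hVc hEc hV₀c (by
        rw [hEinv]
        refine (Set.mul_subset_mul_left ?_).trans hV₀V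
        rintro _ ⟨v, hv, rfl⟩
        exact hr2 v (hD hv)) hs₀top (c := M ^ d * σ (Q '' E)) (fun h hh => by
        rw [hQsmul]
        exact hσmul (Q h) M (Q '' E) (hM h hh).1)
    rw [hEinv] at h1
    calc μ (γ '' D) ≤ M ^ d * σ (Q '' E) * μ V / s₀ := by
          rw [ENNReal.le_div_iff_mul_le (Or.inl hs₀0) (Or.inl hs₀top), mul_comm]
          exact h1
      _ ≤ M ^ d * (K ^ d * volume D) * μ V / s₀ := by gcongr
      _ = (M ^ d * K ^ d * μ V) / s₀ * volume D := by
        simp only [div_eq_mul_inv]; ring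
      _ ≤ _ := by gcongr; exact le_add_self

end Comparison

end RealSpherical
end

noncomputable section

open MeasureTheory NormedSpace Filter
open scoped Pointwise Topology Matrix.Norms.Operator

set_option linter.unusedSectionVars false

namespace RealSpherical

/-! ### The modular function -/

open MeasureTheory.Measure in
theorem map_mul_right_eq_modularCharacterFun_smul {Γ : Type*} [Group Γ] [TopologicalSpace Γ]
    [IsTopologicalGroup Γ] [LocallyCompactSpace Γ] [SecondCountableTopology Γ]
    [MeasurableSpace Γ] [BorelSpace Γ] (μ : Measure Γ) [μ.IsHaarMeasure] (g : Γ) :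
    μ.map (· * g) = modularCharacterFun g • μ := by
  rw [modularCharacterFun_eq_haarScalarFactor μ g]
  exact isMulLeftInvariant_eq_smul _ _

theorem measure_preimage_mul_right_eq {Γ : Type*} [Group Γ] [TopologicalSpace Γ]
    [IsTopologicalGroup Γ] [LocallyCompactSpace Γ] [SecondCountableTopology Γ]
    [MeasurableSpace Γ] [BorelSpace Γ] (μ : Measure Γ) [μ.IsHaarMeasure] (g : Γ) {E : Set Γ}
    (hE : MeasurableSet E) :
    μ {x | x * g ∈ E} = Measure.modularCharacterFun g * μ E := by
  have h := congrArg (fun ν : Measure Γ => ν E) (map_mul_right_eq_modularCharacterFun_smul μ g)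
  simp only [Measure.smul_apply] at h
  rw [Measure.map_apply (measurable_mul_const g) hE] at h
  exact h

theorem modularCharacterFun_pow {Γ : Type*} [Group Γ] [TopologicalSpace Γ]
    [IsTopologicalGroup Γ] [LocallyCompactSpace Γ] (g : Γ) (k : ℕ) :
    Measure.modularCharacterFun (g ^ k) = Measure.modularCharacterFun g ^ k := by
  induction k with
  | zero => simp [Measure.modularCharacterFun_map_one]
  | succ k ih => rw [pow_succ, pow_succ, Measure.modularCharacterFun_map_mul, ih]

/-- Passing to powers removes the multiplicative constant from an estimate between characters. -/
theorem le_of_forall_pow_le {x y C : ℝ} (hy : 0 < y)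
    (h : ∀ k : ℕ, x ^ k ≤ C * y ^ k) : x ≤ y := by
  by_contra hxy
  have h1 : 1 < x / y := by rw [lt_div_iff₀ hy]; linarith [not_le.1 hxy]
  obtain ⟨k, hk⟩ := pow_unbounded_of_one_lt C h1
  have := h k
  rw [div_pow, lt_div_iff₀ (by positivity)] at hk
  linarith

section Modular

attribute [local instance 100] LieRing.ofAssociativeRing

variable {n : ℕ} {Γ : Type*} [Group Γ] [TopologicalSpace Γ] [IsTopologicalGroup Γ] [T2Space Γ]
  {q : Γ →* GL (Fin n) ℝ}

/-- Coordinates on a subspace of `𝔤𝔩(n, ℝ)`. -/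
theorem exists_linear_coordinates (V : Submodule ℝ (Mat n)) :
    ∃ (d : ℕ) (e : (Fin d → ℝ) ≃ₗ[ℝ] V), Function.Injective (V.subtype ∘ₗ e.toLinearMap) ∧
      LinearMap.range (V.subtype ∘ₗ e.toLinearMap) = V := by
  refine ⟨Module.finrank ℝ V, (Module.finBasis ℝ V).equivFun.symm, ?_, ?_⟩
  · exact V.injective_subtype.comp (LinearEquiv.injective _)
  · rw [LinearMap.range_comp, LinearEquiv.range, Submodule.map_top, Submodule.range_subtype]

-- Conjugation by `a` is `Ad(a)` in exponential coordinates, so it scales Lebesgue measure by `|det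
-- Ad(a)|`. Passing between Lebesgue and Haar measure costs the factor `C` twice, and `C` does not
-- depend on `a`.
open MeasureTheory.Measure in
theorem IsFiniteClosedHom.modularCharacterFun_le (hq : IsFiniteClosedHom q)
    [LocallyCompactSpace Γ] :
    ∃ C : ℝ, ∀ (a : Γ) (T : Module.End ℝ (lieOf q ⊤).toSubmodule),
      (∀ X, (T X : Mat n) = (q a : Mat n) * X * (((q a)⁻¹ : GL (Fin n) ℝ) : Mat n)) →
      (modularCharacterFun a : ℝ) ≤ C * |LinearMap.det T| := by
  borelize Γ
  have hsc := hq.secondCountableTopology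
  let μ : Measure Γ := haar
  obtain ⟨d, e, hinj, hrange⟩ := exists_linear_coordinates (lieOf q ⊤).toSubmodule
  set L := (lieOf q ⊤).toSubmodule.subtype ∘ₗ e.toLinearMap with hL
  obtain ⟨r, hr, C, hC, hcomp⟩ := hq.exists_measure_gexp_comparable μ L hinj hrange
  have hmem : ∀ v, L v ∈ lieOf q ⊤ := fun v => (e v).2
  refine ⟨(C * C).toReal, fun a T hT => ?_⟩
  let T' : (Fin d → ℝ) →ₗ[ℝ] (Fin d → ℝ) := e.symm.toLinearMap ∘ₗ T ∘ₗ e.toLinearMap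
  have hdet : LinearMap.det T' = LinearMap.det T := by
    have := LinearMap.det_conj T e.symm
    simpa [T'] using this
  have hT'L : ∀ v, L (T' v) = (q a : Mat n) * L v * (((q a)⁻¹ : GL (Fin n) ℝ) : Mat n) := by
    intro v
    simp only [hL, T', LinearMap.comp_apply, LinearEquiv.coe_coe, LinearEquiv.apply_symm_apply,
      Submodule.subtype_apply]
    exact hT _
  have hγ : ∀ v, gexp q (L (T' v)) = a * gexp q (L v) * a⁻¹ := fun v => by
    rw [hT'L, conj_gexp hq (hmem v)]
  have hcont : Continuous T' := T'.continuous_of_finiteDimensional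
  -- The ball may depend on `a`; only the comparison constant must not.
  obtain ⟨ρ, hρ, hρr⟩ : ∃ ρ > 0, Metric.closedBall (0 : Fin d → ℝ) ρ ⊆
      Metric.ball 0 r ∩ T' ⁻¹' Metric.ball 0 r := by
    refine Metric.nhds_basis_closedBall.mem_iff.1 (inter_mem (Metric.ball_mem_nhds _ hr)
      (hcont.continuousAt.preimage_mem_nhds ?_))
    rw [map_zero]
    exact Metric.ball_mem_nhds _ hr
  set D := Metric.closedBall (0 : Fin d → ℝ) ρ
  have hDc : IsCompact D := isCompact_closedBall _ _
  have hD0 : volume D ≠ 0 := (Metric.measure_closedBall_pos _ _ hρ).ne'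
  have hDtop : volume D ≠ ⊤ := hDc.measure_lt_top.ne
  obtain ⟨h1, h1'⟩ := hcomp D (fun v hv => (hρr hv).1) hDc
  obtain ⟨-, h2⟩ := hcomp (T' '' D) (by rintro _ ⟨v, hv, rfl⟩; exact (hρr hv).2) (hDc.image hcont)
  rw [addHaar_image_linearMap, hdet] at h2
  set E := (fun v => gexp q (L v)) '' D with hE
  have hEtop : μ E ≠ ⊤ := (h1'.trans_lt (ENNReal.mul_lt_top hC.lt_top hDtop.lt_top)).ne
  have hE0 : μ E ≠ 0 := fun h => hD0 (by simpa [h] using h1)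
  have h3 : (fun v => gexp q (L v)) '' (T' '' D) = {x | a⁻¹ * x * a ∈ E} := by
    ext x
    constructor
    · rintro ⟨_, ⟨v, hv, rfl⟩, rfl⟩
      refine ⟨v, hv, ?_⟩
      change gexp q (L v) = a⁻¹ * gexp q (L (T' v)) * a
      rw [hγ]; group
    · rintro ⟨v, hv, hvx⟩
      refine ⟨T' v, ⟨v, hv, rfl⟩, ?_⟩
      change gexp q (L (T' v)) = x
      have hvx : gexp q (L v) = a⁻¹ * x * a := hvx
      rw [hγ, hvx]; group
  have h4 : (modularCharacterFun a : ENNReal) * μ E ≤ μ {x | a⁻¹ * x * a ∈ E} := by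
    -- The right translation formula is applied to a measurable hull of the conjugated set.
    obtain ⟨E', hEE', hE'm, hE'⟩ := exists_measurable_superset μ {x | a⁻¹ * x * a ∈ E}
    have h5 : μ {x | x * a ∈ {y | a * y * a⁻¹ ∈ E'}} =
        modularCharacterFun a * μ {y | a * y * a⁻¹ ∈ E'} :=
      measure_preimage_mul_right_eq μ a
        (((measurable_const_mul a).mul_const a⁻¹) hE'm)
    have h6 : {x | x * a ∈ {y | a * y * a⁻¹ ∈ E'}} = (fun x => a * x) ⁻¹' E' := by
      ext x; simp [mul_assoc]
    rw [h6, measure_preimage_mul, hE'] at h5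
    rw [h5]
    gcongr
    intro x hx
    refine hEE' ?_
    simpa [mul_assoc] using hx
  have h7 : (modularCharacterFun a : ENNReal) * μ E ≤
      C * C * ENNReal.ofReal |LinearMap.det T| * μ E := by
    calc (modularCharacterFun a : ENNReal) * μ E ≤ μ {x | a⁻¹ * x * a ∈ E} := h4
      _ ≤ C * (ENNReal.ofReal |LinearMap.det T| * volume D) := by rw [← h3]; exact h2
      _ ≤ C * (ENNReal.ofReal |LinearMap.det T| * (C * μ E)) := by gcongr
      _ = _ := by ring
  rw [ENNReal.mul_le_mul_iff_left hE0 hEtop] at h7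
  have h8 := ENNReal.toReal_mono (by finiteness) h7
  rwa [ENNReal.toReal_mul, ENNReal.toReal_ofReal (abs_nonneg _), ENNReal.coe_toReal] at h8

/-- The modular function is the determinant of the adjoint representation. -/
theorem IsFiniteClosedHom.modularCharacterFun_eq (hq : IsFiniteClosedHom q)
    [LocallyCompactSpace Γ] (a : Γ) (T : Module.End ℝ (lieOf q ⊤).toSubmodule)
    (hT : ∀ X, (T X : Mat n) = (q a : Mat n) * X * (((q a)⁻¹ : GL (Fin n) ℝ) : Mat n)) :
    (Measure.modularCharacterFun a : ℝ) = |LinearMap.det T| := by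
  obtain ⟨C, hC⟩ := hq.modularCharacterFun_le
  have key : ∀ (a : Γ) (T : Module.End ℝ (lieOf q ⊤).toSubmodule),
      (∀ X, (T X : Mat n) = (q a : Mat n) * X * (((q a)⁻¹ : GL (Fin n) ℝ) : Mat n)) →
      LinearMap.det T ≠ 0 → (Measure.modularCharacterFun a : ℝ) ≤ |LinearMap.det T| := by
    -- Both sides are multiplicative in `a`, so the constant `C` disappears on replacing `a` by its
    -- powers. The same bound for `a⁻¹` gives the reverse inequality.
    intro a T hT h0
    refine le_of_forall_pow_le (C := C)
      (abs_pos.2 h0) fun k => ?_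
    have := hC (a ^ k) (T ^ k) ?_
    · rwa [map_pow, abs_pow, modularCharacterFun_pow, NNReal.coe_pow] at this
    · induction k with
      | zero => intro X; simp
      | succ k ih =>
        intro X
        rw [pow_succ' T, Module.End.mul_apply, hT, ih, pow_succ' a]
        simp only [map_mul, map_pow, mul_inv_rev, Units.val_mul]
        noncomm_ring
  have hconj : ∀ X ∈ (lieOf q ⊤).toSubmodule,
      (q a⁻¹ : Mat n) * X * (((q a⁻¹)⁻¹ : GL (Fin n) ℝ) : Mat n) ∈ (lieOf q ⊤).toSubmodule := by
    intro X hX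
    have hX' : X ∈ lieOf q ⊤ := hX
    rw [lieOf_top_eq] at hX'
    have := conj_mem_lieAlg hq.isClosed_range (g := q a⁻¹) ⟨_, rfl⟩ hX'
    rwa [← lieOf_top_eq] at this
  let T' : Module.End ℝ (lieOf q ⊤).toSubmodule :=
    { toFun := fun X => ⟨_, hconj X X.2⟩
      map_add' := fun X Y => Subtype.ext (by simp [mul_add, add_mul])
      map_smul' := fun c X => Subtype.ext (by simp) }
  have hTT' : T * T' = 1 := by
    ext X : 2
    rw [Module.End.mul_apply, hT]
    change (q a : Mat n) * ((q a⁻¹ : Mat n) * X * (((q a⁻¹)⁻¹ : GL (Fin n) ℝ) : Mat n)) *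
      (((q a)⁻¹ : GL (Fin n) ℝ) : Mat n) = X
    rw [map_inv, inv_inv, mul_assoc, mul_assoc, mul_assoc, Units.mul_inv, mul_one,
      Units.mul_inv_cancel_left]
  have hdet : LinearMap.det T * LinearMap.det T' = 1 := by
    rw [← map_mul, hTT', map_one]
  have h0 : LinearMap.det T ≠ 0 := left_ne_zero_of_mul_eq_one hdet
  have h0' : LinearMap.det T' ≠ 0 := right_ne_zero_of_mul_eq_one hdet
  have h1 := key a T hT h0
  have h2 := key a⁻¹ T' (fun X => rfl) h0'
  refine le_antisymm h1 ?_
  have h3 : (Measure.modularCharacterFun a : ℝ) * Measure.modularCharacterFun a⁻¹ = 1 := by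
    rw [← NNReal.coe_mul, ← Measure.modularCharacterFun_map_mul, mul_inv_cancel,
      Measure.modularCharacterFun_map_one, NNReal.coe_one]
  have h4 : |LinearMap.det T| * |LinearMap.det T'| = 1 := by rw [← abs_mul, hdet, abs_one]
  have h5 : 0 < |LinearMap.det T'| := abs_pos.2 h0'
  have h6 : (0 : ℝ) < Measure.modularCharacterFun a :=
    NNReal.coe_pos.2 (Measure.modularCharacterFun_pos a)
  by_contra hlt
  rw [not_le] at hlt
  nlinarith

end Modular

/-! ### Invariant measures on homogeneous spaces -/

instance Subgroup.instSecondCountable {G : Type*} [Group G] [TopologicalSpace G]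
    [SecondCountableTopology G] (H : Subgroup G) : SecondCountableTopology H :=
  Topology.IsInducing.subtypeVal.secondCountableTopology

section Weil

variable {G : Type*} [Group G] [TopologicalSpace G] [IsTopologicalGroup G]
  [T2Space G] [LocallyCompactSpace G] [SecondCountableTopology G]
  [MeasurableSpace G] [BorelSpace G] {H : Subgroup G} (μG : Measure G) [μG.IsHaarMeasure]
  (μH : Measure H) [μH.IsHaarMeasure]
  (μZ : Measure (G ⧸ H)) [μZ.Regular] [SMulInvariantMeasure G (G ⧸ H) μZ]

/-- The measure of the fibre `{h ∈ H | gh ∈ M}` as a function of `gH`. -/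
def fibreMeasure (M : Set G) : G ⧸ H → ENNReal :=
  Quotient.lift (fun g : G => μH {h : H | g * h ∈ M}) (by
    intro a b hab
    rw [← Quotient.eq_iff_equiv] at hab
    have hab' : a⁻¹ * b ∈ H := QuotientGroup.eq.1 hab
    have := measure_preimage_mul μH ⟨a⁻¹ * b, hab'⟩ {h : H | a * h ∈ M}
    rw [← this]
    congr 1
    ext h
    simp [mul_assoc])

theorem fibreMeasure_mk (M : Set G) (g : G) :
    fibreMeasure μH M (g : G ⧸ H) = μH {h : H | g * h ∈ M} := rfl

theorem measurable_fibreMeasure [LocallyCompactSpace H] {M : Set G} (hM : MeasurableSet M) :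
    Measurable (fibreMeasure μH M) := by
  refine QuotientGroup.measurable_from_quotient.2 ?_
  have h1 : MeasurableSet {x : G × H | x.1 * x.2 ∈ M} :=
    (measurable_fst.mul (measurable_subtype_coe.comp measurable_snd)) hM
  exact measurable_measure_prodMk_left h1

theorem fibreMeasure_iUnion {M : ℕ → Set G} (hM : ∀ i, MeasurableSet (M i))
    (hd : Pairwise (Function.onFun Disjoint M)) (z : G ⧸ H) :
    fibreMeasure μH (⋃ i, M i) z = ∑' i, fibreMeasure μH (M i) z := by
  induction z using QuotientGroup.induction_on with
  | H g =>
    simp only [fibreMeasure_mk]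
    rw [← measure_iUnion]
    · congr 1
      ext h; simp
    · intro i j hij
      exact (hd hij).preimage (fun h : H => g * h)
    · intro i
      exact (measurable_subtype_coe.const_mul g) (hM i)

/-- The measure `M ↦ ∫ μ_H{h | gh ∈ M} dμ_Z(gH)` on `G`. -/
def fibreIntegral [LocallyCompactSpace H] : Measure G :=
  Measure.ofMeasurable (fun M _ => ∫⁻ z, fibreMeasure μH M z ∂μZ)
    (by
      rw [← lintegral_zero (μ := μZ)]
      refine lintegral_congr fun z => ?_
      induction z using QuotientGroup.induction_on with
      | H g => simp [fibreMeasure_mk])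
    (by
      intro M hM hd
      simp only [fibreMeasure_iUnion μH hM hd]
      exact lintegral_tsum fun i => (measurable_fibreMeasure μH (hM i)).aemeasurable)

theorem fibreIntegral_apply [LocallyCompactSpace H] {M : Set G} (hM : MeasurableSet M) :
    fibreIntegral μH μZ M = ∫⁻ z, fibreMeasure μH M z ∂μZ :=
  Measure.ofMeasurable_apply M hM

theorem measurePreserving_smul_quotient (g : G) :
    MeasurePreserving (fun z : G ⧸ H => g • z) μZ μZ := by
  have hm : Measurable (fun z : G ⧸ H => g • z) := by
    refine QuotientGroup.measurable_from_quotient.2 ?_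
    exact QuotientGroup.measurable_coe.comp (measurable_const_mul g)
  refine ⟨hm, Measure.ext fun s hs => ?_⟩
  rw [Measure.map_apply hm hs]
  exact SMulInvariantMeasure.measure_preimage_smul g hs

/-- Weil's formula. -/
theorem exists_lintegral_fibreMeasure_eq (hH : IsClosed (H : Set G)) :
    ∃ c : NNReal, ∀ M : Set G, MeasurableSet M →
      ∫⁻ z, fibreMeasure μH M z ∂μZ = c * μG M := by
  have hHlc : LocallyCompactSpace H := hH.isClosedEmbedding_subtypeVal.locallyCompactSpace
  have hinv : (fibreIntegral μH μZ).IsMulLeftInvariant := by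
    refine ⟨fun g => Measure.ext fun M hM => ?_⟩
    rw [Measure.map_apply (measurable_const_mul g) hM,
      fibreIntegral_apply μH μZ ((measurable_const_mul g) hM), fibreIntegral_apply μH μZ hM,
      ← (measurePreserving_smul_quotient μZ g).lintegral_comp (measurable_fibreMeasure μH hM)]
    refine lintegral_congr fun z => ?_
    induction z using QuotientGroup.induction_on with
    | H x =>
      change μH {h : H | g * (x * h) ∈ M} = μH {h : H | g * x * h ∈ M}
      simp only [mul_assoc]
  -- A fibre of `K` that meets `K` is a translate of a subset of the compact set `K⁻¹ K ∩ H`, and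
  -- the base points involved lie in the compact image of `K`.
  have hfin : IsFiniteMeasureOnCompacts (fibreIntegral μH μZ) := by
    refine ⟨fun K hK => ?_⟩
    have hKm := hK.measurableSet
    rw [fibreIntegral_apply μH μZ hKm]
    have hKK : IsCompact ((fun h : H => (h : G)) ⁻¹' (K⁻¹ * K)) :=
      hH.isClosedEmbedding_subtypeVal.isCompact_preimage (hK.inv.mul hK)
    set b := μH ((fun h : H => (h : G)) ⁻¹' (K⁻¹ * K))
    have hmeas := measurable_fibreMeasure μH (H := H) hKm
    have hle : ∀ z, fibreMeasure μH K z ≤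
        ({z | fibreMeasure μH K z ≠ 0} : Set (G ⧸ H)).indicator (fun _ => b) z := by
      intro z
      by_cases hz : fibreMeasure μH K z = 0
      · rw [hz]; exact zero_le
      · rw [Set.indicator_of_mem (show z ∈ {z | fibreMeasure μH K z ≠ 0} from hz)]
        induction z using QuotientGroup.induction_on with
        | H g =>
          obtain ⟨h₀, hh₀⟩ := nonempty_of_measure_ne_zero hz
          have h1 : (g : G ⧸ H) = ((g * h₀ : G) : G ⧸ H) := by
            rw [QuotientGroup.eq]; simp
          rw [h1, fibreMeasure_mk]
          refine measure_mono fun h hh => ?_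
          exact ⟨(g * h₀)⁻¹, Set.inv_mem_inv.2 hh₀, g * h₀ * h, hh, by group⟩
    have hS : MeasurableSet {z | fibreMeasure μH K z ≠ 0} :=
      hmeas (measurableSet_singleton 0).compl
    refine (lintegral_mono hle).trans_lt ?_
    rw [lintegral_indicator hS, setLIntegral_const]
    refine ENNReal.mul_lt_top hKK.measure_lt_top ?_
    have hKZ : IsCompact ((fun g : G => (g : G ⧸ H)) '' K) :=
      hK.image QuotientGroup.continuous_mk
    refine (measure_mono ?_).trans_lt hKZ.measure_lt_top
    intro z hz
    induction z using QuotientGroup.induction_on with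
    | H g =>
      obtain ⟨h₀, hh₀⟩ := nonempty_of_measure_ne_zero hz
      refine ⟨g * h₀, hh₀, ?_⟩
      change ((g * h₀ : G) : G ⧸ H) = g
      rw [eq_comm, QuotientGroup.eq]; simp
  -- Uniqueness of Haar measure.
  refine ⟨Measure.haarScalarFactor (fibreIntegral μH μZ) μG, fun M hM => ?_⟩
  rw [← fibreIntegral_apply μH μZ hM]
  conv_lhs => rw [Measure.isMulLeftInvariant_eq_smul (fibreIntegral μH μZ) μG]
  rfl

/-- If `G/H` carries an invariant measure, the modular functions agree on `H`. -/
theorem modularCharacterFun_subgroup_eq [LocallyCompactSpace H] (hH : IsClosed (H : Set G))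
    (hμZ : μZ ≠ 0) (h₀ : H) :
    Measure.modularCharacterFun h₀ = Measure.modularCharacterFun (h₀ : G) := by
  let μG : Measure G := Measure.haar
  let μH : Measure H := Measure.haar
  obtain ⟨c, hc⟩ := exists_lintegral_fibreMeasure_eq μG μH μZ hH
  -- If `c = 0`, the formula for the whole group forces almost every fibre, a copy of `H`, to have
  -- measure zero, against `μZ ≠ 0`.
  have hc0 : (c : ENNReal) ≠ 0 := by
    intro h0
    have h1 := hc Set.univ MeasurableSet.univ
    rw [h0, zero_mul, lintegral_eq_zero_iff (measurable_fibreMeasure μH MeasurableSet.univ)] at h1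
    apply hμZ
    rw [← Measure.measure_univ_eq_zero]
    refine measure_mono_null ?_ (ae_iff.1 h1)
    intro z _ hz
    induction z using QuotientGroup.induction_on with
    | H g =>
      have hz : μH {h : H | g * h ∈ Set.univ} = 0 := hz
      simp only [Set.mem_univ, Set.ofPred_true] at hz
      exact NeZero.ne μH (Measure.measure_univ_eq_zero.1 hz)
  obtain ⟨K, hK, hK1⟩ := exists_compact_mem_nhds (1 : G)
  have hKm := hK.measurableSet
  -- Translating `K` on the right by `h₀` multiplies the right side of Weil's formula by the modular
  -- function of `G` and each fibre by that of `H`.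
  have h1 := hc {x | x * (h₀ : G) ∈ K} ((measurable_mul_const (h₀ : G)) hKm)
  rw [measure_preimage_mul_right_eq μG (h₀ : G) hKm] at h1
  have h2 : ∀ z, fibreMeasure μH {x | x * (h₀ : G) ∈ K} z =
      Measure.modularCharacterFun h₀ * fibreMeasure μH K z := by
    intro z
    induction z using QuotientGroup.induction_on with
    | H g =>
      have hm : MeasurableSet {h : H | g * h ∈ K} := (measurable_subtype_coe.const_mul g) hKm
      rw [fibreMeasure_mk, fibreMeasure_mk, ← measure_preimage_mul_right_eq μH h₀ hm]
      congr 1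
      ext h
      simp [mul_assoc]
  rw [lintegral_congr h2, lintegral_const_mul _ (measurable_fibreMeasure μH hKm), hc K hKm,
    mul_left_comm] at h1
  have hK0 : μG K ≠ 0 := (Measure.measure_pos_of_mem_nhds μG hK1).ne'
  have hKtop : μG K ≠ ⊤ := hK.measure_lt_top.ne
  rw [ENNReal.mul_right_inj hc0 ENNReal.coe_ne_top, ENNReal.mul_left_inj hK0 hKtop] at h1
  exact_mod_cast h1

/-- The comparison of the volume of `E a · z₀` with the volume of its inverse image, given a lower
bound of the volume of `a⁻¹ B₁ a ∩ H`. -/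
theorem exists_mul_measure_orbitSet_le (hH : IsClosed (H : Set G)) :
    ∃ c : NNReal, ∀ (a : G) (B₁ : Set G) (b : ENNReal), Measure.modularCharacterFun a = 1 →
      b ≤ μH {h : H | a * (h : G) * a⁻¹ ∈ B₁} → ∀ E ⊆ B₁,
      b * μZ (orbitSet H E a) ≤ c * μG (pullbackSet H B₁ E a) := by
  have hHlc : LocallyCompactSpace H := hH.isClosedEmbedding_subtypeVal.locallyCompactSpace
  obtain ⟨c, hc⟩ := exists_lintegral_fibreMeasure_eq μG μH μZ hH
  refine ⟨c, fun a B₁ b ha hb E hE => ?_⟩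
  obtain ⟨M, hPM, hMm, hM⟩ := exists_measurable_superset μG (pullbackSet H B₁ E a)
  have hainv : Measure.modularCharacterFun a⁻¹ = 1 := by
    have := Measure.modularCharacterFun_map_mul a a⁻¹
    rwa [mul_inv_cancel, Measure.modularCharacterFun_map_one, ha, one_mul, eq_comm] at this
  -- The right translate of the hull `M` by `a`. If `a h a⁻¹ ∈ B₁` then `e a h a⁻¹` lies in `B₁ B₁`
  -- and has the same base point as `e`, so the fibre over `e a z₀` has measure at least `b`;
  -- Markov's inequality concludes.
  have hM' : MeasurableSet {x | x * a⁻¹ ∈ M} := (measurable_mul_const a⁻¹) hMm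
  have h1 := hc _ hM'
  rw [measure_preimage_mul_right_eq μG a⁻¹ hMm, hainv, ENNReal.coe_one, one_mul, hM] at h1
  rw [← h1]
  refine le_trans ?_ (mul_meas_ge_le_lintegral (measurable_fibreMeasure μH hM') b)
  gcongr
  rintro _ ⟨e, he, rfl⟩
  change b ≤ μH {h : H | e * a * h * a⁻¹ ∈ M}
  refine hb.trans (measure_mono fun h hh => hPM ⟨?_, e, he, ?_⟩)
  · exact ⟨e, hE he, a * h * a⁻¹, hh, by simp only [mul_assoc]⟩
  · change ((e * a : G) : G ⧸ H) = _
    rw [QuotientGroup.eq]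
    simp [mul_assoc]

end Weil

end RealSpherical
end

noncomputable section

open MeasureTheory NormedSpace Filter
open scoped Pointwise Topology Matrix.Norms.Operator

set_option linter.unusedSectionVars false

namespace RealSpherical

attribute [local instance 100] LieRing.ofAssociativeRing

/-! ### A lower bound for the volume of `a⁻¹ B₁ a ∩ H` -/

/-- For a fixed small ball `D`, the bound on `f` keeps `f D` inside the exponential chart of `H`,
and the bound on `Ad(a) ∘ f` puts `a exp(f D) a⁻¹` into `B₁`. The volume of `exp(f D)` is then at
least a constant times `|det f|`. -/
theorem exists_le_measure_conj_mem {n : ℕ} {G : Type*} [Group G] [TopologicalSpace G]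
    [IsTopologicalGroup G] [T2Space G] [LocallyCompactSpace G] [MeasurableSpace G] [BorelSpace G]
    {p : G →* GL (Fin n) ℝ} (hp : IsFiniteClosedHom p) {H : Subgroup G}
    (hH : IsClosed (H : Set G)) (μH : Measure H) [μH.IsHaarMeasure] {B₁ : Set G}
    (hB₁ : B₁ ∈ 𝓝 (1 : G)) (K : ℝ) :
    ∃ C : ℝ, 0 < C ∧ ∀ (a : G) (f : Module.End ℝ (lieOf p H).toSubmodule),
      (∀ X, ‖(f X : Mat n)‖ ≤ K * ‖(X : Mat n)‖) →
      (∀ X, ‖(p a : Mat n) * (f X : Mat n) * (((p a)⁻¹ : GL (Fin n) ℝ) : Mat n)‖ ≤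
        K * ‖(X : Mat n)‖) →
      ENNReal.ofReal (C * |LinearMap.det f|) ≤ μH {h : H | a * (h : G) * a⁻¹ ∈ B₁} := by
  have hHlc : LocallyCompactSpace H := hH.isClosedEmbedding_subtypeVal.locallyCompactSpace
  have hq := hp.comp_subtype hH
  have hlie : (lieOf (p.comp H.subtype) ⊤).toSubmodule = (lieOf p H).toSubmodule := by
    rw [lieOf_comp_subtype]
  obtain ⟨d, e, hinj, hrange⟩ := exists_linear_coordinates (lieOf p H).toSubmodule
  set L := (lieOf p H).toSubmodule.subtype ∘ₗ e.toLinearMap with hL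
  obtain ⟨r, hr, C, hC, hcomp⟩ := hq.exists_measure_gexp_comparable μH L hinj
    (hrange.trans hlie.symm)
  obtain ⟨r', hr', hrU⟩ := Metric.eventually_nhds_iff_ball.1 (hp.eventually_gexp_mem hB₁)
  have hmem : ∀ v, L v ∈ lieOf p H := fun v => (e v).2
  obtain ⟨K₁, hK₁, h1⟩ := exists_norm_le_map L hinj
  obtain ⟨K₂, h2⟩ := exists_norm_map_le L
  set K' : ℝ := |K| with hK'
  have hK'0 : 0 ≤ K' := abs_nonneg _
  -- `A` collects the operator norms of the coordinates and the bound `K`; the added ones keep it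
  -- positive. The radius is chosen so that everything lands within `min r r' / 2`.
  set A : ℝ := (K₁ + 1) * (K' * K₂ + 1) with hA
  have hA0 : 0 < A := by positivity
  set ρ : ℝ := min r r' / (2 * A) with hρ
  have hmin : 0 < min r r' := lt_min hr hr'
  have hρ0 : 0 < ρ := by positivity
  set D := Metric.closedBall (0 : Fin d → ℝ) ρ with hD
  have hDc : IsCompact D := isCompact_closedBall _ _
  have hD0 : volume D ≠ 0 := (Metric.measure_closedBall_pos _ _ hρ0).ne'
  have hDtop : volume D ≠ ⊤ := hDc.measure_lt_top.ne
  -- Nonvanishing of `C`, needed to divide by it, is read off from the comparison on a small ball of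
  -- positive volume.
  have hC0 : C ≠ 0 := by
    intro h0
    rw [h0] at hcomp
    have hb := (hcomp (Metric.closedBall 0 (r / 2))
      (Metric.closedBall_subset_ball (by linarith)) (isCompact_closedBall _ _)).1
    rw [zero_mul] at hb
    exact (Metric.measure_closedBall_pos volume (0 : Fin d → ℝ) (half_pos hr)).not_ge hb
  refine ⟨(volume D / C).toReal, ENNReal.toReal_pos (ENNReal.div_ne_zero.2 ⟨hD0, hC⟩)
    (ENNReal.div_ne_top hDtop hC0), fun a f hf hf' => ?_⟩
  let T' : (Fin d → ℝ) →ₗ[ℝ] (Fin d → ℝ) := e.symm.toLinearMap ∘ₗ f ∘ₗ e.toLinearMap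
  have hdet : LinearMap.det T' = LinearMap.det f := by
    have := LinearMap.det_conj f e.symm
    simpa [T'] using this
  have hLT : ∀ v, L (T' v) = f (e v) := by
    intro v
    simp only [hL, T', LinearMap.comp_apply, LinearEquiv.coe_coe, LinearEquiv.apply_symm_apply,
      Submodule.subtype_apply]
  have hcont : Continuous T' := T'.continuous_of_finiteDimensional
  have hbound : ∀ v ∈ D, ∀ x : ℝ, x ≤ K * ‖L v‖ → (K₁ + 1) * x < min r r' := by
    intro v hv x hx
    have hv' : ‖v‖ ≤ ρ := by simpa [hD] using hv
    have h3 : x ≤ K' * (K₂ * ρ) := by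
      calc x ≤ K * ‖L v‖ := hx
        _ ≤ K' * ‖L v‖ := mul_le_mul_of_nonneg_right (le_abs_self K) (norm_nonneg _)
        _ ≤ K' * (K₂ * ‖v‖) := by gcongr; exact h2 v
        _ ≤ K' * (K₂ * ρ) := by gcongr
    have h4 : A * ρ = min r r' / 2 := by rw [hρ]; field_simp
    have h5 : (K₁ + 1 : ℝ) * x ≤ (K₁ + 1) * (K' * (K₂ * ρ)) := by gcongr
    have h6 : (K₁ + 1 : ℝ) * (K' * (K₂ * ρ)) ≤ A * ρ := by
      rw [hA]
      have h7 : (0 : ℝ) ≤ (K₁ + 1) * ρ := by positivity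
      nlinarith
    linarith
  have hTD : T' '' D ⊆ Metric.ball 0 r := by
    rintro _ ⟨v, hv, rfl⟩
    rw [mem_ball_zero_iff]
    have h3 := hbound v hv _ (hf (e v))
    have h4 := h1 (T' v)
    rw [hLT] at h4
    have h5 := norm_nonneg (f (e v) : Mat n)
    have h6 := min_le_left r r'
    nlinarith
  have h3 := (hcomp (T' '' D) hTD (hDc.image hcont)).1
  rw [Measure.addHaar_image_linearMap, hdet] at h3
  have h4 : (fun v => gexp (p.comp H.subtype) (L v)) '' (T' '' D) ⊆
      {h : H | a * (h : G) * a⁻¹ ∈ B₁} := by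
    rintro _ ⟨_, ⟨v, hv, rfl⟩, rfl⟩
    have hLv := lieOf_mono (q := p) (le_top : H ≤ ⊤) (hmem (T' v))
    change a * ((gexp (p.comp H.subtype) (L (T' v)) : H) : G) * a⁻¹ ∈ B₁
    rw [coe_gexp_comp_subtype hp hH (hmem _), conj_gexp hp hLv]
    refine hrU _ ?_ ?_
    · rw [mem_ball_zero_iff, hLT]
      have h5 := hbound v hv _ (hf' (e v))
      have h6 := norm_nonneg ((p a : Mat n) * (f (e v) : Mat n) *
        (((p a)⁻¹ : GL (Fin n) ℝ) : Mat n))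
      have h7 := min_le_right r r'
      have h8 : (0 : ℝ) ≤ K₁ := K₁.2
      nlinarith
    · rw [lieOf_top_eq] at hLv ⊢
      exact conj_mem_lieAlg hp.isClosed_range ⟨a, rfl⟩ hLv
  calc ENNReal.ofReal ((volume D / C).toReal * |LinearMap.det f|)
      = volume D / C * ENNReal.ofReal |LinearMap.det f| := by
        rw [ENNReal.ofReal_mul ENNReal.toReal_nonneg,
          ENNReal.ofReal_toReal (ENNReal.div_ne_top hDtop hC0)]
    _ = ENNReal.ofReal |LinearMap.det f| * volume D / C := by
        simp only [div_eq_mul_inv]; ring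
    _ ≤ μH ((fun v => gexp (p.comp H.subtype) (L v)) '' (T' '' D)) := by
        exact ENNReal.div_le_of_le_mul' h3
    _ ≤ _ := measure_mono h4

end RealSpherical
end

noncomputable section

open MeasureTheory NormedSpace Filter
open scoped Pointwise Topology Matrix.Norms.Operator

set_option linter.unusedSectionVars false

namespace RealSpherical

/-! ### Diagonalizable endomorphisms and weight bases -/

section Weights

open Polynomial

/-- The monic polynomial with the simple roots `s`. -/
def rootPoly (s : Finset ℝ) : ℝ[X] := ∏ c ∈ s, (X - C c)

theorem separable_rootPoly (s : Finset ℝ) : (rootPoly s).Separable :=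
  separable_prod_X_sub_C_iff'.2 fun _ _ _ _ h => h

/-- Coprime linear factors split the kernel of the annihilating polynomial into eigenspaces. -/
theorem iSup_eigenspace_eq_top {V : Type*} [AddCommGroup V] [Module ℝ V] {f : Module.End ℝ V}
    {s : Finset ℝ} (h : aeval f (rootPoly s) = 0) : ⨆ μ, f.eigenspace μ = ⊤ := by
  have key : ∀ s : Finset ℝ, LinearMap.ker (aeval f (rootPoly s)) ≤ ⨆ μ, f.eigenspace μ := by
    intro s
    induction s using Finset.induction_on with
    | empty => simp [rootPoly, Module.End.one_eq_id]
    | insert c s hc ih =>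
      have h1 : rootPoly (insert c s) = (X - C c) * rootPoly s := Finset.prod_insert hc
      have h2 : IsCoprime (X - C c) (rootPoly s) :=
        IsCoprime.prod_right fun d hd => isCoprime_X_sub_C_of_isUnit_sub
          (sub_ne_zero.2 (ne_of_mem_of_not_mem hd hc).symm).isUnit
      rw [h1, ← sup_ker_aeval_eq_ker_aeval_mul_of_coprime f h2]
      refine sup_le (le_trans (le_of_eq ?_) (le_iSup _ c)) ih
      rw [Module.End.eigenspace_def]
      simp [Algebra.algebraMap_eq_smul_one]
  rw [eq_top_iff]
  refine le_trans (le_of_eq ?_) (key s)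
  rw [h, LinearMap.ker_zero]

theorem exists_aeval_smul_rootPoly {A : Type*} [Ring A] [Algebra ℝ A] {Z : A} {s : Finset ℝ}
    (h : aeval Z (rootPoly s) = 0) (c : ℝ) : ∃ s' : Finset ℝ, aeval (c • Z) (rootPoly s') = 0 := by
  rcases eq_or_ne c 0 with rfl | hc
  · exact ⟨{0}, by simp [rootPoly]⟩
  · refine ⟨s.image (c * ·), ?_⟩
    have h1 : c • Z = aeval Z (C c * X) := by simp [Algebra.smul_def]
    have h2 : (rootPoly (s.image (c * ·))).comp (C c * X) = C c ^ s.card * rootPoly s := by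
      rw [rootPoly, Finset.prod_image fun x _ y _ hxy => mul_left_cancel₀ hc hxy, prod_comp,
        rootPoly, ← Finset.prod_const, ← Finset.prod_mul_distrib]
      exact Finset.prod_congr rfl fun a _ => by simp [mul_sub]
    rw [h1, ← aeval_comp, h2, map_mul, h, mul_zero]

/-- Conjugation by a unit. -/
def conjAlgHom {A : Type*} [Ring A] [Algebra ℝ A] (g : Aˣ) : A →ₐ[ℝ] A :=
  AlgHom.ofLinearMap (LinearMap.mulLeft ℝ (g : A) ∘ₗ LinearMap.mulRight ℝ ((g⁻¹ : Aˣ) : A))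
    (by simp) fun x y => by simp [mul_assoc]

theorem conjAlgHom_apply {A : Type*} [Ring A] [Algebra ℝ A] (g : Aˣ) (X : A) :
    conjAlgHom g X = (g : A) * X * ((g⁻¹ : Aˣ) : A) := (mul_assoc _ _ _).symm

theorem conjAlgHom_mul {A : Type*} [Ring A] [Algebra ℝ A] (g h : Aˣ) (X : A) :
    conjAlgHom (g * h) X = conjAlgHom g (conjAlgHom h X) := by
  simp [conjAlgHom_apply, mul_assoc]

theorem conjAlgHom_one {A : Type*} [Ring A] [Algebra ℝ A] (X : A) :
    conjAlgHom (1 : Aˣ) X = X := by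
  simp [conjAlgHom_apply]

theorem aeval_rootPoly_of_eq_conj_diagonal {n : ℕ} {Z : Mat n} {g : GL (Fin n) ℝ} {d : Fin n → ℝ}
    (h : Z = (g : Mat n) * Matrix.diagonal d * ((g⁻¹ : GL (Fin n) ℝ) : Mat n)) :
    aeval Z (rootPoly (Finset.univ.image d)) = 0 := by
  rw [h, ← conjAlgHom_apply, aeval_algHom_apply]
  have : Matrix.diagonal d = Matrix.diagonalAlgHom ℝ d := rfl
  rw [this, aeval_algHom_apply]
  have h0 : aeval d (rootPoly (Finset.univ.image d)) = 0 := by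
    ext i
    rw [aeval_pi_apply]
    simp only [rootPoly, coe_aeval_eq_eval, Pi.zero_apply, eval_prod]
    exact Finset.prod_eq_zero (Finset.mem_image_of_mem d (Finset.mem_univ i)) (by simp)
  rw [h0, map_zero, map_zero]

attribute [local instance 100] LieRing.ofAssociativeRing

theorem aeval_mulLeft_eq_zero {n : ℕ} {Z : Mat n} {m : ℝ[X]} (h : aeval Z m = 0) :
    aeval (LinearMap.mulLeft ℝ Z) m = 0 := by
  have : aeval (Algebra.lmul ℝ (Mat n) Z) m = 0 := by
    rw [aeval_algHom_apply, h, map_zero]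
  simpa using! this

theorem aeval_mulRight_eq_zero {n : ℕ} {Z : Mat n} {m : ℝ[X]} (h : aeval Z m = 0) :
    aeval (LinearMap.mulRight ℝ Z) m = 0 := by
  have hrw : LinearMap.mulRight ℝ Z =
      (Algebra.lsmul (A := (Mat n)ᵐᵒᵖ) ℝ ℝ (Mat n)) (.op Z) := by
    ext; simp [Algebra.lsmul]
  rw [hrw, aeval_algHom_apply, aeval_op_apply, h, MulOpposite.op_zero, map_zero]

/-- `ad Z` is the difference of left and right multiplication by `Z`, which commute and are both
annihilated by the same separable polynomial. -/
theorem isSemisimple_ad {n : ℕ} {Z : Mat n} {s : Finset ℝ} (h : aeval Z (rootPoly s) = 0) :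
    (LieModule.toEnd ℝ (Mat n) (Mat n) Z).IsSemisimple := by
  have h1 : Module.End.IsSemisimple (LinearMap.mulLeft ℝ Z) :=
    Module.End.isSemisimple_of_squarefree_aeval_eq_zero (separable_rootPoly s).squarefree
      (aeval_mulLeft_eq_zero h)
  have h2 : Module.End.IsSemisimple (LinearMap.mulRight ℝ Z) :=
    Module.End.isSemisimple_of_squarefree_aeval_eq_zero (separable_rootPoly s).squarefree
      (aeval_mulRight_eq_zero h)
  exact h1.sub_of_commute (LinearMap.commute_mulLeft_right Z Z) h2

/-- On a joint eigenspace of left and right multiplication `ad Z` acts by the difference of the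
eigenvalues, and these spaces span. -/
theorem iSup_eigenspace_ad_eq_top {n : ℕ} {Z : Mat n} {s : Finset ℝ}
    (h : aeval Z (rootPoly s) = 0) :
    ⨆ μ, (LieModule.toEnd ℝ (Mat n) (Mat n) Z).eigenspace μ = ⊤ := by
  have hl := aeval_mulLeft_eq_zero h
  have hr := aeval_mulRight_eq_zero h
  let f : Bool → Module.End ℝ (Mat n) := fun b =>
    if b then LinearMap.mulLeft ℝ Z else LinearMap.mulRight ℝ Z
  have hs : ∀ b, (f b).IsSemisimple := by
    intro b
    cases b
    · exact Module.End.isSemisimple_of_squarefree_aeval_eq_zero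
        (separable_rootPoly s).squarefree hr
    · exact Module.End.isSemisimple_of_squarefree_aeval_eq_zero
        (separable_rootPoly s).squarefree hl
  have hmax : ∀ b μ, (f b).maxGenEigenspace μ = (f b).eigenspace μ := fun b μ =>
    (hs b).isFinitelySemisimple.maxGenEigenspace_eq_eigenspace μ
  have h1 : ⨆ χ : Bool → ℝ, ⨅ b, (f b).maxGenEigenspace (χ b) = ⊤ := by
    refine Module.End.iSup_iInf_maxGenEigenspace_eq_top_of_iSup_maxGenEigenspace_eq_top_of_commute
      f ?_ ?_
    · intro a b hab
      cases a <;> cases b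
      · exact absurd rfl hab
      · exact (LinearMap.commute_mulLeft_right Z Z).symm
      · exact LinearMap.commute_mulLeft_right Z Z
      · exact absurd rfl hab
    · intro b
      simp only [hmax]
      cases b
      · exact iSup_eigenspace_eq_top hr
      · exact iSup_eigenspace_eq_top hl
  rw [eq_top_iff, ← h1]
  refine iSup_le fun χ X hX => ?_
  refine Submodule.mem_iSup_of_mem (χ true - χ false) ?_
  simp only [hmax, Submodule.mem_iInf] at hX
  have h2 := Module.End.mem_eigenspace_iff.1 (hX true)
  have h3 := Module.End.mem_eigenspace_iff.1 (hX false)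
  simp only [f, if_true, LinearMap.mulLeft_apply] at h2
  simp only [f, Bool.false_eq_true, if_false, LinearMap.mulRight_apply] at h3
  rw [Module.End.mem_eigenspace_iff, LieModule.toEnd_apply_apply, Ring.lie_def, h2, h3, sub_smul]

/-- A subspace that is stable under a commuting family of diagonalizable matrices has a basis
consisting of weight vectors. -/
theorem exists_weightBasis {n : ℕ} {𝔟 W : Submodule ℝ (Mat n)}
    (hdiag : ∀ Y ∈ 𝔟, ∃ s : Finset ℝ, aeval Y (rootPoly s) = 0)
    (hcomm : ∀ X ∈ 𝔟, ∀ Y ∈ 𝔟, ⁅X, Y⁆ = 0) (hW : ∀ Y ∈ 𝔟, ∀ X ∈ W, ⁅Y, X⁆ ∈ W) :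
    ∃ (ι : Type) (_ : Fintype ι) (_ : DecidableEq ι) (b : Module.Basis ι ℝ W)
      (w : ι → Module.Dual ℝ 𝔟), ∀ i (Y : 𝔟), ⁅(Y : Mat n), (b i : Mat n)⁆ = w i Y • (b i : Mat n) := by
  let f : 𝔟 → Module.End ℝ W := fun Y =>
    (LieModule.toEnd ℝ (Mat n) (Mat n) (Y : Mat n)).restrict (hW Y Y.2)
  have hf : ∀ (Y : 𝔟) (X : W), (f Y X : Mat n) = ⁅(Y : Mat n), (X : Mat n)⁆ := fun _ _ => rfl
  have htop : ∀ Y, ⨆ μ, (f Y).maxGenEigenspace μ = ⊤ := by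
    intro Y
    obtain ⟨s, hs⟩ := hdiag Y Y.2
    have h1 : ⨆ μ, (f Y).genEigenspace μ 1 = ⊤ := Module.End.genEigenspace_restrict_eq_top _
      (by simpa [Module.End.eigenspace] using iSup_eigenspace_ad_eq_top hs)
    rw [eq_top_iff, ← h1]
    exact iSup_mono fun μ => (Module.End.genEigenspace _ μ).monotone le_top
  have hmax : ∀ Y μ, (f Y).maxGenEigenspace μ = (f Y).eigenspace μ := by
    intro Y μ
    obtain ⟨s, hs⟩ := hdiag Y Y.2
    have h2 : W ∈ (LieModule.toEnd ℝ (Mat n) (Mat n) (Y : Mat n)).invtSubmodule :=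
      (Module.End.mem_invtSubmodule _).2 fun X hX => hW Y Y.2 X hX
    exact ((isSemisimple_ad hs).restrict h2).isFinitelySemisimple.maxGenEigenspace_eq_eigenspace μ
  have hspan := Module.End.iSup_iInf_maxGenEigenspace_eq_top_of_iSup_maxGenEigenspace_eq_top_of_commute
    f (fun Y Y' _ => by
      refine LinearMap.ext fun X => Subtype.ext ?_
      have := hcomm Y Y.2 Y' Y'.2
      simp only [Module.End.mul_apply, hf]
      rw [leibniz_lie, this, zero_lie, zero_add]) htop
  -- Joint eigenvectors, with no linearity required of the eigenvalue as a function of `Y`;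
  -- linearity is recovered below by reading the eigenvalue as a coordinate of `ad Y (b i)`.
  let S : Set W := {X | ∃ χ : 𝔟 → ℝ, ∀ Y : 𝔟, ⁅(Y : Mat n), (X : Mat n)⁆ = χ Y • (X : Mat n)}
  have hS : ⊤ ≤ Submodule.span ℝ S := by
    rw [← hspan]
    refine iSup_le fun χ X hX => Submodule.subset_span ⟨χ, fun Y => ?_⟩
    simp only [hmax, Submodule.mem_iInf] at hX
    have := congrArg (Subtype.val : W → Mat n) (Module.End.mem_eigenspace_iff.1 (hX Y))
    simpa [hf] using this
  let b := (Module.Basis.ofSpan hS).reindex (Finite.equivFin _)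
  have hb : ∀ i, b i ∈ S := fun i => by
    rw [Module.Basis.reindex_apply]
    exact Module.Basis.ofSpan_subset hS ⟨_, rfl⟩
  choose χ hχ using hb
  refine ⟨_, inferInstance, inferInstance, b, fun i => b.coord i ∘ₗ
    { toFun := fun Y => f Y (b i)
      map_add' := fun Y Y' => Subtype.ext (add_lie (Y : Mat n) (Y' : Mat n) (b i : Mat n))
      map_smul' := fun c Y => Subtype.ext (smul_lie c (Y : Mat n) (b i : Mat n)) }, fun i Y => ?_⟩
  have : f Y (b i) = χ i Y • b i := Subtype.ext (hχ i Y)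
  change _ = b.coord i (f Y (b i)) • (b i : Mat n)
  rw [hχ i Y, this, map_smul, Module.Basis.coord_apply, Module.Basis.repr_self,
    Finsupp.single_eq_same, smul_eq_mul, mul_one]

end Weights

end RealSpherical
end

noncomputable section

open MeasureTheory NormedSpace Filter
open scoped Pointwise Topology Matrix.Norms.Operator

set_option linter.unusedSectionVars false

namespace RealSpherical

/-! ### Conjugates of a diagonalizable element of the Lie algebra -/

/-! ### Exponentials of `ad`, and conjugates near a separable element of a normed algebra. -/

section Generic

variable {𝔸 : Type*} [NormedRing 𝔸] [NormedAlgebra ℝ 𝔸] [CompleteSpace 𝔸]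

theorem hasSum_exp_apply (T : 𝔸 →L[ℝ] 𝔸) (x : 𝔸) :
    HasSum (fun k : ℕ => ((k.factorial : ℝ)⁻¹) • (T ^ k) x) (exp T x) := by
  have h := (exp_series_hasSum_exp' (𝕂 := ℝ) T).mapL (ContinuousLinearMap.apply ℝ 𝔸 x)
  simpa using h

/-- `Ad(exp N) = exp(ad N)`: left multiplication by `N` and right multiplication by `-N` commute, so
the exponential of their sum factors. -/
theorem hasSum_exp_conj (N x : 𝔸) :
    HasSum (fun k : ℕ => ((k.factorial : ℝ)⁻¹) • ((fun y => N * y - y * N)^[k] x))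
      (exp N * x * exp (-N)) := by
  set L : 𝔸 →L[ℝ] 𝔸 := ContinuousLinearMap.mul ℝ 𝔸 N with hL
  set R : 𝔸 →L[ℝ] 𝔸 := (ContinuousLinearMap.mul ℝ 𝔸).flip (-N) with hR
  have hLR : Commute L R := by
    ext y
    simp [hL, hR, mul_assoc]
  have hLk : ∀ k y, (L ^ k) y = N ^ k * y := by
    intro k
    induction k with
    | zero => intro y; simp
    | succ k ih => intro y; rw [pow_succ, pow_succ, mul_apply_eq_comp, ih]; simp [hL, mul_assoc]
  have hRk : ∀ k y, (R ^ k) y = y * (-N) ^ k := by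
    intro k
    induction k with
    | zero => intro y; simp
    | succ k ih =>
      intro y
      rw [pow_succ, pow_succ', mul_apply_eq_comp, ih]; simp [hR, mul_assoc]
  have hLe : ∀ y, exp L y = exp N * y := by
    intro y
    refine (hasSum_exp_apply L y).unique ?_
    have := (exp_series_hasSum_exp' (𝕂 := ℝ) N).mul_right y
    simpa [hLk] using this
  have hRe : ∀ y, exp R y = y * exp (-N) := by
    intro y
    refine (hasSum_exp_apply R y).unique ?_
    have := (exp_series_hasSum_exp' (𝕂 := ℝ) (-N)).mul_left y
    simpa only [hRk, mul_smul_comm] using this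
  let _ : NormedAlgebra ℚ (𝔸 →L[ℝ] 𝔸) := NormedAlgebra.restrictScalars ℚ ℝ _
  have h1 : exp (L + R) x = exp N * x * exp (-N) := by
    rw [exp_add_of_commute hLR, mul_apply_eq_comp, hRe, hLe, mul_assoc]
  rw [← h1]
  have hk : ∀ k, ((L + R) ^ k) x = (fun y => N * y - y * N)^[k] x := by
    intro k
    induction k with
    | zero => rfl
    | succ k ih =>
      rw [pow_succ', mul_apply_eq_comp, ih, Function.iterate_succ_apply']
      simp [hL, hR, sub_eq_add_neg]
  simpa only [hk] using hasSum_exp_apply (L + R) x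

theorem exp_conj_mem_of_lie_mem' {W : Submodule ℝ 𝔸} (hc : IsClosed (W : Set 𝔸)) {N : 𝔸}
    (hW : ∀ x ∈ W, N * x - x * N ∈ W) {x : 𝔸} (hx : x ∈ W) : exp N * x * exp (-N) ∈ W := by
  have hk : ∀ k, (fun y => N * y - y * N)^[k] x ∈ W := by
    intro k
    induction k with
    | zero => exact hx
    | succ k ih => rw [Function.iterate_succ_apply']; exact hW _ ih
  exact hc.mem_of_tendsto (hasSum_exp_conj N x)
    (Eventually.of_forall fun s => Submodule.sum_mem _ fun k _ => W.smul_mem _ (hk k))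

theorem exp_conj_eq_smul' {N x : 𝔸} {c : ℝ} (h : N * x - x * N = c • x) :
    exp N * x * exp (-N) = Real.exp c • x := by
  refine (hasSum_exp_conj N x).unique ?_
  have hk : ∀ k, (fun y => N * y - y * N)^[k] x = c ^ k • x := by
    intro k
    induction k with
    | zero => simp
    | succ k ih =>
      rw [Function.iterate_succ_apply', ih, mul_smul_comm, smul_mul_assoc, ← smul_sub, h, smul_smul,
        pow_succ]
  have h1 := (exp_series_hasSum_exp' (𝕂 := ℝ) c).smul_const x
  rw [← Real.exp_eq_exp_ℝ] at h1
  simpa only [hk, smul_smul, smul_eq_mul] using h1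

theorem hasStrictFDerivAt_exp_conj {E : Type*} [NormedAddCommGroup E] [NormedSpace ℝ E]
    (Z : 𝔸) (A B : E →L[ℝ] 𝔸) :
    HasStrictFDerivAt (fun x => exp (A x) * (Z + B x) * exp (-A x))
      ((ContinuousLinearMap.mul ℝ 𝔸).flip Z ∘L A + B - ContinuousLinearMap.mul ℝ 𝔸 Z ∘L A) 0 := by
  have h1 : HasStrictFDerivAt (fun x => exp (A x)) A 0 := by
    have h : HasStrictFDerivAt (exp : 𝔸 → 𝔸) (1 : 𝔸 →L[ℝ] 𝔸) (A 0) := by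
      rw [map_zero]; exact hasStrictFDerivAt_exp_zero
    exact h.comp 0 A.hasStrictFDerivAt
  have h2 : HasStrictFDerivAt (fun x => exp (-A x)) (-A) 0 := by
    have h : HasStrictFDerivAt (exp : 𝔸 → 𝔸) (1 : 𝔸 →L[ℝ] 𝔸) ((-A) 0) := by
      rw [map_zero]; exact hasStrictFDerivAt_exp_zero
    exact h.comp 0 (-A).hasStrictFDerivAt
  have h3 : HasStrictFDerivAt (fun x => Z + B x) B 0 := B.hasStrictFDerivAt.const_add Z
  refine ((h1.fun_mul' h3).fun_mul' h2).congr_fderiv ?_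
  ext x
  simp [sub_eq_add_neg]
  abel

open Polynomial in
/-- A simple root of a polynomial is isolated among the elements that commute with it. -/
theorem exists_aeval_add_eq (Z : 𝔸) (m : ℝ[X]) : ∃ q : 𝔸 → 𝔸, Continuous q ∧
    q 0 = aeval Z (derivative m) ∧
    ∀ W, Commute W Z → aeval (Z + W) m = aeval Z m + W * q W := by
  induction m using Polynomial.induction_on with
  | C a => exact ⟨fun _ => 0, continuous_const, by simp, by simp⟩
  | add p q hp hq =>
    obtain ⟨f, hf, hf0, hfW⟩ := hp
    obtain ⟨g, hg, hg0, hgW⟩ := hq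
    refine ⟨fun W => f W + g W, hf.add hg, by simp [hf0, hg0], fun W hW => ?_⟩
    rw [map_add, map_add, hfW W hW, hgW W hW, mul_add]
    abel
  | monomial k a hk =>
    obtain ⟨f, hf, hf0, hfW⟩ := hk
    have hcont : Continuous fun W : 𝔸 => aeval (Z + W) (C a * X ^ k) := by
      simp only [map_mul, map_pow, aeval_X, aeval_C]
      fun_prop
    refine ⟨fun W => aeval (Z + W) (C a * X ^ k) + f W * Z, hcont.add (hf.mul continuous_const),
      ?_, fun W hW => ?_⟩
    · change aeval (Z + 0) (C a * X ^ k) + f 0 * Z = _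
      rw [pow_succ, ← mul_assoc, derivative_mul (f := C a * X ^ k), derivative_X, mul_one, map_add,
        map_mul _ _ X, aeval_X, hf0, add_zero, add_comm]
    · have h1 : Commute W (aeval (Z + W) (C a * X ^ k)) := by
        simp only [map_mul, map_pow, aeval_X, aeval_C]
        exact Commute.mul_right (Algebra.commutes a W).symm ((hW.add_right (Commute.refl W)).pow_right k)
      rw [pow_succ, ← mul_assoc, map_mul _ (C a * X ^ k), map_mul _ (C a * X ^ k), aeval_X, aeval_X,
        mul_add, ← h1.eq, mul_add W, hfW W hW]
      noncomm_ring

-- Separability makes `m'(Z)` invertible, hence so is the cofactor of `W` in `m(Z + W) - m(Z)` for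
-- small `W`.
open Polynomial in
theorem eventually_eq_zero_of_aeval_add_eq_zero {Z : 𝔸} {m : ℝ[X]} (hm : m.Separable)
    (hZ : aeval Z m = 0) :
    ∀ᶠ W in 𝓝 (0 : 𝔸), Commute W Z → aeval (Z + W) m = 0 → W = 0 := by
  obtain ⟨q, hq, hq0, hqW⟩ := exists_aeval_add_eq Z m
  obtain ⟨u, v, huv⟩ := hm
  have h1 := congrArg (aeval Z) huv
  rw [map_add, map_mul, map_mul, hZ, mul_zero, zero_add, map_one] at h1
  have h2 : aeval Z (derivative m) * aeval Z v = 1 := by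
    rw [← h1, ← map_mul, ← map_mul, mul_comm]
  have hunit : IsUnit (q 0) := by
    rw [hq0]
    exact ⟨⟨_, _, h2, h1⟩, rfl⟩
  have hev := hq.continuousAt.eventually (Units.isOpen.mem_nhds hunit)
  filter_upwards [hev] with W hW hc h0
  rw [hqW W hc, hZ, zero_add] at h0
  exact (IsUnit.mul_left_eq_zero hW).1 h0

-- When `V = [V, Z] + C_V(Z)`, the map `(X, W) ↦ exp(X) (Z + W) exp(-X)`, with `W` commuting with
-- `Z`, is a submersion onto `V` at the origin. If the conjugate is annihilated by `m`, so is `Z +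
-- W`, and then `W = 0` because roots of `m` are isolated in the commutant.
open Polynomial in
theorem eventually_exists_conj' [FiniteDimensional ℝ 𝔸] {V : Submodule ℝ 𝔸} {Z : 𝔸}
    (hV : ∀ X ∈ V, ∀ Y ∈ V, X * Y - Y * X ∈ V) (hZV : Z ∈ V)
    (hsurj : ∀ v ∈ V, ∃ X ∈ V, ∃ W ∈ V, Commute W Z ∧ v = X * Z - Z * X + W)
    {m : ℝ[X]} (hm : m.Separable) (hZ : aeval Z m = 0) :
    ∀ᶠ Z' in 𝓝 Z, Z' ∈ V → aeval Z' m = 0 → ∃ X ∈ V, Z' = exp X * Z * exp (-X) := by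
  let K : Submodule ℝ 𝔸 :=
    { carrier := {W | W ∈ V ∧ Commute W Z}
      zero_mem' := ⟨zero_mem _, Commute.zero_left Z⟩
      add_mem' := fun h h' => ⟨add_mem h.1 h'.1, h.2.add_left h'.2⟩
      smul_mem' := fun c X h => ⟨V.smul_mem c h.1, h.2.smul_left c⟩ }
  obtain ⟨V', hV'⟩ := Submodule.exists_isCompl V
  let P : 𝔸 →L[ℝ] V := LinearMap.toContinuousLinearMap (V.projectionOnto V' hV')
  have hP : ∀ x : V, P x = x := fun x => Submodule.projectionOnto_apply_left hV' x
  let A : V × K →L[ℝ] 𝔸 := V.subtypeL ∘L ContinuousLinearMap.fst ℝ V K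
  let B : V × K →L[ℝ] 𝔸 := K.subtypeL ∘L ContinuousLinearMap.snd ℝ V K
  have hF := P.hasStrictFDerivAt.comp (0 : V × K) (hasStrictFDerivAt_exp_conj Z A B)
  have hclosed : IsClosed (V : Set 𝔸) := V.closed_of_finiteDimensional
  have hconj : ∀ x : V × K, exp (A x) * (Z + B x) * exp (-A x) ∈ V := fun x =>
    exp_conj_mem_of_lie_mem' hclosed (fun Y hY => hV _ x.1.2 Y hY) (add_mem hZV x.2.2.1)
  have hmap := hF.map_nhds_eq_of_surj (by
    rw [eq_top_iff]
    rintro v -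
    obtain ⟨X, hX, W, hW, hWZ, hv⟩ := hsurj v v.2
    refine ⟨(⟨X, hX⟩, ⟨W, hW, hWZ⟩), ?_⟩
    rw [← hP v, hv]
    simp only [ContinuousLinearMap.coe_coe, ContinuousLinearMap.comp_apply]
    congr 1
    simp [A, B]
    abel)
  have hev : ∀ᶠ x in 𝓝 (0 : V × K), aeval (Z + B x) m = 0 → B x = 0 := by
    have h0 : Tendsto B (𝓝 0) (𝓝 0) := by simpa using B.continuous.tendsto 0
    exact (h0.eventually (eventually_eq_zero_of_aeval_add_eq_zero hm hZ)).mono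
      fun x hx => hx x.2.2.2
  have himg := image_mem_map (m := fun x => P (exp (A x) * (Z + B x) * exp (-A x))) hev
  rw [hmap] at himg
  have h00 : P (exp (A 0) * (Z + B 0) * exp (-A 0)) = P Z := by simp
  rw [h00] at himg
  filter_upwards [P.continuous.continuousAt himg] with Z' hZ' hZ'V hZ'm
  obtain ⟨x, hx, hxZ⟩ := hZ'
  have h1 : exp (A x) * (Z + B x) * exp (-A x) = Z' := by
    have h2 := congrArg (Subtype.val : V → 𝔸) hxZ
    have h3 := hP ⟨_, hconj x⟩
    have h4 := hP ⟨_, hZ'V⟩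
    simp only [h4] at h2
    rw [← h2, h3]
  let _ : NormedAlgebra ℚ 𝔸 := NormedAlgebra.restrictScalars ℚ ℝ _
  have e1 : exp (A x) * exp (-A x) = 1 := by
    rw [← exp_add_of_commute (Commute.refl (A x)).neg_right, add_neg_cancel, exp_zero]
  have e2 : exp (-A x) * exp (A x) = 1 := by
    rw [← exp_add_of_commute (Commute.refl (A x)).neg_left, neg_add_cancel, exp_zero]
  let g : 𝔸ˣ := ⟨exp (A x), exp (-A x), e1, e2⟩
  have h2 : conjAlgHom g (Z + B x) = Z' := by rw [conjAlgHom_apply]; exact h1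
  have h3 : Function.Injective (conjAlgHom g) := by
    intro y z h
    simpa [conjAlgHom_apply] using h
  have h4 : B x = 0 := hx (h3 (by rw [map_zero, ← aeval_algHom_apply, h2, hZ'm]))
  rw [h4, add_zero] at h1
  exact ⟨A x, x.1.2, h1.symm⟩

theorem hasDerivAt_apply_mul' (ℓ : 𝔸 →L[ℝ] ℝ) (τ : 𝔸 →L[ℝ] 𝔸) {f : ℝ → 𝔸} {f' : 𝔸} {t : ℝ}
    (hf : HasDerivAt f f' t) :
    HasDerivAt (fun t => ℓ (f t * τ (f t))) (ℓ (f' * τ (f t) + f t * τ f')) t :=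
  ℓ.hasFDerivAt.comp_hasDerivAt t (hf.fun_mul (τ.hasFDerivAt.comp_hasDerivAt t hf))

end Generic

attribute [local instance 100] LieRing.ofAssociativeRing

/-! ### Closed orbits and symmetric representatives. -/

section Orbit

variable {n : ℕ}

theorem exp_conj_mem_of_lie_mem {W : Submodule ℝ (Mat n)} {N : Mat n}
    (hW : ∀ X ∈ W, ⁅N, X⁆ ∈ W) {X : Mat n} (hX : X ∈ W) : exp N * X * exp (-N) ∈ W :=
  exp_conj_mem_of_lie_mem' (𝔸 := Mat n) W.closed_of_finiteDimensional hW hX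

-- Since `ad Z` is diagonalizable on `𝔤`, its kernel and range span `𝔤`; this is the infinitesimal
-- surjectivity required by `eventually_exists_conj'`.
open Polynomial in
theorem eventually_exists_conj {𝔤 : LieSubalgebra ℝ (Mat n)} {Z : Mat n} (hZ : Z ∈ 𝔤)
    {s : Finset ℝ} (hs : aeval Z (rootPoly s) = 0) :
    ∀ᶠ Z' in 𝓝 Z, Z' ∈ 𝔤 → aeval Z' (rootPoly s) = 0 →
      ∃ X ∈ 𝔤, Z' = exp X * Z * exp (-X) := by
  refine eventually_exists_conj' (𝔸 := Mat n) (V := 𝔤.toSubmodule)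
    (fun X hX Y hY => 𝔤.lie_mem hX hY) hZ ?_ (separable_rootPoly s) hs
  have hcomm : ∀ X ∈ Submodule.span ℝ {Z}, ∀ Y ∈ Submodule.span ℝ {Z}, ⁅X, Y⁆ = 0 := by
    intro X hX Y hY
    obtain ⟨c, rfl⟩ := Submodule.mem_span_singleton.1 hX
    obtain ⟨d, rfl⟩ := Submodule.mem_span_singleton.1 hY
    simp
  let f : Module.End ℝ 𝔤.toSubmodule :=
    (LieModule.toEnd ℝ (Mat n) (Mat n) Z).restrict fun X hX => 𝔤.lie_mem hZ hX
  have htop : LinearMap.ker f ⊔ LinearMap.range f = ⊤ := by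
    have hd : ∀ Y ∈ Submodule.span ℝ {Z}, ∃ s : Finset ℝ, aeval Y (rootPoly s) = 0 := by
      intro Y hY
      obtain ⟨c, rfl⟩ := Submodule.mem_span_singleton.1 hY
      exact exists_aeval_smul_rootPoly hs c
    obtain ⟨ι, _, _, b, w, hw⟩ := exists_weightBasis (W := 𝔤.toSubmodule) hd hcomm
      fun Y hY X hX => 𝔤.lie_mem ((Submodule.span_singleton_le_iff_mem Z 𝔤.toSubmodule).2 hZ hY) hX
    rw [eq_top_iff, ← b.span_eq, Submodule.span_le]
    rintro _ ⟨i, rfl⟩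
    have h1 : f (b i) = w i ⟨Z, Submodule.mem_span_singleton_self Z⟩ • b i :=
      Subtype.ext (hw i ⟨Z, Submodule.mem_span_singleton_self Z⟩)
    by_cases h0 : w i ⟨Z, Submodule.mem_span_singleton_self Z⟩ = 0
    · exact Submodule.mem_sup_left (by rw [LinearMap.mem_ker, h1, h0, zero_smul])
    · refine Submodule.mem_sup_right
        ⟨(w i ⟨Z, Submodule.mem_span_singleton_self Z⟩)⁻¹ • b i, ?_⟩
      rw [map_smul, h1, smul_smul, inv_mul_cancel₀ h0, one_smul]
  intro v hv
  have hmem : (⟨v, hv⟩ : 𝔤.toSubmodule) ∈ LinearMap.ker f ⊔ LinearMap.range f := by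
    rw [htop]; trivial
  obtain ⟨W, hW, R, ⟨X, rfl⟩, hv'⟩ := Submodule.mem_sup.1 hmem
  refine ⟨-X, neg_mem X.2, W, W.2, ?_, ?_⟩
  · have : ⁅Z, (W : Mat n)⁆ = 0 := congrArg (Subtype.val : 𝔤.toSubmodule → Mat n) hW
    rw [Ring.lie_def, sub_eq_zero] at this
    exact this.symm
  · have h1 : (W : Mat n) + ⁅Z, (X : Mat n)⁆ = v :=
      congrArg (Subtype.val : 𝔤.toSubmodule → Mat n) hv'
    rw [← h1, Ring.lie_def]
    noncomm_ring

-- For a normal matrix, an eigenvector of `N` is one of `Nᵀ` with the same eigenvalue, and here real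
-- eigenvectors span.
open Polynomial Matrix in
theorem transpose_eq_of_commute {N : Mat n} (hN : Commute N Nᵀ) {s : Finset ℝ}
    (hs : aeval N (rootPoly s) = 0) : Nᵀ = N := by
  have h1 : aeval (Matrix.toLinAlgEquiv' N) (rootPoly s) = 0 := by
    have := aeval_algHom_apply (Matrix.toLinAlgEquiv' (R := ℝ) (n := Fin n)).toAlgHom N (rootPoly s)
    rw [hs, map_zero] at this
    exact this
  have h2 := iSup_eigenspace_eq_top h1
  refine Matrix.toLinAlgEquiv'.injective (LinearMap.ext fun v => ?_)
  have h3 : (⊤ : Submodule ℝ (Fin n → ℝ)) ≤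
      LinearMap.eqLocus (Matrix.toLinAlgEquiv' Nᵀ) (Matrix.toLinAlgEquiv' N) := by
    rw [← h2]
    refine iSup_le fun μ v hv => ?_
    rw [Module.End.mem_eigenspace_iff, Matrix.toLinAlgEquiv'_apply] at hv
    rw [LinearMap.mem_eqLocus, Matrix.toLinAlgEquiv'_apply, Matrix.toLinAlgEquiv'_apply, hv]
    have h4 : (N - μ • (1 : Mat n)) * Nᵀ = Nᵀ * (N - μ • (1 : Mat n)) := by
      rw [sub_mul, mul_sub, hN.eq]; simp
    have h5 : (N - μ • (1 : Mat n)) *ᵥ v = 0 := by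
      rw [sub_mulVec, hv, smul_mulVec, one_mulVec, sub_self]
    have h6 : (N - μ • (1 : Mat n)) *ᵥ ((Nᵀ - μ • (1 : Mat n)) *ᵥ v) = 0 := by
      rw [mulVec_mulVec, mul_sub, h4, sub_mulVec, ← mulVec_mulVec, h5, mulVec_zero]
      simp [h5, smul_mulVec]
    have h7 : ((Nᵀ - μ • (1 : Mat n)) *ᵥ v) ⬝ᵥ ((Nᵀ - μ • (1 : Mat n)) *ᵥ v) = 0 := by
      have : (Nᵀ - μ • (1 : Mat n)) = (N - μ • (1 : Mat n))ᵀ := by simp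
      nth_rewrite 1 [this]
      rw [mulVec_transpose, ← dotProduct_mulVec, h6, dotProduct_zero]
    have h8 := dotProduct_self_eq_zero.1 h7
    rw [sub_mulVec, smul_mulVec, one_mulVec, sub_eq_zero] at h8
    exact h8
  exact h3 (Submodule.mem_top (x := v))

theorem conjAlgHom_expGL (X Z : Mat n) : conjAlgHom (expGL X) Z = exp X * Z * exp (-X) := by
  rw [conjAlgHom_apply, expGL_val, ← expGL_neg, expGL_val]

theorem conjAlgHom_expGL_mem {W : Submodule ℝ (Mat n)} {N : Mat n}
    (hW : ∀ X ∈ W, ⁅N, X⁆ ∈ W) (X : Mat n) : conjAlgHom (expGL N) X ∈ W ↔ X ∈ W := by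
  refine ⟨fun h => ?_, fun h => ?_⟩
  · have h1 : conjAlgHom (expGL (-N)) (conjAlgHom (expGL N) X) ∈ W := by
      rw [conjAlgHom_expGL]
      refine exp_conj_mem_of_lie_mem (fun X hX => ?_) h
      rw [neg_lie]
      exact neg_mem (hW X hX)
    rwa [← conjAlgHom_mul, expGL_neg, inv_mul_cancel, conjAlgHom_one] at h1
  · rw [conjAlgHom_expGL]
    exact exp_conj_mem_of_lie_mem hW h

theorem trace_lie_mul (A B C : Mat n) : (⁅A, B⁆ * C).trace = (A * ⁅B, C⁆).trace := by
  simp only [Ring.lie_def, sub_mul, mul_sub, Matrix.trace_sub]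
  rw [← mul_assoc A C B, Matrix.trace_mul_cycle A C B, mul_assoc A B C]

theorem conjAlgHom_expGL_eq_smul {N X : Mat n} {c : ℝ} (h : ⁅N, X⁆ = c • X) :
    conjAlgHom (expGL N) X = Real.exp c • X := by
  rw [conjAlgHom_expGL]
  exact exp_conj_eq_smul' (𝔸 := Mat n) h

open Polynomial in
/-- The orbit of a diagonalizable element under the normalizer of the Lie algebra is closed. -/
theorem isClosed_conj_orbit {𝔤 : LieSubalgebra ℝ (Mat n)} {x : Mat n} (hx : x ∈ 𝔤)
    {s : Finset ℝ} (hs : aeval x (rootPoly s) = 0) :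
    IsClosed {Z : Mat n | ∃ g : GL (Fin n) ℝ, (∀ X, conjAlgHom g X ∈ 𝔤 ↔ X ∈ 𝔤) ∧
      conjAlgHom g x = Z} := by
  have hsub : {Z : Mat n | ∃ g : GL (Fin n) ℝ, (∀ X, conjAlgHom g X ∈ 𝔤 ↔ X ∈ 𝔤) ∧
      conjAlgHom g x = Z} ⊆ {Z : Mat n | Z ∈ 𝔤 ∧ aeval Z (rootPoly s) = 0} := by
    rintro _ ⟨g, hg, rfl⟩
    exact ⟨(hg x).2 hx, by rw [aeval_algHom_apply, hs, map_zero]⟩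
  have hc : IsClosed {Z : Mat n | Z ∈ 𝔤 ∧ aeval Z (rootPoly s) = 0} := by
    have h1 : Continuous fun Z : Mat n => aeval Z (rootPoly s) :=
      Polynomial.continuous_aeval (A := Mat n) _
    exact (𝔤.toSubmodule.closed_of_finiteDimensional).inter (isClosed_singleton.preimage h1)
  refine isClosed_of_closure_subset fun Z hZ => ?_
  obtain ⟨hZ𝔤, hZs⟩ := hc.closure_subset_iff.2 hsub hZ
  -- A limit point `Z` is still annihilated by the separable polynomial, so orbit points close to
  -- `Z` are conjugate to `Z`, which puts `Z` on the orbit.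
  obtain ⟨Z', ⟨g, hg, rfl⟩, h⟩ := ((mem_closure_iff_frequently.1 hZ).and_eventually
    (eventually_exists_conj hZ𝔤 hZs)).exists
  obtain ⟨X, hX, hXZ⟩ := h ((hg x).2 hx) (by rw [aeval_algHom_apply, hs, map_zero])
  refine ⟨expGL (-X) * g, fun W => ?_, ?_⟩
  · rw [conjAlgHom_mul, ← hg W]
    exact conjAlgHom_expGL_mem (W := 𝔤.toSubmodule) (fun Y hY => 𝔤.lie_mem (neg_mem hX) hY) _
  · rw [conjAlgHom_mul, hXZ, ← conjAlgHom_expGL, ← conjAlgHom_mul, expGL_neg, inv_mul_cancel,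
      conjAlgHom_one]

open Polynomial Matrix in
/-- A diagonalizable element of a Lie algebra that is stable under transposition is conjugate to a
symmetric one under the normalizer of the Lie algebra. -/
theorem exists_conj_transpose_eq {𝔤 : LieSubalgebra ℝ (Mat n)} (hT : ∀ X ∈ 𝔤, Xᵀ ∈ 𝔤)
    {x : Mat n} (hx : x ∈ 𝔤) {s : Finset ℝ} (hs : aeval x (rootPoly s) = 0) :
    ∃ g : GL (Fin n) ℝ, (∀ X, conjAlgHom g X ∈ 𝔤 ↔ X ∈ 𝔤) ∧
      (conjAlgHom g x)ᵀ = conjAlgHom g x := by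
  set O := {Z : Mat n | ∃ g : GL (Fin n) ℝ, (∀ X, conjAlgHom g X ∈ 𝔤 ↔ X ∈ 𝔤) ∧
      conjAlgHom g x = Z} with hO
  have hOc : IsClosed O := isClosed_conj_orbit hx hs
  have hxO : x ∈ O := ⟨1, fun X => by rw [conjAlgHom_one], conjAlgHom_one x⟩
  have hcont : Continuous fun Z : Mat n => (Z * Zᵀ).trace :=
    (continuous_id.matrix_mul continuous_id.matrix_transpose).matrix_trace
  have htr : ∀ (Z : Mat n) i j, Z i j ^ 2 ≤ (Z * Zᵀ).trace := by
    intro Z i j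
    simp only [Matrix.trace, Matrix.diag, Matrix.mul_apply, Matrix.transpose_apply, ← pow_two]
    refine (Finset.single_le_sum (f := fun j => Z i j ^ 2) (fun _ _ => sq_nonneg _)
      (Finset.mem_univ j)).trans (Finset.single_le_sum (f := fun i => ∑ j, Z i j ^ 2)
        (fun _ _ => Finset.sum_nonneg fun _ _ => sq_nonneg _) (Finset.mem_univ i))
  set c := (x * xᵀ).trace with hc
  have hK : IsCompact (O ∩ {Z : Mat n | (Z * Zᵀ).trace ≤ c}) := by
    have h1 : IsCompact (Set.pi Set.univ fun _ : Fin n => Set.pi Set.univ fun _ : Fin n =>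
        Set.Icc (-√c) √c : Set (Fin n → Fin n → ℝ)) :=
      isCompact_univ_pi fun _ => isCompact_univ_pi fun _ => isCompact_Icc
    refine h1.of_isClosed_subset (hOc.inter (isClosed_le hcont continuous_const)) ?_
    rintro Z ⟨-, hZ⟩ i - j -
    exact abs_le.1 (Real.abs_le_sqrt ((htr Z i j).trans hZ))
  -- A point of minimal Frobenius norm on the closed orbit; intersecting with a sublevel set
  -- provides compactness.
  obtain ⟨Z, ⟨⟨g, hg, rfl⟩, hZc⟩, hmin⟩ := hK.exists_isMinOn ⟨x, hxO, le_refl c⟩ hcont.continuousOn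
  refine ⟨g, hg, ?_⟩
  set Z := conjAlgHom g x with hZ
  have hZ𝔤 : Z ∈ 𝔤 := (hg x).2 hx
  have hcrit : ∀ X ∈ 𝔤, (⁅X, Z⁆ * Zᵀ).trace = 0 := by
    intro X hX
    have h1 : HasDerivAt (fun t : ℝ => conjAlgHom (expGL (t • X)) Z) ⁅X, Z⁆ 0 := by
      simp only [conjAlgHom_expGL]
      exact hasDerivAt_conj_exp X Z
    have h2 : HasDerivAt (fun t : ℝ => (conjAlgHom (expGL (t • X)) Z *
        (conjAlgHom (expGL (t • X)) Z)ᵀ).trace)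
        (⁅X, Z⁆ * (conjAlgHom (expGL ((0 : ℝ) • X)) Z)ᵀ +
          conjAlgHom (expGL ((0 : ℝ) • X)) Z * ⁅X, Z⁆ᵀ).trace 0 :=
      hasDerivAt_apply_mul' (𝔸 := Mat n)
        (LinearMap.toContinuousLinearMap (Matrix.traceLinearMap (Fin n) ℝ ℝ))
        (LinearMap.toContinuousLinearMap
          (Matrix.transposeLinearEquiv (Fin n) (Fin n) ℝ ℝ).toLinearMap) h1
    rw [zero_smul, expGL_zero, conjAlgHom_one] at h2
    have h3 : IsLocalMin (fun t : ℝ => (conjAlgHom (expGL (t • X)) Z *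
        (conjAlgHom (expGL (t • X)) Z)ᵀ).trace) 0 := by
      refine Eventually.of_forall fun t => ?_
      simp only [zero_smul, expGL_zero, conjAlgHom_one]
      rcases le_or_gt (conjAlgHom (expGL (t • X)) Z *
        (conjAlgHom (expGL (t • X)) Z)ᵀ).trace c with hle | hlt
      · refine hmin ⟨⟨expGL (t • X) * g, fun W => ?_, conjAlgHom_mul _ _ _⟩, hle⟩
        rw [conjAlgHom_mul, ← hg W]
        exact conjAlgHom_expGL_mem (W := 𝔤.toSubmodule)
          (fun Y hY => 𝔤.lie_mem (𝔤.smul_mem t hX) hY) _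
      · exact hZc.trans hlt.le
    have h4 := h3.hasDerivAt_eq_zero h2
    have h5 : (Z * ⁅X, Z⁆ᵀ).trace = (⁅X, Z⁆ * Zᵀ).trace := by
      rw [← Matrix.trace_transpose, Matrix.transpose_mul, Matrix.transpose_transpose]
    rw [Matrix.trace_add, h5] at h4
    linarith
  have hsym : ⁅Z, Zᵀ⁆ᵀ = ⁅Z, Zᵀ⁆ := by
    simp [Ring.lie_def, Matrix.transpose_sub, Matrix.transpose_mul]
  -- The first variation in the direction `[Z, Zᵀ]` is the squared norm of `[Z, Zᵀ]`, so `Z` is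
  -- normal.
  have h0 := hcrit _ (𝔤.lie_mem hZ𝔤 (hT _ hZ𝔤))
  have h1 : (⁅Z, Zᵀ⁆ᴴ * ⁅Z, Zᵀ⁆).trace = 0 := by
    rw [Matrix.conjTranspose_eq_transpose_of_trivial, hsym, ← trace_lie_mul, h0]
  have h2 := Matrix.trace_conjTranspose_mul_self_eq_zero_iff.1 h1
  rw [Ring.lie_def, sub_eq_zero] at h2
  exact transpose_eq_of_commute h2 (s := s) (by rw [hZ, aeval_algHom_apply, hs, map_zero])

end Orbit

end RealSpherical
end

noncomputable section

open MeasureTheory NormedSpace Filter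
open scoped Pointwise Topology Matrix.Norms.Operator

set_option linter.unusedSectionVars false

namespace RealSpherical

attribute [local instance 100] LieRing.ofAssociativeRing

/-! ### An adapted Cartan anti-involution -/

open Matrix in
/-- The Lie algebra of a real reductive group is stable under transposition. -/
theorem IsRealReductive.transpose_mem_lieOf {n : ℕ} {G : Type*} [Group G] [TopologicalSpace G]
    [IsTopologicalGroup G] [T2Space G] {p : G →* GL (Fin n) ℝ} (hp : IsRealReductive p)
    {X : Mat n} (hX : X ∈ lieOf p ⊤) : Xᵀ ∈ lieOf p ⊤ := by
  have hq := hp.isFiniteClosedHom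
  obtain ⟨-, -, S, -, hST, hpS, hopen⟩ := hp
  rw [hq.mem_lieOf_iff] at hX ⊢
  obtain ⟨V, hV, hVS⟩ := hopen Set.univ isOpen_univ
  rw [Set.image_univ] at hVS
  have hmem : ∀ t : ℝ, expGL (t • Xᵀ) ∈ S := by
    intro t
    obtain ⟨x, hx⟩ := hX t
    obtain ⟨g', hg', h⟩ := hST _ (hpS x)
    rwa [← Units.ext (show (g' : Mat n) = expGL (t • Xᵀ) by
      rw [h, hx, expGL_val, expGL_val, ← Matrix.transpose_smul]
      exact (Matrix.exp_transpose _).symm)]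
  have h1 : (1 : GL (Fin n) ℝ) ∈ V := by
    have : (1 : GL (Fin n) ℝ) ∈ Set.range p := ⟨1, map_one p⟩
    rw [hVS] at this
    exact this.1
  have hev : ∀ᶠ t : ℝ in 𝓝 0, expGL (t • Xᵀ) ∈ V := by
    refine (continuous_expGL_smul Xᵀ).continuousAt.eventually (hV.mem_nhds ?_)
    change expGL ((0 : ℝ) • Xᵀ) ∈ V
    rwa [zero_smul, expGL_zero]
  have hev' : ∀ᶠ t : ℝ in 𝓝 0, expGL (t • Xᵀ) ∈ p.range := by
    filter_upwards [hev] with t ht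
    have : expGL (t • Xᵀ) ∈ Set.range p := by
      rw [hVS]; exact ⟨ht, hmem t⟩
    exact this
  intro t
  -- The range of `p` is only known to agree with `S` near `1`, so `exp(tXᵀ)` is written as a power
  -- of an element close to `1`.
  have hlim : Tendsto (fun k : ℕ => t / (k + 1 : ℝ)) atTop (𝓝 0) := by
    have := (tendsto_one_div_add_atTop_nhds_zero_nat (𝕜 := ℝ)).const_mul t
    simpa [div_eq_mul_inv] using this
  obtain ⟨k, hk⟩ := (hlim.eventually hev').exists
  have h2 : expGL (t • Xᵀ) = expGL ((t / (k + 1 : ℝ)) • Xᵀ) ^ (k + 1) := by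
    rw [← expGL_nsmul, ← Nat.cast_smul_eq_nsmul ℝ, smul_smul]
    congr 2
    have : (k + 1 : ℝ) ≠ 0 := by positivity
    push_cast
    field_simp
  rw [h2]
  exact pow_mem hk _

/-- A linear anti-involution `τ` of the matrices (minus a Cartan involution) that preserves `𝔤`
and fixes `𝔞`. -/
structure IsCartanAnti {n : ℕ} (𝔤 : LieSubalgebra ℝ (Mat n)) (𝔞 : Submodule ℝ (Mat n))
    (τ : Mat n →ₗ[ℝ] Mat n) : Prop where
  map_mul : ∀ X Y, τ (X * Y) = τ Y * τ X
  involutive : ∀ X, τ (τ X) = X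
  pos : ∀ X, X ≠ 0 → 0 < (X * τ X).trace
  mem : ∀ X ∈ 𝔤, τ X ∈ 𝔤
  fix : ∀ Y ∈ 𝔞, τ Y = Y
  diag : ∀ X, τ X = X → ∃ (g : GL (Fin n) ℝ) (d : Fin n → ℝ),
    X = (g : Mat n) * Matrix.diagonal d * ((g⁻¹ : GL (Fin n) ℝ) : Mat n)

-- Make `x` symmetric by some `g` normalizing `𝔤`, and transport the transpose by `g`. Only `x` has
-- been made symmetric, but `τY` then commutes with `x`, so regularity makes `Y` normal after
-- conjugation, hence symmetric.
open Matrix in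
theorem exists_isCartanAnti {n : ℕ} {𝔤 : LieSubalgebra ℝ (Mat n)} (hT : ∀ X ∈ 𝔤, Xᵀ ∈ 𝔤)
    {𝔞 : Submodule ℝ (Mat n)} (h𝔞 : IsSplitAbelian 𝔤 𝔞) {x : Mat n} (hx : x ∈ 𝔞)
    (hreg : ∀ X ∈ 𝔤, ⁅x, X⁆ = 0 → ∀ Y ∈ 𝔞, ⁅Y, X⁆ = 0) :
    ∃ τ : Mat n →ₗ[ℝ] Mat n, IsCartanAnti 𝔤 𝔞 τ := by
  obtain ⟨h1, h2, h3⟩ := h𝔞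
  obtain ⟨g₀, d₀, hd₀⟩ := h2 x hx
  obtain ⟨g, hg, hgx⟩ := exists_conj_transpose_eq hT (h1 hx)
    (aeval_rootPoly_of_eq_conj_diagonal hd₀)
  let τ : Mat n →ₗ[ℝ] Mat n := (conjAlgHom g⁻¹).toLinearMap ∘ₗ
    (Matrix.transposeLinearEquiv (Fin n) (Fin n) ℝ ℝ).toLinearMap ∘ₗ (conjAlgHom g).toLinearMap
  have hτ : ∀ X, τ X = conjAlgHom g⁻¹ (conjAlgHom g X)ᵀ := fun _ => rfl
  have hgg : ∀ X, conjAlgHom g (conjAlgHom g⁻¹ X) = X := fun X => by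
    rw [← conjAlgHom_mul, mul_inv_cancel, conjAlgHom_one]
  have hgg' : ∀ X, conjAlgHom g⁻¹ (conjAlgHom g X) = X := fun X => by
    rw [← conjAlgHom_mul, inv_mul_cancel, conjAlgHom_one]
  have hgτ : ∀ X, conjAlgHom g (τ X) = (conjAlgHom g X)ᵀ := fun X => by rw [hτ, hgg]
  have htr : ∀ (g : GL (Fin n) ℝ) X, (conjAlgHom g X).trace = X.trace := fun g X => by
    rw [conjAlgHom_apply, Matrix.trace_mul_comm, ← mul_assoc, Units.inv_mul, one_mul]
  have hinj : Function.Injective (conjAlgHom g) := fun X Y h => by rw [← hgg' X, h, hgg']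
  have hmul : ∀ X Y, τ (X * Y) = τ Y * τ X := fun X Y => by
    rw [hτ, map_mul, Matrix.transpose_mul, map_mul, ← hτ, ← hτ]
  have hinv : ∀ X, τ (τ X) = X := fun X => hinj (by
    rw [hgτ, hgτ, Matrix.transpose_transpose])
  have hmem : ∀ X ∈ 𝔤, τ X ∈ 𝔤 := fun X hX => by
    rw [← hg, hgτ]
    exact hT _ ((hg X).2 hX)
  have hlie : ∀ X Y, τ ⁅X, Y⁆ = ⁅τ Y, τ X⁆ := fun X Y => by
    rw [Ring.lie_def, Ring.lie_def, map_sub, hmul, hmul]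
  have hfx : τ x = x := hinj (by rw [hgτ, hgx])
  refine ⟨τ, hmul, hinv, fun X hX => ?_,
    hmem, fun Y hY => ?_, fun X hX => ?_⟩
  · rw [← htr g, map_mul, hgτ]
    have h0 : conjAlgHom g X ≠ 0 := fun h => hX (hinj (by rw [h, map_zero]))
    refine lt_of_le_of_ne ?_ fun h => h0 ?_
    · simp only [Matrix.trace, Matrix.diag, Matrix.mul_apply, Matrix.transpose_apply]
      exact Finset.sum_nonneg fun _ _ => Finset.sum_nonneg fun _ _ => mul_self_nonneg _
    · have := Matrix.trace_mul_conjTranspose_self_eq_zero_iff (A := conjAlgHom g X)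
      rw [Matrix.conjTranspose_eq_transpose_of_trivial] at this
      exact this.1 h.symm
  · have h4 : ⁅x, τ Y⁆ = 0 := by
      have := hlie Y x
      rw [h3 Y hY x hx, map_zero, hfx] at this
      exact this.symm
    have h5 := hreg _ (hmem Y (h1 hY)) h4 Y hY
    have h6 : Commute (conjAlgHom g Y) (conjAlgHom g Y)ᵀ := by
      rw [← hgτ]
      rw [Ring.lie_def, sub_eq_zero] at h5
      change _ * _ = _ * _
      rw [← map_mul, ← map_mul, h5]
    obtain ⟨g₁, d₁, hd₁⟩ := h2 Y hY
    refine hinj ?_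
    rw [hgτ]
    exact transpose_eq_of_commute h6
      (by rw [Polynomial.aeval_algHom_apply, aeval_rootPoly_of_eq_conj_diagonal hd₁, map_zero])
  · have hS : (conjAlgHom g X).IsHermitian := by
      rw [Matrix.IsHermitian, Matrix.conjTranspose_eq_transpose_of_trivial, ← hgτ, hX]
    refine ⟨g⁻¹ * Unitary.toUnits hS.eigenvectorUnitary, hS.eigenvalues, ?_⟩
    have h7 := hS.spectral_theorem
    rw [Unitary.conjStarAlgAut_apply] at h7
    refine hinj (h7.trans ?_)
    rw [← conjAlgHom_apply, ← conjAlgHom_mul, mul_inv_cancel_left]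
    exact (conjAlgHom_apply (Unitary.toUnits hS.eigenvectorUnitary) _).symm

section CartanAnti

variable {n : ℕ} {𝔤 : LieSubalgebra ℝ (Mat n)} {𝔞 : Submodule ℝ (Mat n)} {τ : Mat n →ₗ[ℝ] Mat n}

theorem IsCartanAnti.map_lie (h : IsCartanAnti 𝔤 𝔞 τ) (X Y : Mat n) : τ ⁅X, Y⁆ = ⁅τ Y, τ X⁆ := by
  rw [Ring.lie_def, Ring.lie_def, map_sub, h.map_mul, h.map_mul]

/-- Elements fixed by `τ` are diagonalizable over `ℝ`, so adjoining `X` to `𝔞` would again give a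
split abelian subspace. -/
theorem IsCartanAnti.mem_of_fix (h : IsCartanAnti 𝔤 𝔞 τ) (hmax : Maximal (IsSplitAbelian 𝔤) 𝔞)
    {X : Mat n} (hX : X ∈ 𝔤) (hτ : τ X = X) (hcomm : ∀ Y ∈ 𝔞, ⁅Y, X⁆ = 0) : X ∈ 𝔞 := by
  have h1 : IsSplitAbelian 𝔤 (𝔞 ⊔ Submodule.span ℝ {X}) := by
    obtain ⟨h1, h2, h3⟩ := hmax.prop
    refine ⟨sup_le h1 ((Submodule.span_singleton_le_iff_mem X 𝔤.toSubmodule).2 hX),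
      fun Z hZ => h.diag Z ?_, fun Z hZ Z' hZ' => ?_⟩
    · obtain ⟨Y, hY, W, hW, rfl⟩ := Submodule.mem_sup.1 hZ
      obtain ⟨c, rfl⟩ := Submodule.mem_span_singleton.1 hW
      rw [map_add, h.fix Y hY, map_smul, hτ]
    · obtain ⟨Y, hY, W, hW, rfl⟩ := Submodule.mem_sup.1 hZ
      obtain ⟨c, rfl⟩ := Submodule.mem_span_singleton.1 hW
      obtain ⟨Y', hY', W', hW', rfl⟩ := Submodule.mem_sup.1 hZ'
      obtain ⟨c', rfl⟩ := Submodule.mem_span_singleton.1 hW'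
      have h4 : ⁅X, Y'⁆ = 0 := by rw [← lie_skew, hcomm Y' hY', neg_zero]
      simp [h3 Y hY Y' hY', hcomm Y hY, h4]
  exact hmax.le_of_ge h1 le_sup_left (Submodule.mem_sup_right (Submodule.mem_span_singleton_self X))

end CartanAnti

end RealSpherical
end

noncomputable section

open MeasureTheory NormedSpace Filter
open scoped Pointwise Topology Matrix.Norms.Operator

set_option linter.unusedSectionVars false

namespace RealSpherical

/-! ### Non-compact simple ideals -/

section Orthogonal

theorem exists_orthogonal_decomposition {V : Type*} [AddCommGroup V] [Module ℝ V]
    [FiniteDimensional ℝ V] {B : V →ₗ[ℝ] V →ₗ[ℝ] ℝ} (hpos : ∀ x, x ≠ 0 → 0 < B x x)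
    (W : Submodule ℝ V) (x : V) : ∃ y ∈ W, ∀ w ∈ W, B (x - y) w = 0 := by
  let φ : W →ₗ[ℝ] Module.Dual ℝ W := B.domRestrict₁₂ W W
  have hinj : Function.Injective φ := by
    rw [injective_iff_map_eq_zero]
    intro w hw
    by_contra h
    have h1 := hpos w (fun h' => h (Subtype.ext h'))
    have h2 : B w w = 0 := congrArg (fun f : Module.Dual ℝ W => f w) hw
    exact h1.ne' h2
  have hsurj : Function.Surjective φ :=
    (LinearMap.injective_iff_surjective_of_finrank_eq_finrank
      (Subspace.dual_finrank_eq (K := ℝ) (V := W)).symm).1 hinj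
  obtain ⟨y, hy⟩ := hsurj ((B x).domRestrict W)
  refine ⟨y, y.2, fun w hw => ?_⟩
  have h1 : B y w = B x w := congrArg (fun f : Module.Dual ℝ W => f ⟨w, hw⟩) hy
  rw [map_sub, LinearMap.sub_apply, h1, sub_self]

variable {L : Type*} [LieRing L] [LieAlgebra ℝ L] [FiniteDimensional ℝ L]
  {B : L →ₗ[ℝ] L →ₗ[ℝ] ℝ} {θ : L → L}

/-- The orthogonal complement of an ideal with respect to a form for which the adjoint of
`ad z` is `ad (θ z)`. -/
def orthIdeal (hθ : ∀ z x y, B ⁅z, x⁆ y = B x ⁅θ z, y⁆) (I : LieIdeal ℝ L) : LieIdeal ℝ L where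
  carrier := {x | ∀ y ∈ I, B x y = 0}
  zero_mem' := fun y _ => by simp
  add_mem' := fun h h' y hy => by rw [map_add, LinearMap.add_apply, h y hy, h' y hy, add_zero]
  smul_mem' := fun c x h y hy => by rw [map_smul, LinearMap.smul_apply, h y hy, smul_zero]
  lie_mem := fun {z x} h y hy => by rw [hθ]; exact h _ (lie_mem_right ℝ L I _ _ hy)

theorem eq_zero_of_mem_orthIdeal (hpos : ∀ x, x ≠ 0 → 0 < B x x)
    {hθ : ∀ z x y, B ⁅z, x⁆ y = B x ⁅θ z, y⁆} {I : LieIdeal ℝ L} {x : L} (hx : x ∈ I)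
    (hx' : x ∈ orthIdeal hθ I) : x = 0 := by
  by_contra h
  exact (hpos x h).ne' (hx' x hx)

theorem exists_mem_orthIdeal (hpos : ∀ x, x ≠ 0 → 0 < B x x)
    (hθ : ∀ z x y, B ⁅z, x⁆ y = B x ⁅θ z, y⁆) (I : LieIdeal ℝ L) (x : L) :
    ∃ y ∈ I, x - y ∈ orthIdeal hθ I :=
  exists_orthogonal_decomposition hpos I.toSubmodule x

/-- The bracket lies in both ideals, and these meet only in zero by positivity. -/
theorem lie_eq_zero_of_mem_orthIdeal (hpos : ∀ x, x ≠ 0 → 0 < B x x)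
    {hθ : ∀ z x y, B ⁅z, x⁆ y = B x ⁅θ z, y⁆} {I : LieIdeal ℝ L} {x z : L} (hx : x ∈ I)
    (hz : z ∈ orthIdeal hθ I) : ⁅z, x⁆ = 0 :=
  eq_zero_of_mem_orthIdeal hpos (lie_mem_right ℝ L I _ _ hx) (lie_mem_left ℝ L _ _ _ hz)

/-- `ad Y` preserves both ideals of the orthogonal decomposition, so each component of an
eigenvector satisfies the eigenvalue equation separately. -/
theorem exists_eigen_mem_orthIdeal (hpos : ∀ x, x ≠ 0 → 0 < B x x)
    (hθ : ∀ z x y, B ⁅z, x⁆ y = B x ⁅θ z, y⁆) (I : LieIdeal ℝ L) {x Y : L} {c : ℝ}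
    (hx : ⁅Y, x⁆ = c • x) :
    ∃ y ∈ I, ⁅Y, y⁆ = c • y ∧ x - y ∈ orthIdeal hθ I ∧ ⁅Y, x - y⁆ = c • (x - y) := by
  obtain ⟨y, hy, hxy⟩ := exists_mem_orthIdeal hpos hθ I x
  have h1 : ⁅Y, y⁆ - c • y ∈ I := sub_mem (lie_mem_right ℝ L I _ _ hy) (I.smul_mem c hy)
  have h2 : ⁅Y, x - y⁆ - c • (x - y) ∈ orthIdeal hθ I :=
    sub_mem (lie_mem_right ℝ L _ _ _ hxy) ((orthIdeal hθ I).smul_mem c hxy)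
  have h3 : ⁅Y, x - y⁆ - c • (x - y) = -(⁅Y, y⁆ - c • y) := by
    rw [lie_sub, hx, smul_sub]; abel
  have h4 : ⁅Y, y⁆ - c • y = 0 := by
    refine eq_zero_of_mem_orthIdeal hpos h1 (hθ := hθ) ?_
    rw [h3] at h2
    simpa using neg_mem h2
  refine ⟨y, hy, sub_eq_zero.1 h4, hxy, ?_⟩
  rw [h4, neg_zero] at h3
  exact sub_eq_zero.1 h3

/-- In a Lie algebra with a positive definite form for which the adjoint of every `ad z` is an inner
derivation, an eigenvector of some `ad Y` with a nonzero real eigenvalue lies in the sum of the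
non-compact simple ideals. -/
theorem mem_iSup_noncompact_simple (hpos : ∀ x, x ≠ 0 → 0 < B x x)
    (hθ : ∀ z x y, B ⁅z, x⁆ y = B x ⁅θ z, y⁆) {x Y : L} {c : ℝ} (hc : c ≠ 0)
    (hx : ⁅Y, x⁆ = c • x) :
    x ∈ ⨆ (I : LieIdeal ℝ L) (_ : LieAlgebra.IsSimple ℝ I)
      (_ : ¬ ∀ x : I, x ≠ 0 → killingForm ℝ I x x < 0), I := by
  set J := ⨆ (I : LieIdeal ℝ L) (_ : LieAlgebra.IsSimple ℝ I)
      (_ : ¬ ∀ x : I, x ≠ 0 → killingForm ℝ I x x < 0), I with hJ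
  obtain ⟨x₁, hx₁, -, hx₂, hYx₂⟩ := exists_eigen_mem_orthIdeal hpos hθ J hx
  rcases eq_or_ne (x - x₁) 0 with h0 | h0
  · rwa [sub_eq_zero.1 h0]
  exfalso
  have : WellFoundedLT (LieIdeal ℝ L) := LieSubmodule.wellFoundedLT_of_isArtinian ℝ L L
  -- If the component orthogonal to `J` were nonzero, take a minimal ideal orthogonal to `J`
  -- containing an eigenvector. It turns out to be simple and non-compact, hence contained in `J`: a
  -- contradiction.
  obtain ⟨I, ⟨hIJ, v, hvI, hv0, hYv⟩, hImin⟩ := exists_minimal_of_wellFoundedLT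
    (fun I : LieIdeal ℝ L => I ≤ orthIdeal hθ J ∧ ∃ v ∈ I, v ≠ 0 ∧ ⁅Y, v⁆ = c • v)
    ⟨_, le_rfl, _, hx₂, h0, hYx₂⟩
  have hK : ∀ K : LieIdeal ℝ L, K ≤ I → K = ⊥ ∨ I ≤ K := by
    intro K hKI
    obtain ⟨k, hk, hYk, hk', hYk'⟩ := exists_eigen_mem_orthIdeal hpos hθ K hYv
    rcases eq_or_ne k 0 with h | h
    · left
      rw [h, sub_zero] at hk'
      have h1 := hImin (y := I ⊓ orthIdeal hθ K)
        ⟨inf_le_left.trans hIJ, v, ⟨hvI, hk'⟩, hv0, hYv⟩ inf_le_left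
      rw [LieSubmodule.eq_bot_iff]
      exact fun w hw => eq_zero_of_mem_orthIdeal hpos hw (h1 (hKI hw)).2
    · right
      exact hImin ⟨hKI.trans hIJ, k, hk, h, hYk⟩ hKI
  obtain ⟨y, hy, hyY⟩ := exists_mem_orthIdeal hpos hθ I Y
  have hyv : ⁅y, v⁆ = c • v := by
    have := lie_eq_zero_of_mem_orthIdeal hpos hvI hyY
    rw [sub_lie, sub_eq_zero] at this
    rw [← this, hYv]
  have hcv : c • v ≠ 0 := smul_ne_zero hc hv0
  have hsimple : LieAlgebra.IsSimple ℝ I := by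
    refine ⟨fun K' => ?_, fun hab => ?_⟩
    -- An ideal of `I` is an ideal of `L`, because the orthogonal component of an element of `L`
    -- acts trivially on `I`.
    · let K : LieIdeal ℝ L :=
        { K'.toSubmodule.map I.toSubmodule.subtype with
          lie_mem := by
            rintro z _ ⟨k, hk, rfl⟩
            obtain ⟨w, hw, hzw⟩ := exists_mem_orthIdeal hpos hθ I z
            have h1 := lie_eq_zero_of_mem_orthIdeal hpos k.2 hzw
            rw [sub_lie, sub_eq_zero] at h1
            exact ⟨⁅(⟨w, hw⟩ : I), k⁆, lie_mem_right ℝ I K' _ _ hk, h1.symm⟩ }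
      have hKmem : ∀ k : I, (k : L) ∈ K ↔ k ∈ K' := by
        intro k
        refine ⟨?_, fun hk => ⟨k, hk, rfl⟩⟩
        rintro ⟨k', hk', h⟩
        rwa [← Subtype.ext h]
      rcases hK K (by rintro _ ⟨k, -, rfl⟩; exact k.2) with h | h
      · left
        rw [LieSubmodule.eq_bot_iff]
        intro k hk
        have := (hKmem k).2 hk
        rw [h, LieSubmodule.mem_bot] at this
        exact Subtype.ext this
      · right
        rw [eq_top_iff]
        intro k _
        exact (hKmem k).1 (h k.2)
    · have h1 : ⁅(⟨y, hy⟩ : I), (⟨v, hvI⟩ : I)⁆ = 0 := hab.trivial _ _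
      exact hcv (hyv.symm.trans (congrArg (Subtype.val : I → L) h1))
  have hnc : ¬ ∀ x : I, x ≠ 0 → killingForm ℝ I x x < 0 := by
    intro h
    have h1 := h ⟨v, hvI⟩ fun h' => hv0 (congrArg (Subtype.val : I → L) h')
    have h2 : ⁅(⟨y, hy⟩ : I), (⟨v, hvI⟩ : I)⁆ = c • (⟨v, hvI⟩ : I) := Subtype.ext hyv
    -- By invariance, `c κ(v, v) = κ([y, v], v) = κ(y, [v, v]) = 0`, so the Killing form is not
    -- negative definite.
    have h3 := LieModule.traceForm_apply_lie_apply ℝ I I (⟨y, hy⟩ : I) ⟨v, hvI⟩ ⟨v, hvI⟩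
    rw [h2, lie_self, map_zero, map_smul, LinearMap.smul_apply, smul_eq_mul, mul_eq_zero] at h3
    exact h1.ne (h3.resolve_left hc)
  have hIJ' : I ≤ J := le_iSup₂_of_le I hsimple (le_iSup_of_le hnc le_rfl)
  exact hv0 (eq_zero_of_mem_orthIdeal hpos (hIJ' hvI) (hIJ hvI))

end Orthogonal

end RealSpherical
end

noncomputable section

open MeasureTheory NormedSpace Filter
open scoped Pointwise Topology Matrix.Norms.Operator

set_option linter.unusedSectionVars false

namespace RealSpherical

attribute [local instance 100] LieRing.ofAssociativeRing

/-! ### Traces and determinants -/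

section Trace

variable {M N ι : Type*} [AddCommGroup M] [Module ℝ M] [AddCommGroup N] [Module ℝ N]
  [FiniteDimensional ℝ M] [FiniteDimensional ℝ N] [Fintype ι] [DecidableEq ι]

theorem toMatrix_eq_diagonal (b : Module.Basis ι ℝ M) {f : Module.End ℝ M} {μ : ι → ℝ}
    (h : ∀ i, f (b i) = μ i • b i) : LinearMap.toMatrix b b f = Matrix.diagonal μ := by
  ext i j
  rw [LinearMap.toMatrix_apply, h, map_smul, Module.Basis.repr_self, Matrix.diagonal_apply]
  rcases eq_or_ne i j with rfl | hij
  · simp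
  · simp [hij, Finsupp.single_eq_of_ne hij]

theorem trace_eq_sum_of_eigenbasis (b : Module.Basis ι ℝ M) {f : Module.End ℝ M} {μ : ι → ℝ}
    (h : ∀ i, f (b i) = μ i • b i) : LinearMap.trace ℝ M f = ∑ i, μ i := by
  rw [LinearMap.trace_eq_matrix_trace ℝ b, toMatrix_eq_diagonal b h, Matrix.trace_diagonal]

theorem det_eq_prod_of_eigenbasis (b : Module.Basis ι ℝ M) {f : Module.End ℝ M} {μ : ι → ℝ}
    (h : ∀ i, f (b i) = μ i • b i) : LinearMap.det f = ∏ i, μ i := by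
  rw [← LinearMap.det_toMatrix b, toMatrix_eq_diagonal b h, Matrix.det_diagonal]

theorem exists_end_of_mapsTo {j : M →ₗ[ℝ] N} (hj : Function.Injective j) {F : Module.End ℝ N}
    (hF : ∀ x, F (j x) ∈ LinearMap.range j) : ∃ f : Module.End ℝ M, ∀ x, j (f x) = F (j x) := by
  refine ⟨(LinearEquiv.ofInjective j hj).symm.toLinearMap ∘ₗ (F ∘ₗ j).codRestrict _ hF,
    fun x => ?_⟩
  exact congrArg (Subtype.val : LinearMap.range j → N)
    ((LinearEquiv.ofInjective j hj).apply_symm_apply ((F ∘ₗ j).codRestrict _ hF x))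

/-- Commutators act with trace zero. -/
theorem trace_eq_zero_of_lie {n : ℕ} {j : M →ₗ[ℝ] Mat n} (hj : Function.Injective j) {A B : Mat n}
    (hA : ∀ x, ⁅A, j x⁆ ∈ LinearMap.range j) (hB : ∀ x, ⁅B, j x⁆ ∈ LinearMap.range j)
    {f : Module.End ℝ M} (hf : ∀ x, j (f x) = ⁅⁅A, B⁆, j x⁆) : LinearMap.trace ℝ M f = 0 := by
  obtain ⟨fA, hfA⟩ := exists_end_of_mapsTo hj (F := LieModule.toEnd ℝ (Mat n) (Mat n) A) hA
  obtain ⟨fB, hfB⟩ := exists_end_of_mapsTo hj (F := LieModule.toEnd ℝ (Mat n) (Mat n) B) hB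
  have : f = fA * fB - fB * fA := by
    refine LinearMap.ext fun x => hj ?_
    rw [hf, lie_lie, LinearMap.sub_apply, map_sub, Module.End.mul_apply, Module.End.mul_apply, hfA,
      hfB, hfB, hfA]
    rfl
  rw [this, map_sub, LinearMap.trace_mul_comm, sub_self]

/-- The trace of an endomorphism is the sum of its traces on a subspace and on the quotient. -/
theorem trace_eq_trace_ker_add {π : M →ₗ[ℝ] N} {σ : N →ₗ[ℝ] M} (hσ : ∀ y, π (σ y) = y)
    {D : Module.End ℝ M} {D₁ : Module.End ℝ (LinearMap.ker π)} {D₂ : Module.End ℝ N}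
    (h₁ : ∀ x, (D₁ x : M) = D x) (h₂ : ∀ x, π (D x) = D₂ (π x)) :
    LinearMap.trace ℝ M D =
      LinearMap.trace ℝ (LinearMap.ker π) D₁ + LinearMap.trace ℝ N D₂ := by
  let r : M →ₗ[ℝ] LinearMap.ker π := (LinearMap.id - σ ∘ₗ π).codRestrict _ fun x => by
    rw [LinearMap.mem_ker]; simp [hσ]
  have hr : ∀ x, (r x : M) = x - σ (π x) := fun _ => rfl
  have h3 : D = (LinearMap.ker π).subtype ∘ₗ (D₁ ∘ₗ r) + (D ∘ₗ σ) ∘ₗ π := by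
    ext x
    simp [h₁, hr]
  have h4 : (D₁ ∘ₗ r) ∘ₗ (LinearMap.ker π).subtype = D₁ := by
    refine LinearMap.ext fun x => ?_
    have : r x = x := Subtype.ext (by rw [hr, LinearMap.mem_ker.1 x.2, map_zero, sub_zero])
    simp [this]
  have h5 : π ∘ₗ (D ∘ₗ σ) = D₂ := by
    refine LinearMap.ext fun x => ?_
    simp [h₂, hσ]
  rw [h3, map_add, LinearMap.trace_comp_comm', h4, LinearMap.trace_comp_comm', h5]

/-- Sylvester's determinant identity, used to reduce a determinant on `𝔥` to a diagonal one on the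
coordinates of `𝔲̄`. -/
theorem det_id_add_comp_comm (f : M →ₗ[ℝ] N) (g : N →ₗ[ℝ] M) :
    LinearMap.det (LinearMap.id + g ∘ₗ f) = LinearMap.det (LinearMap.id + f ∘ₗ g) := by
  classical
  let b := Module.finBasis ℝ M
  let c := Module.finBasis ℝ N
  rw [← LinearMap.det_toMatrix b, ← LinearMap.det_toMatrix c, map_add, map_add,
    LinearMap.toMatrix_id, LinearMap.toMatrix_id, LinearMap.toMatrix_comp b c b,
    LinearMap.toMatrix_comp c b c, Matrix.det_one_add_mul_comm]

end Trace

/-! ### Weight spaces -/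

section WeightSpaces

variable {n : ℕ} {𝔤 : LieSubalgebra ℝ (Mat n)} {𝔞 : Submodule ℝ (Mat n)} {ι : Type} [Fintype ι]
  [DecidableEq ι] (b : Module.Basis ι ℝ 𝔤.toSubmodule) {w : ι → Module.Dual ℝ 𝔞}

/-- `b` is a basis of `𝔤` that consists of weight vectors with the weights `w`. -/
def IsWeightBasis (w : ι → Module.Dual ℝ 𝔞) : Prop :=
  ∀ i (Y : 𝔞), ⁅(Y : Mat n), (b i : Mat n)⁆ = w i Y • (b i : Mat n)

/-- The span of the basis vectors with index in `S`. -/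
def wspan (S : Set ι) : Submodule ℝ (Mat n) :=
  Submodule.span ℝ (Set.range fun i : S => (b i : Mat n))

theorem basis_mem_wspan {S : Set ι} {i : ι} (hi : i ∈ S) : (b i : Mat n) ∈ wspan b S :=
  Submodule.subset_span ⟨⟨i, hi⟩, rfl⟩

theorem wspan_le_iff {S : Set ι} {W : Submodule ℝ (Mat n)} :
    wspan b S ≤ W ↔ ∀ i ∈ S, (b i : Mat n) ∈ W := by
  rw [wspan, Submodule.span_le]
  exact ⟨fun h i hi => h ⟨⟨i, hi⟩, rfl⟩, by rintro h _ ⟨i, rfl⟩; exact h i i.2⟩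

theorem wspan_le (S : Set ι) : wspan b S ≤ 𝔤.toSubmodule :=
  (wspan_le_iff b).2 fun i _ => (b i).2

theorem sum_repr_coe (X : 𝔤.toSubmodule) : ∑ i, b.repr X i • (b i : Mat n) = X := by
  have h := congrArg 𝔤.toSubmodule.subtype (b.sum_repr X)
  rw [map_sum] at h
  exact h

theorem mem_wspan {S : Set ι} (X : 𝔤.toSubmodule) :
    (X : Mat n) ∈ wspan b S ↔ ∀ i, i ∉ S → b.repr X i = 0 := by
  constructor
  · intro h i hi
    have h1 : wspan b S ≤ (LinearMap.ker (b.coord i)).map 𝔤.toSubmodule.subtype := by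
      refine (wspan_le_iff b).2 fun j hj => ⟨b j, ?_, rfl⟩
      change b.coord i (b j) = 0
      rw [Module.Basis.coord_apply, Module.Basis.repr_self]
      exact Finsupp.single_eq_of_ne fun h => hi (h ▸ hj)
    obtain ⟨X', hX', h2⟩ := h1 h
    rw [← Subtype.ext h2]
    exact hX'
  · intro h
    rw [← sum_repr_coe b X]
    refine Submodule.sum_mem _ fun i _ => ?_
    by_cases hi : i ∈ S
    · exact Submodule.smul_mem _ _ (basis_mem_wspan b hi)
    · rw [h i hi, zero_smul]; exact zero_mem _

theorem wspan_mono {S T : Set ι} (h : S ⊆ T) : wspan b S ≤ wspan b T :=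
  (wspan_le_iff b).2 fun _ hi => basis_mem_wspan b (h hi)

theorem exists_add_mem_wspan {X : Mat n} {S T : Set ι} (hX : X ∈ wspan b (S ∪ T)) :
    ∃ A ∈ wspan b S, ∃ B ∈ wspan b T, X = A + B := by
  have h : wspan b (S ∪ T) ≤ wspan b S ⊔ wspan b T := (wspan_le_iff b).2 fun i hi =>
    hi.elim (fun h => Submodule.mem_sup_left (basis_mem_wspan b h))
      fun h => Submodule.mem_sup_right (basis_mem_wspan b h)
  obtain ⟨A, hA, B, hB, h⟩ := Submodule.mem_sup.1 (h hX)
  exact ⟨A, hA, B, hB, h.symm⟩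

/-- The basis of `wspan b S` given by the basis vectors with index in `S`. -/
def wspanBasis (S : Set ι) : Module.Basis S ℝ (wspan b S) :=
  Module.Basis.span ((b.linearIndependent.comp _ Subtype.val_injective).map'
    𝔤.toSubmodule.subtype 𝔤.toSubmodule.ker_subtype)

theorem wspanBasis_apply (S : Set ι) (i : S) : (wspanBasis b S i : Mat n) = b i :=
  congrArg (Subtype.val : wspan b S → Mat n) (Module.Basis.span_apply _ i)

theorem repr_eq_of_apply_eq {F : Mat n →ₗ[ℝ] Mat n} {μ : ι → ℝ}
    (hF : ∀ i, F (b i) = μ i • (b i : Mat n)) {X Z : 𝔤.toSubmodule} (h : F X = Z) (i : ι) :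
    b.repr Z i = μ i * b.repr X i := by
  have h1 : Z = ∑ j, (μ j * b.repr X j) • b j := by
    refine Subtype.ext ?_
    rw [← h]
    conv_lhs => rw [← sum_repr_coe b X]
    rw [map_sum]
    simp [hF, smul_smul, mul_comm]
  rw [h1]
  simp [Finsupp.single_apply]

variable {b}

theorem IsWeightBasis.lie_apply (hb : IsWeightBasis b w) (Y : 𝔞) (i : ι) :
    LieModule.toEnd ℝ (Mat n) (Mat n) (Y : Mat n) (b i) = w i Y • (b i : Mat n) := hb i Y

theorem IsWeightBasis.repr_eq_zero (hb : IsWeightBasis b w) {Y : 𝔞} {X : 𝔤.toSubmodule} {c : ℝ}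
    (h : ⁅(Y : Mat n), (X : Mat n)⁆ = c • (X : Mat n)) {i : ι} (hi : w i Y ≠ c) :
    b.repr X i = 0 := by
  have h1 := repr_eq_of_apply_eq b (fun i => hb.lie_apply Y i) (X := X) (Z := c • X) h i
  rw [map_smul, Finsupp.smul_apply, smul_eq_mul] at h1
  have : (w i Y - c) * b.repr X i = 0 := by rw [sub_mul, ← h1, sub_self]
  exact (mul_eq_zero.1 this).resolve_left (sub_ne_zero.2 hi)

theorem IsWeightBasis.lie_eq_smul (hb : IsWeightBasis b w) {Y : 𝔞} {S : Set ι} {c : ℝ}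
    (h : ∀ i ∈ S, w i Y = c) {X : Mat n} (hX : X ∈ wspan b S) : ⁅(Y : Mat n), X⁆ = c • X := by
  have h1 : wspan b S ≤ LinearMap.ker
      (LieModule.toEnd ℝ (Mat n) (Mat n) (Y : Mat n) - c • LinearMap.id) :=
    (wspan_le_iff b).2 fun i hi => by
      rw [LinearMap.mem_ker, LinearMap.sub_apply, hb.lie_apply, h i hi]
      simp
  have h2 := LinearMap.mem_ker.1 (h1 hX)
  rw [LinearMap.sub_apply, sub_eq_zero] at h2
  exact h2

theorem IsWeightBasis.mem_wspan_of_lie_eq (hb : IsWeightBasis b w) {Y : 𝔞} {X : Mat n} {c : ℝ}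
    (hX : X ∈ 𝔤) (h : ⁅(Y : Mat n), X⁆ = c • X) : X ∈ wspan b {i | w i Y = c} :=
  (mem_wspan b ⟨X, hX⟩).2 fun _ hi => hb.repr_eq_zero (X := ⟨X, hX⟩) h hi

theorem IsWeightBasis.lie_basis_mem (hb : IsWeightBasis b w) (i j : ι) :
    ⁅(b i : Mat n), (b j : Mat n)⁆ ∈ wspan b {k | w k = w i + w j} := by
  refine (mem_wspan b ⟨_, 𝔤.lie_mem (b i).2 (b j).2⟩).2 fun k hk => ?_
  obtain ⟨Y, hY⟩ : ∃ Y, w k Y ≠ (w i + w j) Y := by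
    by_contra! h
    exact hk (LinearMap.ext h)
  refine hb.repr_eq_zero (Y := Y) (c := (w i + w j) Y) ?_ hY
  rw [leibniz_lie, hb i Y, hb j Y, smul_lie, lie_smul, LinearMap.add_apply, add_smul]

theorem IsWeightBasis.lie_mem_wspan (hb : IsWeightBasis b w) {S T R : Set ι}
    (h : ∀ i ∈ S, ∀ j ∈ T, ∀ k, w k = w i + w j → k ∈ R) {X Z : Mat n}
    (hX : X ∈ wspan b S) (hZ : Z ∈ wspan b T) : ⁅X, Z⁆ ∈ wspan b R := by
  have h1 : ∀ i ∈ S, wspan b T ≤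
      (wspan b R).comap (LieModule.toEnd ℝ (Mat n) (Mat n) (b i : Mat n)) := fun i hi =>
    (wspan_le_iff b).2 fun j hj =>
      wspan_mono b (fun k hk => h i hi j hj k hk) (hb.lie_basis_mem i j)
  have h2 : wspan b S ≤ (wspan b R).comap
      (-(LieModule.toEnd ℝ (Mat n) (Mat n) Z)) := (wspan_le_iff b).2 fun i hi => by
    have := h1 i hi hZ
    rw [Submodule.mem_comap, LieModule.toEnd_apply_apply] at this
    rw [Submodule.mem_comap, LinearMap.neg_apply, LieModule.toEnd_apply_apply, lie_skew]
    exact this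
  have h3 := h2 hX
  rw [Submodule.mem_comap, LinearMap.neg_apply, LieModule.toEnd_apply_apply, lie_skew] at h3
  exact h3

open Classical in
theorem IsWeightBasis.trace_eq (hb : IsWeightBasis b w) {S : Set ι} {W : Submodule ℝ (Mat n)}
    (hW : W = wspan b S) (Y : 𝔞) {f : Module.End ℝ W} (hf : ∀ X, (f X : Mat n) = ⁅(Y : Mat n), (X : Mat n)⁆) :
    LinearMap.trace ℝ W f = ∑ i : S, w i Y := by
  subst hW
  refine trace_eq_sum_of_eigenbasis (wspanBasis b S) fun i => Subtype.ext ?_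
  rw [hf, Submodule.coe_smul, wspanBasis_apply]
  exact hb i Y

end WeightSpaces

end RealSpherical
end

noncomputable section

open MeasureTheory NormedSpace Filter
open scoped Pointwise Topology Matrix.Norms.Operator

set_option linter.unusedSectionVars false

namespace RealSpherical

/-! ### Products of exponentials of complementary subspaces. -/

section Generic

variable {𝔸 E : Type*} [NormedRing 𝔸] [NormedAlgebra ℝ 𝔸] [CompleteSpace 𝔸]
  [NormedAddCommGroup E] [NormedSpace ℝ E]

theorem hasStrictFDerivAt_exp_mul_exp_clm' (A B : E →L[ℝ] 𝔸) :
    HasStrictFDerivAt (fun x => exp (A x) * exp (B x)) (A + B) 0 := by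
  have h : ∀ A : E →L[ℝ] 𝔸, HasStrictFDerivAt (fun x => exp (A x)) A 0 := fun A => by
    have h : HasStrictFDerivAt (exp : 𝔸 → 𝔸) (1 : 𝔸 →L[ℝ] 𝔸) (A 0) := by
      rw [map_zero]; exact hasStrictFDerivAt_exp_zero
    exact h.comp 0 A.hasStrictFDerivAt
  refine ((h A).fun_mul' (h B)).congr_fderiv ?_
  ext x
  simp [add_comm]

/-- The map `(X, Z) ↦ P(log(exp X exp Z))`, with `P` a projection onto `q`, is a submersion at `0`,
so it attains every small `X ∈ q`. The projection can be dropped once the product is known to be the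
exponential of some `C ∈ q`; supplying `C` is left to the application. -/
theorem eventually_exists_exp_mul_exp' [FiniteDimensional ℝ 𝔸] {q l u : Submodule ℝ 𝔸}
    (hq : ∀ v ∈ q, ∃ X ∈ l, ∃ Z ∈ u, v = X + Z) {L : 𝔸 → 𝔸} (hL1 : L 1 = 0)
    (hLd : HasStrictFDerivAt L (1 : 𝔸 →L[ℝ] 𝔸) 1) {s : Set (l × u)} (hs : s ∈ 𝓝 0) :
    ∀ᶠ X in 𝓝 (0 : 𝔸), X ∈ q → ∃ x ∈ s, ∀ C ∈ q, L (exp C) = C →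
      exp (x.1 : 𝔸) * exp (x.2 : 𝔸) = exp C → X = C := by
  obtain ⟨q', hq'⟩ := Submodule.exists_isCompl q
  let P : 𝔸 →L[ℝ] q := LinearMap.toContinuousLinearMap (q.projectionOnto q' hq')
  have hP : ∀ x : q, P x = x := fun x => Submodule.projectionOnto_apply_left hq' x
  let A : l × u →L[ℝ] 𝔸 := l.subtypeL ∘L ContinuousLinearMap.fst ℝ l u
  let B : l × u →L[ℝ] 𝔸 := u.subtypeL ∘L ContinuousLinearMap.snd ℝ l u
  have h1 : HasStrictFDerivAt (fun x : l × u => exp (A x) * exp (B x)) (A + B) 0 :=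
    hasStrictFDerivAt_exp_mul_exp_clm' A B
  have h2 : HasStrictFDerivAt (fun x : l × u => P (L (exp (A x) * exp (B x))))
      (P ∘L ((1 : 𝔸 →L[ℝ] 𝔸) ∘L (A + B))) 0 := by
    refine P.hasStrictFDerivAt.comp (0 : l × u) (HasStrictFDerivAt.comp (0 : l × u) ?_ h1)
    simpa using hLd
  have hmap := h2.map_nhds_eq_of_surj (by
    rw [eq_top_iff]
    rintro v -
    obtain ⟨X, hX, Z, hZ, hXZ⟩ := hq v v.2
    refine ⟨(⟨X, hX⟩, ⟨Z, hZ⟩), ?_⟩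
    rw [← hP v, hXZ]
    rfl)
  have himg := image_mem_map (m := fun x : l × u => P (L (exp (A x) * exp (B x)))) hs
  rw [hmap] at himg
  have h00 : P (L (exp (A 0) * exp (B 0))) = 0 := by simp [hL1]
  rw [h00] at himg
  have hP0 : Tendsto P (𝓝 0) (𝓝 0) := by simpa using P.continuous.tendsto 0
  filter_upwards [hP0 himg] with X hX hXq
  obtain ⟨x, hx, hxX⟩ := hX
  refine ⟨x, hx, fun C hC hLC hxC => ?_⟩
  have h4 : P X = P C := by
    rw [← hxX]
    change P (L (exp (x.1 : 𝔸) * exp (x.2 : 𝔸))) = _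
    rw [hxC, hLC]
  have h6 := hP ⟨X, hXq⟩
  have h7 := hP ⟨C, hC⟩
  simp only at h6 h7
  rw [h6, h7] at h4
  exact congrArg (Subtype.val : q → 𝔸) h4

end Generic

attribute [local instance 100] LieRing.ofAssociativeRing

/-! ### The Levi decomposition of a parabolic subalgebra -/

section Parabolic

variable {n : ℕ} {G : Type*} [Group G] [TopologicalSpace G] [IsTopologicalGroup G] [T2Space G]
  {p : G →* GL (Fin n) ℝ} {𝔞 : Submodule ℝ (Mat n)} {ι : Type} [Fintype ι] [DecidableEq ι]
  {b : Module.Basis ι ℝ (lieOf p ⊤).toSubmodule} {w : ι → Module.Dual ℝ 𝔞}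

theorem conjAlgHom_lie (g : GL (Fin n) ℝ) (X Y : Mat n) :
    conjAlgHom g ⁅X, Y⁆ = ⁅conjAlgHom g X, conjAlgHom g Y⁆ := by
  simp only [Ring.lie_def, map_sub, map_mul]

theorem conjAlgHom_eq_self_iff {g : GL (Fin n) ℝ} {X : Mat n} :
    conjAlgHom g X = X ↔ (g : Mat n) * X = X * (g : Mat n) := by
  rw [conjAlgHom_apply, Units.mul_inv_eq_iff_eq_mul]

theorem continuous_conjAlgHom (X : Mat n) : Continuous fun g : GL (Fin n) ℝ => conjAlgHom g X := by
  simp only [conjAlgHom_apply]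
  exact (Units.continuous_val.mul continuous_const).mul
    (Units.continuous_val.comp continuous_inv)

theorem IsFiniteClosedHom.conjAlgHom_mem (hq : IsFiniteClosedHom p) (x : G) {X : Mat n}
    (hX : X ∈ lieOf p ⊤) : conjAlgHom (p x) X ∈ lieOf p ⊤ := by
  rw [lieOf_top_eq] at hX ⊢
  rw [conjAlgHom_apply]
  exact conj_mem_lieAlg hq.isClosed_range ⟨x, rfl⟩ hX

theorem IsWeightBasis.basis_mem_rootSpace (hb : IsWeightBasis b w) (i : ι) :
    (b i : Mat n) ∈ rootSpace p 𝔞 (w i) := ⟨(b i).2, hb i⟩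

theorem basis_coe_ne_zero (i : ι) : (b i : Mat n) ≠ 0 := fun h => b.ne_zero i (Subtype.ext h)

theorem IsWeightBasis.mem_roots (hb : IsWeightBasis b w) {i : ι} (hi : w i ≠ 0) :
    w i ∈ roots p 𝔞 :=
  ⟨hi, fun h => basis_coe_ne_zero (b := b) i (by
    have := hb.basis_mem_rootSpace i
    rwa [h, Submodule.mem_bot] at this)⟩

theorem IsWeightBasis.mem_rootsPos (hb : IsWeightBasis b w) {i : ι} {y : 𝔞} (hi : 0 < w i y) :
    w i ∈ rootsPos p 𝔞 y :=
  ⟨hb.mem_roots fun h => by rw [h] at hi; exact lt_irrefl _ hi, hi⟩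

theorem IsWeightBasis.nilradical_eq (hb : IsWeightBasis b w) (y : 𝔞) :
    nilradical p 𝔞 y = wspan b {i | 0 < w i y} := by
  refine le_antisymm (iSup₂_le fun α hα X hX => ?_) ((wspan_le_iff b).2 fun i hi => ?_)
  · refine wspan_mono b (fun i (hi : w i y = α y) => ?_) (hb.mem_wspan_of_lie_eq hX.1 (hX.2 y))
    change 0 < w i y
    rw [hi]
    exact hα.2
  · exact (le_iSup₂ (f := fun α (_ : α ∈ rootsPos p 𝔞 y) => rootSpace p 𝔞 α) (w i)
      (hb.mem_rootsPos hi)) (hb.basis_mem_rootSpace i)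

/-- The image of `L` is the stabilizer of `y` in the range of `p`, a closed group, so its Lie
algebra is found by differentiating the stabilizer condition. -/
theorem IsFiniteClosedHom.mem_lieOf_levi_iff (hq : IsFiniteClosedHom p) {y : 𝔞} {X : Mat n} :
    X ∈ lieOf p (levi p 𝔞 y) ↔ X ∈ lieOf p ⊤ ∧ ⁅(y : Mat n), X⁆ = 0 := by
  have hmap : (levi p 𝔞 y).map p =
      { carrier := {g | g ∈ p.range ∧ conjAlgHom g (y : Mat n) = y}
        one_mem' := ⟨one_mem _, conjAlgHom_one _⟩
        mul_mem' := fun h h' => ⟨mul_mem h.1 h'.1, by rw [conjAlgHom_mul, h'.2, h.2]⟩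
        inv_mem' := fun {g} h => ⟨inv_mem h.1, by
          conv_lhs => rw [← h.2]
          rw [← conjAlgHom_mul, inv_mul_cancel, conjAlgHom_one]⟩ } := by
    ext g
    constructor
    · rintro ⟨x, hx, rfl⟩
      exact ⟨⟨x, rfl⟩, conjAlgHom_eq_self_iff.2 (hx _ rfl)⟩
    · rintro ⟨⟨x, rfl⟩, hx⟩
      refine ⟨x, ?_, rfl⟩
      rintro _ rfl
      exact conjAlgHom_eq_self_iff.1 hx
  rw [lieOf, hmap, mem_lieAlg_iff (hq.isClosed_range.inter
    (isClosed_singleton.preimage (continuous_conjAlgHom (y : Mat n)))), hq.mem_lieOf_iff]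
  constructor
  · intro h
    refine ⟨fun t => (h t).1, ?_⟩
    have h1 := hasDerivAt_conj_exp X (y : Mat n)
    have h2 : (fun t : ℝ => exp (t • X) * (y : Mat n) * exp (-(t • X))) = fun _ => (y : Mat n) := by
      funext t
      rw [← conjAlgHom_expGL]
      exact (h t).2
    rw [h2] at h1
    rw [← lie_skew, h1.unique (hasDerivAt_const _ _), neg_zero]
  · rintro ⟨h1, h2⟩ t
    refine ⟨h1 t, ?_⟩
    have h3 : ⁅t • X, (y : Mat n)⁆ = (0 : ℝ) • (y : Mat n) := by
      rw [smul_lie, ← lie_skew, h2]; simp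
    rw [conjAlgHom_expGL_eq_smul h3, Real.exp_zero, one_smul]

theorem IsWeightBasis.lie_mem_parabolic (hb : IsWeightBasis b w) (y : 𝔞) {X Z : Mat n}
    (hX : X ∈ wspan b {i | 0 ≤ w i y}) (hZ : Z ∈ wspan b {i | 0 ≤ w i y}) :
    ⁅X, Z⁆ ∈ wspan b {i | 0 ≤ w i y} :=
  hb.lie_mem_wspan (fun i hi j hj k hk => by
    change 0 ≤ w k y
    rw [hk]
    exact add_nonneg hi hj) hX hZ

/-- The normalizer in the image of `p` of a subspace of matrices. -/
def normalizerIn (p : G →* GL (Fin n) ℝ) (V : Submodule ℝ (Mat n)) : Subgroup (GL (Fin n) ℝ) where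
  carrier := {g | g ∈ p.range ∧ ∀ X, conjAlgHom g X ∈ V ↔ X ∈ V}
  one_mem' := ⟨one_mem _, fun X => by rw [conjAlgHom_one]⟩
  mul_mem' := fun h h' => ⟨mul_mem h.1 h'.1, fun X => by rw [conjAlgHom_mul, h.2, h'.2]⟩
  inv_mem' := fun {g} h => ⟨inv_mem h.1, fun X => by
    rw [← h.2, ← conjAlgHom_mul, mul_inv_cancel, conjAlgHom_one]⟩

theorem IsFiniteClosedHom.isClosed_normalizerIn (hq : IsFiniteClosedHom p)
    (V : Submodule ℝ (Mat n)) : IsClosed (normalizerIn p V : Set (GL (Fin n) ℝ)) := by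
  have h1 : (normalizerIn p V : Set (GL (Fin n) ℝ)) = (p.range : Set (GL (Fin n) ℝ)) ∩ ((⋂ X ∈ V,
      {g | conjAlgHom g X ∈ V}) ∩ ⋂ X ∈ V, {g : GL (Fin n) ℝ | conjAlgHom g⁻¹ X ∈ V}) := by
    ext g
    simp only [Set.mem_inter_iff, Set.mem_iInter]
    refine and_congr_right fun _ => ⟨fun h => ⟨fun X hX => (h X).2 hX, fun X hX => ?_⟩,
      fun h X => ⟨fun hX => ?_, h.1 X⟩⟩
    · change conjAlgHom g⁻¹ X ∈ V
      rwa [← h, ← conjAlgHom_mul, mul_inv_cancel, conjAlgHom_one]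
    · have := h.2 _ hX
      change conjAlgHom g⁻¹ (conjAlgHom g X) ∈ V at this
      rwa [← conjAlgHom_mul, inv_mul_cancel, conjAlgHom_one] at this
  have hV : IsClosed (V : Set (Mat n)) := V.closed_of_finiteDimensional
  rw [h1]
  refine hq.isClosed_range.inter (IsClosed.inter ?_ ?_)
  · exact isClosed_biInter fun X _ => hV.preimage (continuous_conjAlgHom X)
  · exact isClosed_biInter fun X _ => hV.preimage ((continuous_conjAlgHom X).comp continuous_inv)

theorem IsWeightBasis.expGL_mem_normalizerIn (hb : IsWeightBasis b w) (hq : IsFiniteClosedHom p)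
    (y : 𝔞) {X : Mat n} (hX : X ∈ wspan b {i | 0 ≤ w i y}) :
    expGL X ∈ normalizerIn p (wspan b {i | 0 ≤ w i y}) := by
  refine ⟨?_, conjAlgHom_expGL_mem fun Z hZ => hb.lie_mem_parabolic y hX hZ⟩
  have := hq.mem_lieOf_iff.1 (wspan_le b _ hX) 1
  rwa [one_smul] at this

/-- A parabolic subalgebra is its own normalizer: `y` belongs to it, and bracketing with `y`
rescales each coordinate of negative weight by a nonzero factor. -/
theorem IsWeightBasis.lieAlg_normalizerIn_le (hb : IsWeightBasis b w) (hq : IsFiniteClosedHom p)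
    (h𝔞 : 𝔞 ≤ (lieOf p ⊤).toSubmodule) (h𝔞' : ∀ X ∈ 𝔞, ∀ Y ∈ 𝔞, ⁅X, Y⁆ = 0) (y : 𝔞) :
    (lieAlg (normalizerIn p (wspan b {i | 0 ≤ w i y}))).toSubmodule ≤
      wspan b {i | 0 ≤ w i y} := by
  intro X hX
  have hX' := (mem_lieAlg_iff (hq.isClosed_normalizerIn _)).1 hX
  have hX𝔤 : X ∈ lieOf p ⊤ := hq.mem_lieOf_iff.2 fun t => (hX' t).1
  have hy : (y : Mat n) ∈ wspan b {i | 0 ≤ w i y} := by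
    refine wspan_mono b (fun i (hi : w i y = 0) => hi.ge)
      (hb.mem_wspan_of_lie_eq (h𝔞 y.2) (Y := y) (c := 0) ?_)
    rw [h𝔞' y y.2 y y.2, zero_smul]
  have h1 : ⁅X, (y : Mat n)⁆ ∈ wspan b {i | 0 ≤ w i y} := lie_mem_of_conj_mem fun t => by
    rw [← conjAlgHom_expGL]
    exact ((hX' t).2 _).2 hy
  have h2 : ⁅(y : Mat n), X⁆ ∈ wspan b {i | 0 ≤ w i y} := by
    rw [← lie_skew]; exact neg_mem h1
  refine (mem_wspan b ⟨X, hX𝔤⟩).2 fun i hi => ?_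
  have h3 := (mem_wspan b ⟨_, wspan_le b _ h2⟩).1 h2 i hi
  rw [repr_eq_of_apply_eq b (fun i => hb.lie_apply y i) (X := ⟨X, hX𝔤⟩) rfl, mul_eq_zero] at h3
  refine h3.resolve_left fun h => hi h.ge

/-- `P` normalizes the parabolic subalgebra of `y`, so its Lie algebra lies in that of the closed
normalizer. -/
theorem IsWeightBasis.lieOf_minParabolic_le (hb : IsWeightBasis b w) (hq : IsFiniteClosedHom p)
    (h𝔞 : 𝔞 ≤ (lieOf p ⊤).toSubmodule) (h𝔞' : ∀ X ∈ 𝔞, ∀ Y ∈ 𝔞, ⁅X, Y⁆ = 0) {x y : 𝔞}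
    (hxy : ∀ i, 0 < w i x → 0 ≤ w i y) :
    (lieOf p (minParabolic p 𝔞 x)).toSubmodule ≤ wspan b {i | 0 ≤ w i y} := by
  refine le_trans ?_ (hb.lieAlg_normalizerIn_le hq h𝔞 h𝔞' y)
  have h1 : (minParabolic p 𝔞 x).map p ≤ normalizerIn p (wspan b {i | 0 ≤ w i y}) := by
    rw [Subgroup.map_le_iff_le_comap]
    refine sup_le (fun m hm => ⟨⟨m, rfl⟩, ?_⟩) ((Subgroup.closure_le _).2 ?_)
    · have key : ∀ m ∈ centralizerOf p (𝔞 : Set (Mat n)), ∀ X ∈ wspan b {i | 0 ≤ w i y},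
          conjAlgHom (p m) X ∈ wspan b {i | 0 ≤ w i y} := by
        intro m hm
        have h2 : wspan b {i | 0 ≤ w i y} ≤
            (wspan b {i | 0 ≤ w i y}).comap (conjAlgHom (p m)).toLinearMap := by
          refine (wspan_le_iff b).2 fun i hi => ?_
          refine wspan_mono b (fun k (hk : w k y = w i y) => (hk ▸ hi : 0 ≤ w k y))
            (hb.mem_wspan_of_lie_eq (hq.conjAlgHom_mem m (b i).2) ?_)
          have h3 := conjAlgHom_eq_self_iff.2 (hm y y.2)
          change ⁅(y : Mat n), conjAlgHom (p m) (b i : Mat n)⁆ = _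
          conv_lhs => rw [← h3]
          rw [← conjAlgHom_lie, hb i y, map_smul]
          rfl
        exact fun X hX => h2 hX
      refine fun X => ⟨fun h => ?_, key m hm X⟩
      have := key m⁻¹ (inv_mem hm) _ h
      rwa [map_inv, ← conjAlgHom_mul, inv_mul_cancel, conjAlgHom_one] at this
    · rintro _ ⟨X, hX, rfl⟩
      rw [SetLike.mem_coe, hb.nilradical_eq] at hX
      change p (gexp p X) ∈ normalizerIn p _
      rw [map_gexp hq (wspan_le b _ hX)]
      exact hb.expGL_mem_normalizerIn hq y (wspan_mono b (fun i hi => hxy i hi) hX)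
  rw [lieOf, lieAlg_eq_span, lieAlg_eq_span]
  exact LieSubalgebra.lieSpan_mono fun X hX t => h1 (hX t)

/-- A product `exp A exp B` lies in the closed normalizer of `𝔮`, so near `1` it is `exp C` with `C
∈ 𝔮`. This is the input that the submersion argument needs. -/
theorem IsWeightBasis.eventually_exists_expGL_mul (hb : IsWeightBasis b w)
    (hq : IsFiniteClosedHom p) (h𝔞 : 𝔞 ≤ (lieOf p ⊤).toSubmodule)
    (h𝔞' : ∀ X ∈ 𝔞, ∀ Y ∈ 𝔞, ⁅X, Y⁆ = 0) (y : 𝔞) :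
    ∀ᶠ X in 𝓝 (0 : Mat n), X ∈ wspan b {i | 0 ≤ w i y} →
      ∃ A ∈ wspan b {i | w i y = 0}, ∃ B ∈ wspan b {i | 0 < w i y},
        expGL X = expGL A * expGL B := by
  set q := wspan b {i | 0 ≤ w i y} with hqdef
  set l := wspan b {i | w i y = 0} with hl
  set u := wspan b {i | 0 < w i y} with hu
  have hlq : l ≤ q := wspan_mono b fun i (hi : w i y = 0) => hi.ge
  have huq : u ≤ q := wspan_mono b fun i (hi : 0 < w i y) => hi.le
  obtain ⟨L, hL1, hLd, -, hL⟩ := exists_log (n := n)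
  have hcont : Tendsto (fun x : l × u => expGL (x.1 : Mat n) * expGL (x.2 : Mat n)) (𝓝 0)
      (𝓝 1) := by
    have : Continuous fun x : l × u => expGL (x.1 : Mat n) * expGL (x.2 : Mat n) :=
      (continuous_expGL.comp (continuous_subtype_val.comp continuous_fst)).mul
        (continuous_expGL.comp (continuous_subtype_val.comp continuous_snd))
    simpa [expGL_zero] using this.tendsto 0
  have hev := hcont.eventually (eventually_exists_expGL_eq (hq.isClosed_normalizerIn q) hL)
  have hsplit : ∀ v ∈ q, ∃ X ∈ l, ∃ Z ∈ u, v = X + Z := fun v hv =>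
    exists_add_mem_wspan b
      (wspan_mono b (fun i (hi : 0 ≤ w i y) => hi.eq_or_lt.imp Eq.symm id) hv)
  have hmain := eventually_exists_exp_mul_exp' (𝔸 := Mat n) hsplit hL1 hLd hev
  filter_upwards [hmain] with X hX hXq
  obtain ⟨x, hx, hxX⟩ := hX hXq
  obtain ⟨C, hC, hLC, hCx⟩ := hx (mul_mem (hb.expGL_mem_normalizerIn hq y (hlq x.1.2))
    (hb.expGL_mem_normalizerIn hq y (huq x.2.2)))
  have hCq : C ∈ q := hb.lieAlg_normalizerIn_le hq h𝔞 h𝔞' y hC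
  have h3 := congrArg (Units.val : GL (Fin n) ℝ → Mat n) hCx
  exact ⟨x.1, x.1.2, x.2, x.2.2, by rw [hxX C hCq hLC h3.symm, hCx]⟩

/-- If `Q ∩ H ⊆ L` then `𝔮 ∩ 𝔥 ⊆ 𝔩`. -/
theorem IsWeightBasis.mem_levi_of_mem_parabolic (hb : IsWeightBasis b w)
    (hq : IsFiniteClosedHom p) (h𝔞 : 𝔞 ≤ (lieOf p ⊤).toSubmodule)
    (h𝔞' : ∀ X ∈ 𝔞, ∀ Y ∈ 𝔞, ⁅X, Y⁆ = 0) {y : 𝔞} {H : Subgroup G} (hH : IsClosed (H : Set G))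
    (hle : parabolic p 𝔞 y ⊓ H ≤ levi p 𝔞 y) {X : Mat n} (hX : X ∈ lieOf p H)
    (hXq : X ∈ wspan b {i | 0 ≤ w i y}) : X ∈ wspan b {i | w i y = 0} := by
  have hX𝔤 : X ∈ lieOf p ⊤ := wspan_le b _ hXq
  have hlim : Tendsto (fun t : ℝ => t • X) (𝓝 0) (𝓝 0) := by
    have : Continuous fun t : ℝ => t • X := continuous_id.smul continuous_const
    simpa using this.tendsto 0
  have hev : ∀ᶠ t : ℝ in 𝓝 0, exp (t • X) * (y : Mat n) * exp (-(t • X)) = y := by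
    filter_upwards [hlim.eventually (hb.eventually_exists_expGL_mul hq h𝔞 h𝔞' y)] with t ht
    obtain ⟨A, hA, B, hB, hAB⟩ := ht (Submodule.smul_mem _ t hXq)
    have hA𝔤 := wspan_le b _ hA
    have hB𝔤 := wspan_le b _ hB
    have htX : t • X ∈ lieOf p ⊤ := (lieOf p ⊤).smul_mem t hX𝔤
    have h1 : gexp p A ∈ levi p 𝔞 y := by
      rintro _ rfl
      rw [map_gexp hq hA𝔤, ← conjAlgHom_eq_self_iff]
      have : ⁅A, (y : Mat n)⁆ = (0 : ℝ) • (y : Mat n) := by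
        rw [← lie_skew, hb.lie_eq_smul (fun i hi => hi) hA]; simp
      rw [conjAlgHom_expGL_eq_smul this, Real.exp_zero, one_smul]
    have h2 : gexp p B ∈ analyticSubgroup p (nilradical p 𝔞 y) :=
      Subgroup.subset_closure ⟨B, by rw [hb.nilradical_eq]; exact hB, rfl⟩
    -- The two elements of `G` have the same image under `p`; they differ by an element of the
    -- kernel, which is contained in `L`.
    have h3 : gexp p (t • X) * (gexp p A * gexp p B)⁻¹ ∈ levi p 𝔞 y := by
      rintro _ rfl
      rw [map_mul, map_inv, map_mul, map_gexp hq htX, map_gexp hq hA𝔤, map_gexp hq hB𝔤, hAB,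
        mul_inv_cancel]
      simp
    have h4 : gexp p (t • X) ∈ parabolic p 𝔞 y := by
      have h5 := mul_mem (Subgroup.mem_sup_left h3 : _ ∈ parabolic p 𝔞 y)
        (mul_mem (Subgroup.mem_sup_left h1 : _ ∈ parabolic p 𝔞 y) (Subgroup.mem_sup_right h2))
      rwa [inv_mul_cancel_right] at h5
    have h6 : gexp p (t • X) ∈ H := by
      rw [← coe_gexp_comp_subtype hq hH ((lieOf p H).smul_mem t hX)]
      exact SetLike.coe_mem _
    have h7 := hle ⟨h4, h6⟩ _ rfl
    rw [map_gexp hq htX, ← conjAlgHom_eq_self_iff, conjAlgHom_expGL] at h7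
    exact h7
  have h1 := (hasDerivAt_conj_exp X (y : Mat n)).congr_of_eventuallyEq
    (f₁ := fun _ => (y : Mat n)) (hev.mono fun t ht => ht.symm)
  refine hb.mem_wspan_of_lie_eq hX𝔤 ?_
  rw [← lie_skew, h1.unique (hasDerivAt_const _ _), neg_zero, zero_smul]

theorem IsFiniteClosedHom.le_lieOf_of_analyticSubgroup_le (hq : IsFiniteClosedHom p)
    {V : Submodule ℝ (Mat n)} (hV : V ≤ (lieOf p ⊤).toSubmodule) {H : Subgroup G}
    (hH : analyticSubgroup p V ≤ H) : V ≤ (lieOf p H).toSubmodule := by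
  intro X hX
  change X ∈ lieOf p H
  rw [lieOf, lieAlg_eq_span]
  refine LieSubalgebra.subset_lieSpan fun t => ?_
  exact ⟨gexp p (t • X), hH (Subgroup.subset_closure ⟨_, V.smul_mem t hX, rfl⟩),
    map_gexp hq (hV (V.smul_mem t hX))⟩

end Parabolic

end RealSpherical
end

noncomputable section

open MeasureTheory NormedSpace Filter
open scoped Pointwise Topology Matrix.Norms.Operator

set_option linter.unusedSectionVars false

namespace RealSpherical

attribute [local instance 100] LieRing.ofAssociativeRing

/-! ### The structure of an adapted real spherical pair -/

/-- The form `tr(x τ(y))` is positive definite, and the adjoint of `ad z` for it is `ad(τ z)`. -/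
theorem mem_noncompactPart {n : ℕ} {𝔤 𝔩 : LieSubalgebra ℝ (Mat n)} {𝔞 : Submodule ℝ (Mat n)}
    {τ : Mat n →ₗ[ℝ] Mat n} (hτ : IsCartanAnti 𝔤 𝔞 τ) (h𝔩 : ∀ X ∈ 𝔩, τ X ∈ 𝔩) {X Y : Mat n}
    (hX : X ∈ 𝔩) (hY : Y ∈ 𝔩) {c : ℝ} (hc : c ≠ 0) (h : ⁅Y, X⁆ = c • X) :
    X ∈ noncompactPart 𝔩 := by
  let B : 𝔩 →ₗ[ℝ] 𝔩 →ₗ[ℝ] ℝ := LinearMap.mk₂ ℝ (fun x y => ((x : Mat n) * τ y).trace)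
    (fun x x' y => by simp [add_mul]) (fun c x y => by simp) (fun x y y' => by simp [mul_add])
    (fun c x y => by simp)
  have hpos : ∀ x, x ≠ 0 → 0 < B x x := fun x hx => hτ.pos x fun h => hx (Subtype.ext h)
  have hθ : ∀ z x y : 𝔩, B ⁅z, x⁆ y = B x ⁅(⟨τ z, h𝔩 z z.2⟩ : 𝔩), y⁆ := by
    intro z x y
    change (⁅(z : Mat n), (x : Mat n)⁆ * τ y).trace = ((x : Mat n) * τ ⁅τ (z : Mat n), y⁆).trace
    rw [← lie_skew, neg_mul, Matrix.trace_neg, trace_lie_mul, hτ.map_lie, hτ.involutive,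
      ← lie_skew, mul_neg, Matrix.trace_neg, neg_neg]
  have h1 := mem_iSup_noncompact_simple hpos hθ (x := ⟨X, hX⟩) (Y := ⟨Y, hY⟩) hc
    (Subtype.ext h)
  rw [← LieSubmodule.mem_toSubmodule] at h1
  simp only [LieSubmodule.iSup_toSubmodule] at h1
  have h2 := Submodule.mem_map_of_mem (f := 𝔩.toSubmodule.subtype) h1
  simp only [Submodule.map_iSup] at h2
  exact h2

section Structure

variable {n : ℕ} {G : Type*} [Group G] [TopologicalSpace G] [IsTopologicalGroup G] [T2Space G]
  {p : G →* GL (Fin n) ℝ} {H : Subgroup G} {𝔞 : Submodule ℝ (Mat n)} {x₀ y₀ : 𝔞} {ι : Type}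
  [Fintype ι] [DecidableEq ι] {b : Module.Basis ι ℝ (lieOf p ⊤).toSubmodule}
  {w : ι → Module.Dual ℝ 𝔞} {τ : Mat n →ₗ[ℝ] Mat n}

theorem IsMaximalSplit.exists_isWeightBasis (h : IsMaximalSplit p 𝔞) :
    ∃ (ι : Type) (_ : Fintype ι) (_ : DecidableEq ι)
      (b : Module.Basis ι ℝ (lieOf p ⊤).toSubmodule) (w : ι → Module.Dual ℝ 𝔞),
      IsWeightBasis b w := by
  obtain ⟨h1, h2, h3⟩ := h.prop
  refine exists_weightBasis (fun Y hY => ?_) h3 fun Y hY X hX => (lieOf p ⊤).lie_mem (h1 hY) hX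
  obtain ⟨g, d, h⟩ := h2 Y hY
  exact ⟨_, aeval_rootPoly_of_eq_conj_diagonal h⟩

theorem IsWeightBasis.mem_wspan_of_forall_lie (hb : IsWeightBasis b w) {X : Mat n}
    (hX : X ∈ lieOf p ⊤) {α : Module.Dual ℝ 𝔞} (h : ∀ Y : 𝔞, ⁅(Y : Mat n), X⁆ = α Y • X) :
    X ∈ wspan b {i | w i = α} := by
  refine (mem_wspan b ⟨X, hX⟩).2 fun i hi => ?_
  obtain ⟨Y, hY⟩ : ∃ Y, w i Y ≠ α Y := by
    by_contra! h
    exact hi (LinearMap.ext h)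
  exact hb.repr_eq_zero (X := ⟨X, hX⟩) (h Y) hY

theorem IsWeightBasis.weight_eq_zero (hb : IsWeightBasis b w) (hreg : ∀ α ∈ roots p 𝔞, α x₀ ≠ 0)
    {i : ι} (hi : w i x₀ = 0) : w i = 0 := by
  by_contra h
  exact hreg _ (hb.mem_roots h) hi

/-- The group and the choices of a real spherical space, with a basis of root vectors and an
adapted Cartan anti-involution. -/
structure IsSphericalFrame (p : G →* GL (Fin n) ℝ) (H : Subgroup G) (𝔞 : Submodule ℝ (Mat n))
    (x₀ y₀ : 𝔞) (b : Module.Basis ι ℝ (lieOf p ⊤).toSubmodule) (w : ι → Module.Dual ℝ 𝔞)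
    (τ : Mat n →ₗ[ℝ] Mat n) : Prop where
  hom : IsFiniteClosedHom p
  closed : IsClosed (H : Set G)
  adapted : IsAdapted p H 𝔞 x₀ y₀
  basis : IsWeightBasis b w
  anti : IsCartanAnti (lieOf p ⊤) 𝔞 τ

theorem IsAdapted.exists_frame (hp : IsRealReductive p) (hH : IsClosed (H : Set G))
    (h : IsAdapted p H 𝔞 x₀ y₀) : ∃ (ι : Type) (_ : Fintype ι) (_ : DecidableEq ι)
      (b : Module.Basis ι ℝ (lieOf p ⊤).toSubmodule) (w : ι → Module.Dual ℝ 𝔞)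
      (τ : Mat n →ₗ[ℝ] Mat n), IsSphericalFrame p H 𝔞 x₀ y₀ b w τ := by
  obtain ⟨ι, _, _, b, w, hb⟩ := h.maximal_split.exists_isWeightBasis
  obtain ⟨τ, hτ⟩ := exists_isCartanAnti (𝔤 := lieOf p ⊤) (fun X hX => hp.transpose_mem_lieOf hX)
    -- What commutes with the regular element `x₀` has only weight zero components, hence commutes
    -- with `𝔞`.
    h.maximal_split.prop x₀.2 fun X hX hx Y hY => by
      have h1 := hb.mem_wspan_of_lie_eq (Y := x₀) (c := 0) hX (by rw [hx, zero_smul])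
      have h2 := hb.lie_eq_smul (Y := ⟨Y, hY⟩) (c := 0)
        (fun i hi => by rw [hb.weight_eq_zero h.regular hi]; rfl) h1
      rw [h2, zero_smul]
  exact ⟨ι, ‹_›, ‹_›, b, w, τ, hp.isFiniteClosedHom, hH, h, hb, hτ⟩

namespace IsSphericalFrame

theorem le_top (F : IsSphericalFrame p H 𝔞 x₀ y₀ b w τ) : 𝔞 ≤ (lieOf p ⊤).toSubmodule :=
  F.adapted.maximal_split.prop.1

theorem lie_eq_zero (F : IsSphericalFrame p H 𝔞 x₀ y₀ b w τ) :
    ∀ X ∈ 𝔞, ∀ Y ∈ 𝔞, ⁅X, Y⁆ = 0 := F.adapted.maximal_split.prop.2.2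

theorem lieOf_le (_ : IsSphericalFrame p H 𝔞 x₀ y₀ b w τ) :
    (lieOf p H).toSubmodule ≤ (lieOf p ⊤).toSubmodule := lieOf_mono _root_.le_top

theorem lie_anti (F : IsSphericalFrame p H 𝔞 x₀ y₀ b w τ) (i : ι) (Y : 𝔞) :
    ⁅(Y : Mat n), τ (b i)⁆ = (-w i) Y • τ (b i) := by
  have h := congrArg τ (F.basis i Y)
  rw [F.anti.map_lie, F.anti.fix Y Y.2, map_smul] at h
  rw [← lie_skew, h, LinearMap.neg_apply, neg_smul]

theorem anti_mem (F : IsSphericalFrame p H 𝔞 x₀ y₀ b w τ) (i : ι) :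
    τ (b i) ∈ wspan b {k | w k = -w i} :=
  F.basis.mem_wspan_of_forall_lie (F.anti.mem _ (b i).2) (F.lie_anti i)

theorem anti_ne_zero (F : IsSphericalFrame p H 𝔞 x₀ y₀ b w τ) (i : ι) : τ (b i) ≠ 0 := fun h =>
  basis_coe_ne_zero (b := b) i (by rw [← F.anti.involutive (b i), h, map_zero])

/-- The set of weights is symmetric. -/
theorem exists_weight_eq_neg (F : IsSphericalFrame p H 𝔞 x₀ y₀ b w τ) (i : ι) :
    ∃ k, w k = -w i := by
  by_contra! h
  refine F.anti_ne_zero i ?_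
  have h1 := F.anti_mem i
  have h2 : {k | w k = -w i} = ∅ := Set.eq_empty_of_forall_notMem h
  rw [h2] at h1
  have h3 : wspan b (∅ : Set ι) ≤ ⊥ := (wspan_le_iff b).2 fun i hi => hi.elim
  exact (Submodule.mem_bot ℝ).1 (h3 h1)

theorem nonneg_of_pos (F : IsSphericalFrame p H 𝔞 x₀ y₀ b w τ) {i : ι} (hi : 0 < w i x₀) :
    0 ≤ w i y₀ :=
  F.adapted.dominant _ (F.basis.mem_rootsPos hi)

/-- If `w i` were negative on `x₀`, then `-w i` would be a positive root, nonnegative on `y₀` by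
dominance. -/
theorem pos_of_pos (F : IsSphericalFrame p H 𝔞 x₀ y₀ b w τ) {i : ι} (hi : 0 < w i y₀) :
    0 < w i x₀ := by
  by_contra! h
  rcases h.eq_or_lt with h | h
  · rw [F.basis.weight_eq_zero F.adapted.regular h] at hi
    exact lt_irrefl _ hi
  · obtain ⟨k, hk⟩ := F.exists_weight_eq_neg i
    have h1 := F.nonneg_of_pos (i := k) (by rw [hk]; exact neg_pos.2 h)
    rw [hk] at h1
    exact absurd hi (not_lt.2 (neg_nonneg.1 h1))

/-- The coroot-like element `[X, τ X]` for the root vector `X = b i`. -/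
theorem lie_anti_mem (F : IsSphericalFrame p H 𝔞 x₀ y₀ b w τ) (i : ι) :
    ⁅(b i : Mat n), τ (b i)⁆ ∈ 𝔞 := by
  refine F.anti.mem_of_fix F.adapted.maximal_split ((lieOf p ⊤).lie_mem (b i).2
    (F.anti.mem _ (b i).2)) ?_ fun Y hY => ?_
  · rw [F.anti.map_lie, F.anti.involutive]
  · rw [leibniz_lie, F.basis i ⟨Y, hY⟩, F.lie_anti i ⟨Y, hY⟩]
    simp

theorem trace_lie_anti_mul (F : IsSphericalFrame p H 𝔞 x₀ y₀ b w τ) (i : ι) (Y : 𝔞) :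
    (⁅(b i : Mat n), τ (b i)⁆ * (Y : Mat n)).trace = w i Y * ((b i : Mat n) * τ (b i)).trace := by
  rw [trace_lie_mul, ← lie_skew, F.lie_anti i Y, LinearMap.neg_apply, neg_smul, neg_neg, mul_smul_comm,
    Matrix.trace_smul, smul_eq_mul]

/-- The root vectors of the Levi algebra `𝔩` belong to `𝔥`. -/
theorem basis_mem_lieOf (F : IsSphericalFrame p H 𝔞 x₀ y₀ b w τ) {i : ι} (hi : w i ≠ 0)
    (hi0 : w i y₀ = 0) : (b i : Mat n) ∈ lieOf p H ∧ τ (b i) ∈ lieOf p H := by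
  obtain ⟨Y, hY⟩ : ∃ Y, w i Y ≠ 0 := by
    by_contra! h
    exact hi (LinearMap.ext h)
  have hle : noncompactPart (lieOf p (levi p 𝔞 y₀)) ≤ (lieOf p H).toSubmodule := by
    refine F.hom.le_lieOf_of_analyticSubgroup_le ?_ (F.adapted.noncompact_le.trans inf_le_right)
    refine le_trans ?_ (lieOf_mono (q := p) (_root_.le_top (a := levi p 𝔞 y₀)))
    refine iSup_le fun I => iSup₂_le fun _ _ => ?_
    rintro _ ⟨x, -, rfl⟩
    exact x.2
  have hl : ∀ X ∈ lieOf p (levi p 𝔞 y₀), τ X ∈ lieOf p (levi p 𝔞 y₀) := by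
    intro X hX
    rw [F.hom.mem_lieOf_levi_iff] at hX ⊢
    refine ⟨F.anti.mem X hX.1, ?_⟩
    have := congrArg τ hX.2
    rw [F.anti.map_lie, F.anti.fix y₀ y₀.2, map_zero] at this
    rw [← lie_skew, this, neg_zero]
  have hY' : (Y : Mat n) ∈ lieOf p (levi p 𝔞 y₀) :=
    F.hom.mem_lieOf_levi_iff.2 ⟨F.le_top Y.2, F.lie_eq_zero _ y₀.2 _ Y.2⟩
  have hbi : (b i : Mat n) ∈ lieOf p (levi p 𝔞 y₀) :=
    F.hom.mem_lieOf_levi_iff.2 ⟨(b i).2, by rw [F.basis i y₀, hi0, zero_smul]⟩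
  exact ⟨hle (mem_noncompactPart F.anti hl hbi hY' hY (F.basis i Y)),
    hle (mem_noncompactPart F.anti hl (hl _ hbi) hY' (neg_ne_zero.2 hY) (F.lie_anti i Y))⟩

/-- The span of the `[X, τ X]` over the root vectors `X` of the Levi algebra. -/
def leviSplit (_ : IsSphericalFrame p H 𝔞 x₀ y₀ b w τ) : Submodule ℝ 𝔞 :=
  Submodule.span ℝ {t | ∃ i, w i ≠ 0 ∧ w i y₀ = 0 ∧ (t : Mat n) = ⁅(b i : Mat n), τ (b i)⁆}

theorem mem_lieOf_of_mem_leviSplit (F : IsSphericalFrame p H 𝔞 x₀ y₀ b w τ) {Y : 𝔞}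
    (hY : Y ∈ F.leviSplit) : (Y : Mat n) ∈ lieOf p H := by
  have h : F.leviSplit ≤ (lieOf p H).toSubmodule.comap 𝔞.subtype := by
    refine Submodule.span_le.2 ?_
    rintro t ⟨i, hi, hi0, ht⟩
    change (t : Mat n) ∈ lieOf p H
    rw [ht]
    exact (lieOf p H).lie_mem (F.basis_mem_lieOf hi hi0).1 (F.basis_mem_lieOf hi hi0).2
  exact h hY

/-- The trace form is positive on `𝔞`, since `τ` fixes `𝔞`, and orthogonality to `[X, τX]` means
vanishing of the root of `X`. So `Yn` is the orthogonal projection of `Y`. -/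
theorem exists_sub_mem_leviSplit (F : IsSphericalFrame p H 𝔞 x₀ y₀ b w τ) (Y : 𝔞) :
    ∃ Yn ∈ F.leviSplit, ∀ i, w i y₀ = 0 → w i (Y - Yn) = 0 := by
  let B : 𝔞 →ₗ[ℝ] 𝔞 →ₗ[ℝ] ℝ := LinearMap.mk₂ ℝ (fun x y => ((x : Mat n) * (y : Mat n)).trace)
    (fun x x' y => by simp [add_mul]) (fun c x y => by simp) (fun x y y' => by simp [mul_add])
    (fun c x y => by simp)
  have hpos : ∀ x, x ≠ 0 → 0 < B x x := fun x hx => by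
    have := F.anti.pos x fun h => hx (Subtype.ext h)
    rwa [F.anti.fix x x.2] at this
  obtain ⟨Yn, hYn, h⟩ := exists_orthogonal_decomposition hpos F.leviSplit Y
  refine ⟨Yn, hYn, fun i hi0 => ?_⟩
  by_cases hi : w i = 0
  · rw [hi]; rfl
  have h1 := h ⟨_, F.lie_anti_mem i⟩ (Submodule.subset_span ⟨i, hi, hi0, rfl⟩)
  change (((Y - Yn : 𝔞) : Mat n) * ⁅(b i : Mat n), τ (b i)⁆).trace = 0 at h1
  rw [Matrix.trace_mul_comm, F.trace_lie_anti_mul, mul_eq_zero] at h1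
  exact h1.resolve_right (F.anti.pos _ (basis_coe_ne_zero i)).ne'

theorem lie_mem_of_mem_levi (F : IsSphericalFrame p H 𝔞 x₀ y₀ b w τ) {S : Set ι}
    (hS : ∀ i, w i y₀ = 0 → ∀ j ∈ S, ∀ k, w k = w i + w j → k ∈ S) {i : ι} (hi : w i y₀ = 0)
    {X : Mat n} (hX : X ∈ wspan b S) :
    ⁅(b i : Mat n), X⁆ ∈ wspan b S ∧ ⁅τ (b i), X⁆ ∈ wspan b S := by
  refine ⟨F.basis.lie_mem_wspan (S := {i | w i y₀ = 0}) hS (basis_mem_wspan b hi) hX,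
    F.basis.lie_mem_wspan hS (S := {i | w i y₀ = 0}) (wspan_mono b (fun k hk => ?_) (F.anti_mem i))
      hX⟩
  change w k y₀ = 0
  rw [hk, LinearMap.neg_apply, hi, neg_zero]

-- The sum is the trace of `ad Y` on a subspace stable under the root vectors of `𝔩`, and `Y` is a
-- combination of commutators of such vectors.
open Classical in
theorem sum_weight_eq_zero (F : IsSphericalFrame p H 𝔞 x₀ y₀ b w τ) {S : Set ι}
    (hS : ∀ i, w i y₀ = 0 → ∀ j ∈ S, ∀ k, w k = w i + w j → k ∈ S) {Y : 𝔞}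
    (hY : Y ∈ F.leviSplit) : ∑ i : S, w i Y = 0 := by
  have h : F.leviSplit ≤ LinearMap.ker (∑ i : S, w i) := by
    refine Submodule.span_le.2 ?_
    rintro t ⟨i, hi, hi0, ht⟩
    rw [SetLike.mem_coe, LinearMap.mem_ker, LinearMap.sum_apply]
    have hrange : ∀ X, X ∈ LinearMap.range (wspan b S).subtype ↔ X ∈ wspan b S := fun X => by
      rw [Submodule.range_subtype]
    obtain ⟨f, hf⟩ := exists_end_of_mapsTo (wspan b S).injective_subtype
      (F := LieModule.toEnd ℝ (Mat n) (Mat n) (t : Mat n)) fun X => by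
        rw [hrange, ht, LieModule.toEnd_apply_apply, lie_lie]
        exact sub_mem (F.lie_mem_of_mem_levi hS hi0 (F.lie_mem_of_mem_levi hS hi0 X.2).2).1
          (F.lie_mem_of_mem_levi hS hi0 (F.lie_mem_of_mem_levi hS hi0 X.2).1).2
    rw [← F.basis.trace_eq rfl t hf]
    refine trace_eq_zero_of_lie (wspan b S).injective_subtype (A := (b i : Mat n)) (B := τ (b i))
      (fun X => (hrange _).2 (F.lie_mem_of_mem_levi hS hi0 X.2).1)
      (fun X => (hrange _).2 (F.lie_mem_of_mem_levi hS hi0 X.2).2) fun X => ?_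
    rw [← ht]
    exact hf X
  have := h hY
  rwa [LinearMap.mem_ker, LinearMap.sum_apply] at this

open Classical in
/-- Removing the component of an element of the negative chamber along `leviSplit` does not destroy
its negativity on the roots of the nilradical. -/
theorem weight_sub_nonpos (F : IsSphericalFrame p H 𝔞 x₀ y₀ b w τ) {Y Yn : 𝔞}
    (hY : Y ∈ negChamber p 𝔞 x₀) (hYn : Yn ∈ F.leviSplit)
    (h0 : ∀ i, w i y₀ = 0 → w i (Y - Yn) = 0) {i : ι} (hi : 0 < w i y₀) : w i (Y - Yn) ≤ 0 := by
  -- The weights agreeing with `w i` on the common kernel of the Levi weights. On `Y - Yn` they all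
  -- take the value `w i (Y - Yn)`, their sum vanishes on `Yn`, and each is nonpositive on `Y`:
  -- averaging gives the sign.
  let S : Set ι := {j | ∀ Z : 𝔞, (∀ k, w k y₀ = 0 → w k Z = 0) → w j Z = w i Z}
  have hS : ∀ k, w k y₀ = 0 → ∀ j ∈ S, ∀ m, w m = w k + w j → m ∈ S := by
    intro k hk j hj m hm Z hZ
    rw [hm, LinearMap.add_apply, hZ k hk, zero_add, hj Z hZ]
  have hiS : i ∈ S := fun _ _ => rfl
  have h1 := F.sum_weight_eq_zero hS hYn
  have h2 : ∑ j : S, w j Y ≤ 0 := Finset.sum_nonpos fun j _ => by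
    have h3 : 0 < w j y₀ := by rwa [j.2 y₀ fun k hk => hk]
    exact hY _ (F.basis.mem_rootsPos (F.pos_of_pos h3))
  have h4 : ∑ j : S, w j (Y - Yn) = Fintype.card S * w i (Y - Yn) := by
    rw [Finset.sum_congr rfl fun (j : S) _ => j.2 (Y - Yn) h0]
    rw [Finset.sum_const, Finset.card_univ, nsmul_eq_mul]
  simp only [map_sub, Finset.sum_sub_distrib, h1, sub_zero] at h4
  have : Nonempty S := ⟨⟨i, hiS⟩⟩
  have h5 : (0 : ℝ) < Fintype.card S := by
    exact_mod_cast Fintype.card_pos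
  rw [h4] at h2
  rw [map_sub]
  by_contra! h6
  exact absurd h2 (not_le.2 (mul_pos h5 h6))

end IsSphericalFrame

end Structure

end RealSpherical
end

noncomputable section

open MeasureTheory NormedSpace Filter
open scoped Pointwise Topology Matrix.Norms.Operator

set_option linter.unusedSectionVars false

namespace RealSpherical

attribute [local instance 100] LieRing.ofAssociativeRing

/-! ### The modular function on one-parameter subgroups -/

/-- `Δ(exp Y) = |det Ad(exp Y)|`, evaluated in an eigenbasis of `ad Y`. -/
theorem IsFiniteClosedHom.modularCharacterFun_gexp {n : ℕ} {Γ : Type*} [Group Γ]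
    [TopologicalSpace Γ] [IsTopologicalGroup Γ] [T2Space Γ] [LocallyCompactSpace Γ]
    {q : Γ →* GL (Fin n) ℝ} (hq : IsFiniteClosedHom q) {W : LieSubalgebra ℝ (Mat n)}
    (hW : lieOf q ⊤ = W) {Y : Mat n} (hY : Y ∈ W) {s : Finset ℝ}
    (hs : Polynomial.aeval Y (rootPoly s) = 0) {f : Module.End ℝ W.toSubmodule}
    (hf : ∀ X, (f X : Mat n) = ⁅Y, (X : Mat n)⁆) :
    (Measure.modularCharacterFun (gexp q Y) : ℝ) = Real.exp (LinearMap.trace ℝ _ f) := by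
  subst hW
  have hspan : ∀ Z ∈ Submodule.span ℝ {Y}, ∃ c : ℝ, c • Y = Z := fun Z hZ =>
    Submodule.mem_span_singleton.1 hZ
  obtain ⟨ι, _, _, b, w, hb⟩ := exists_weightBasis (𝔟 := Submodule.span ℝ {Y})
    (W := (lieOf q ⊤).toSubmodule)
    (fun Z hZ => by
      obtain ⟨c, rfl⟩ := hspan Z hZ
      exact exists_aeval_smul_rootPoly hs c)
    (fun Z hZ Z' hZ' => by
      obtain ⟨c, rfl⟩ := hspan Z hZ
      obtain ⟨c', rfl⟩ := hspan Z' hZ'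
      rw [smul_lie, lie_smul, lie_self, smul_zero, smul_zero])
    (fun Z hZ X hX => by
      obtain ⟨c, rfl⟩ := hspan Z hZ
      exact (lieOf q ⊤).lie_mem ((lieOf q ⊤).smul_mem c hY) hX)
  let y : Submodule.span ℝ {Y} := ⟨Y, Submodule.mem_span_singleton_self Y⟩
  have hby : ∀ i, ⁅Y, (b i : Mat n)⁆ = w i y • (b i : Mat n) := fun i => hb i y
  obtain ⟨T, hT⟩ := exists_end_of_mapsTo (lieOf q ⊤).toSubmodule.injective_subtype
    (F := (conjAlgHom (expGL Y)).toLinearMap) fun X => by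
      rw [Submodule.range_subtype]
      exact (conjAlgHom_expGL_mem (W := (lieOf q ⊤).toSubmodule)
        (fun X hX => (lieOf q ⊤).lie_mem hY hX) _).2 X.2
  have hT' : ∀ X, (T X : Mat n) = conjAlgHom (expGL Y) X := hT
  rw [hq.modularCharacterFun_eq (gexp q Y) T fun X => by
      rw [map_gexp hq hY, hT', conjAlgHom_apply],
    det_eq_prod_of_eigenbasis b (μ := fun i => Real.exp (w i y)) fun i => Subtype.ext (by
      rw [hT', conjAlgHom_expGL_eq_smul (hby i)]; rfl),
    trace_eq_sum_of_eigenbasis b (μ := fun i => w i y) fun i => Subtype.ext (by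
      rw [hf, hby]; rfl),
    Real.exp_sum, abs_of_pos (Finset.prod_pos fun i _ => Real.exp_pos _)]

/-! ### The trace of `ad Y` on `𝔥`, and a uniformly bounded endomorphism of `𝔥`. -/

section Structure

variable {n : ℕ} {G : Type*} [Group G] [TopologicalSpace G] [IsTopologicalGroup G] [T2Space G]
  {p : G →* GL (Fin n) ℝ} {H : Subgroup G} {𝔞 : Submodule ℝ (Mat n)} {x₀ y₀ : 𝔞} {ι : Type}
  [Fintype ι] [DecidableEq ι] {b : Module.Basis ι ℝ (lieOf p ⊤).toSubmodule}
  {w : ι → Module.Dual ℝ 𝔞} {τ : Mat n →ₗ[ℝ] Mat n}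

namespace IsSphericalFrame

open Classical in
theorem rho_eq (F : IsSphericalFrame p H 𝔞 x₀ y₀ b w τ) (Y : 𝔞) :
    rho p 𝔞 y₀ Y = 1 / 2 * ∑ i : {i | 0 < w i y₀}, w i Y := by
  rw [rho, F.basis.trace_eq (F.basis.nilradical_eq y₀) Y fun X => rfl]

/-- Conjugation by `τ` turns `ad Y` into `-ad Y`. -/
theorem trace_ad_eq_zero (F : IsSphericalFrame p H 𝔞 x₀ y₀ b w τ) {Y : Mat n} (hY : Y ∈ 𝔞)
    {f : Module.End ℝ (lieOf p ⊤).toSubmodule} (hf : ∀ X, (f X : Mat n) = ⁅Y, (X : Mat n)⁆) :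
    LinearMap.trace ℝ _ f = 0 := by
  obtain ⟨t, ht⟩ := exists_end_of_mapsTo (lieOf p ⊤).toSubmodule.injective_subtype
    (F := τ) fun X => by
      rw [Submodule.range_subtype]
      exact F.anti.mem _ X.2
  have ht' : ∀ X, (t X : Mat n) = τ X := ht
  have h1 : t * t = 1 := LinearMap.ext fun X => Subtype.ext (by
    rw [Module.End.mul_apply, ht', ht', F.anti.involutive]; rfl)
  have h2 : LinearMap.trace ℝ _ (t * (f * t)) = LinearMap.trace ℝ _ f := by
    rw [LinearMap.trace_mul_comm, mul_assoc, h1, mul_one]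
  have h3 : f = (-1 : ℝ) • (t * (f * t)) := LinearMap.ext fun X => Subtype.ext (by
    rw [LinearMap.smul_apply, Submodule.coe_smul, Module.End.mul_apply, Module.End.mul_apply, ht',
      hf, hf, ht', F.anti.map_lie, F.anti.involutive, F.anti.fix Y hY, neg_one_smul, lie_skew])
  have h4 := congrArg (LinearMap.trace ℝ _) h3
  rw [map_smul, h2, smul_eq_mul] at h4
  linarith

theorem sum_weight_univ (F : IsSphericalFrame p H 𝔞 x₀ y₀ b w τ) (Y : 𝔞) : ∑ i, w i Y = 0 := by
  obtain ⟨f, hf⟩ := exists_end_of_mapsTo (lieOf p ⊤).toSubmodule.injective_subtype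
    (F := LieModule.toEnd ℝ (Mat n) (Mat n) (Y : Mat n)) fun X => by
      rw [Submodule.range_subtype]
      exact (lieOf p ⊤).lie_mem (F.le_top Y.2) X.2
  rw [← F.trace_ad_eq_zero Y.2 hf]
  exact (trace_eq_sum_of_eigenbasis b fun i => Subtype.ext ((hf (b i)).trans (F.basis i Y))).symm

open Classical in
/-- The sum of the weights that are negative on `y₀`. -/
theorem sum_weight_neg (F : IsSphericalFrame p H 𝔞 x₀ y₀ b w τ) {Y : 𝔞}
    (h0 : ∑ i : {i | w i y₀ = 0}, w i Y = 0) :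
    ∑ i : {i | w i y₀ < 0}, w i Y = -2 * rho p 𝔞 y₀ Y := by
  have key : ∀ S : Set ι, ∑ i : S, w i Y = ∑ i, if i ∈ S then w i Y else 0 := fun S => by
    rw [← Finset.sum_filter]
    exact (Finset.sum_subtype _ (by simp) fun i => w i Y).symm
  have h1 : ∑ i : {i | w i y₀ < 0}, w i Y + ∑ i : {i | w i y₀ = 0}, w i Y +
      ∑ i : {i | 0 < w i y₀}, w i Y = ∑ i, w i Y := by
    rw [key, key, key, ← Finset.sum_add_distrib, ← Finset.sum_add_distrib]
    refine Finset.sum_congr rfl fun i _ => ?_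
    simp only [Set.mem_ofPred_eq]
    rcases lt_trichotomy (w i y₀) 0 with h | h | h
    · rw [if_pos h, if_neg h.ne, if_neg h.not_gt, add_zero, add_zero]
    · rw [if_neg h.not_lt, if_pos h, if_neg h.not_gt, add_zero, zero_add]
    · rw [if_neg h.not_gt, if_neg h.ne', if_pos h, zero_add, zero_add]
  rw [F.sum_weight_univ, h0] at h1
  rw [F.rho_eq]
  linarith

/-- The projection of `𝔥` to the opposite nilradical, in coordinates. -/
def proj (F : IsSphericalFrame p H 𝔞 x₀ y₀ b w τ) :
    (lieOf p H).toSubmodule →ₗ[ℝ] ({i | w i y₀ < 0} → ℝ) :=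
  LinearMap.pi fun i => b.coord i ∘ₗ Submodule.inclusion F.lieOf_le

theorem proj_apply (F : IsSphericalFrame p H 𝔞 x₀ y₀ b w τ) (X : (lieOf p H).toSubmodule)
    (i : {i | w i y₀ < 0}) : F.proj X i = b.repr (Submodule.inclusion F.lieOf_le X) i := rfl

/-- Openness of the orbit, `𝔤 = 𝔥 + 𝔭`, together with `𝔭 ⊆ 𝔮`, whose elements have no coordinates in
`𝔲̄`. -/
theorem surjective_proj (F : IsSphericalFrame p H 𝔞 x₀ y₀ b w τ) :
    Function.Surjective F.proj := by
  classical
  intro v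
  let X : (lieOf p ⊤).toSubmodule :=
    b.equivFun.symm fun i => if h : w i y₀ < 0 then v ⟨i, h⟩ else 0
  have hX : (X : Mat n) ∈ (lieOf p H).toSubmodule ⊔ wspan b {i | 0 ≤ w i y₀} := by
    have h1 : (lieOf p ⊤).toSubmodule ≤ (lieOf p H).toSubmodule ⊔ wspan b {i | 0 ≤ w i y₀} := by
      rw [← F.adapted.open_orbit]
      exact sup_le_sup_left (F.basis.lieOf_minParabolic_le F.hom F.le_top F.lie_eq_zero
        fun i => F.nonneg_of_pos) _
    exact h1 X.2
  obtain ⟨A, hA, B, hB, hAB⟩ := Submodule.mem_sup.1 hX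
  refine ⟨⟨A, hA⟩, funext fun i => ?_⟩
  have h2 : X = Submodule.inclusion F.lieOf_le ⟨A, hA⟩ + ⟨B, wspan_le b _ hB⟩ :=
    Subtype.ext hAB.symm
  have h3 := (mem_wspan b ⟨B, wspan_le b _ hB⟩).1 hB i fun (h : 0 ≤ w i y₀) => absurd h (not_le.2 (i.2 : w i y₀ < 0))
  have h4 : b.repr X i = v i := by
    rw [← Module.Basis.equivFun_apply, LinearEquiv.apply_symm_apply]
    exact dif_pos i.2
  rw [proj_apply, ← h4, h2, map_add, Finsupp.add_apply, h3, add_zero]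

theorem mem_wspan_iff (F : IsSphericalFrame p H 𝔞 x₀ y₀ b w τ) {S : Set ι}
    (X : (lieOf p H).toSubmodule) : (X : Mat n) ∈ wspan b S ↔
      ∀ i, i ∉ S → b.repr (Submodule.inclusion F.lieOf_le X) i = 0 := by
  rw [← mem_wspan, Submodule.coe_inclusion]

/-- The kernel of the projection is `𝔥 ∩ 𝔮`, and `Q ∩ H ⊆ L` places it in `𝔩`. -/
theorem mem_wspan_of_proj_eq_zero (F : IsSphericalFrame p H 𝔞 x₀ y₀ b w τ)
    {X : (lieOf p H).toSubmodule} (hX : F.proj X = 0) :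
    (X : Mat n) ∈ wspan b {i | w i y₀ = 0} := by
  refine F.basis.mem_levi_of_mem_parabolic F.hom F.le_top F.lie_eq_zero F.closed F.adapted.inf_le
    X.2 ?_
  refine (F.mem_wspan_iff X).2 fun i hi => ?_
  have h1 := F.proj_apply X ⟨i, (lt_of_not_ge fun h => hi h : w i y₀ < 0)⟩
  rw [hX, Pi.zero_apply] at h1
  exact h1.symm

theorem proj_eq_zero_of_mem_wspan (F : IsSphericalFrame p H 𝔞 x₀ y₀ b w τ)
    {X : (lieOf p H).toSubmodule} (hX : (X : Mat n) ∈ wspan b {i | w i y₀ = 0}) :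
    F.proj X = 0 := by
  funext i
  rw [proj_apply, Pi.zero_apply]
  exact (F.mem_wspan_iff X).1 hX i (ne_of_lt i.2)

theorem add_mem_levi (i j k : ι) (hi : w i y₀ = 0) (hj : w j y₀ = 0) (hk : w k = w i + w j) :
    w k y₀ = 0 := by
  rw [hk, LinearMap.add_apply, hi, hj, add_zero]

/-- Each generator of `leviSplit` is a commutator of elements of `𝔥 ∩ 𝔩`, which preserve the kernel
`𝔥 ∩ 𝔩`; trace zero extends by linearity. -/
theorem exists_end_ker_proj (F : IsSphericalFrame p H 𝔞 x₀ y₀ b w τ) {t : 𝔞}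
    (ht : t ∈ F.leviSplit) : ∃ f : Module.End ℝ (LinearMap.ker F.proj),
      (∀ x, ((f x : (lieOf p H).toSubmodule) : Mat n) =
        ⁅(t : Mat n), ((x : (lieOf p H).toSubmodule) : Mat n)⁆) ∧ LinearMap.trace ℝ _ f = 0 := by
  refine Submodule.span_induction (x := t) (p := fun (t : 𝔞) _ => ∃ f : Module.End ℝ (LinearMap.ker F.proj),
      (∀ x, ((f x : (lieOf p H).toSubmodule) : Mat n) =
        ⁅(t : Mat n), ((x : (lieOf p H).toSubmodule) : Mat n)⁆) ∧ LinearMap.trace ℝ _ f = 0)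
    ?_ ?_ ?_ ?_ ht
  · rintro t ⟨i, hi, hi0, ht⟩
    let j : LinearMap.ker F.proj →ₗ[ℝ] Mat n :=
      (lieOf p H).toSubmodule.subtype ∘ₗ (LinearMap.ker F.proj).subtype
    have hj : Function.Injective j := Subtype.val_injective.comp Subtype.val_injective
    have hmem : ∀ A ∈ lieOf p H, (∀ X ∈ wspan b {i | w i y₀ = 0}, ⁅A, X⁆ ∈ wspan b {i | w i y₀ = 0}) →
        ∀ x, ⁅A, j x⁆ ∈ LinearMap.range j := fun A hA hA' x => by
      refine ⟨⟨⟨⁅A, j x⁆, (lieOf p H).lie_mem hA (x : (lieOf p H).toSubmodule).2⟩,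
        F.proj_eq_zero_of_mem_wspan ?_⟩, rfl⟩
      exact hA' _ (F.mem_wspan_of_proj_eq_zero x.2)
    have hl : ∀ X ∈ wspan b {i | w i y₀ = 0}, ⁅(b i : Mat n), X⁆ ∈ wspan b {i | w i y₀ = 0} ∧
        ⁅τ (b i), X⁆ ∈ wspan b {i | w i y₀ = 0} := fun X hX =>
      F.lie_mem_of_mem_levi (fun i hi j hj k hk => add_mem_levi i j k hi hj hk) hi0 hX
    have hb := F.basis_mem_lieOf hi hi0
    obtain ⟨f, hf⟩ := exists_end_of_mapsTo hj (F := LieModule.toEnd ℝ (Mat n) (Mat n) (t : Mat n))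
      (hmem _ (F.mem_lieOf_of_mem_leviSplit (Submodule.subset_span ⟨i, hi, hi0, ht⟩))
        fun X hX => by
          rw [ht, lie_lie]
          exact sub_mem (hl _ (hl X hX).2).1 (hl _ (hl X hX).1).2)
    refine ⟨f, hf, trace_eq_zero_of_lie hj (hmem _ hb.1 fun X hX => (hl X hX).1)
      (hmem _ hb.2 fun X hX => (hl X hX).2) fun x => ?_⟩
    rw [← ht]
    exact hf x
  · exact ⟨0, fun x => by simp, map_zero _⟩
  · rintro s t - - ⟨f, hf, hf'⟩ ⟨g, hg, hg'⟩
    refine ⟨f + g, fun x => ?_, by rw [map_add, hf', hg', add_zero]⟩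
    rw [Submodule.coe_add, add_lie, ← hf, ← hg]
    rfl
  · rintro c t - ⟨f, hf, hf'⟩
    refine ⟨c • f, fun x => ?_, by rw [map_smul, hf', smul_zero]⟩
    rw [Submodule.coe_smul, smul_lie, ← hf]
    rfl

/-- The trace of `ad Y` on `𝔥` is `-2 ρ(Y)`. -/
theorem trace_lieOf (F : IsSphericalFrame p H 𝔞 x₀ y₀ b w τ) {Y : 𝔞}
    {D : Module.End ℝ (lieOf p H).toSubmodule}
    (hD : ∀ X, (D X : Mat n) = ⁅(Y : Mat n), (X : Mat n)⁆) :
    LinearMap.trace ℝ _ D = -2 * rho p 𝔞 y₀ Y := by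
  classical
  obtain ⟨Yn, hYn, h0⟩ := F.exists_sub_mem_leviSplit Y
  obtain ⟨D₁, hD₁, htr⟩ := F.exists_end_ker_proj hYn
  obtain ⟨σ, hσ⟩ := LinearMap.exists_rightInverse_of_surjective F.proj
    (LinearMap.range_eq_top.2 F.surjective_proj)
  -- On the quotient `𝔲̄` the operator is diagonal, with the weights negative on `y₀`. On the
  -- kernel, `ad Y` coincides with `ad Yn` because `Y - Yn` centralizes `𝔩`.
  let D₂ : Module.End ℝ ({i | w i y₀ < 0} → ℝ) :=
    LinearMap.pi fun i => w i Y • LinearMap.proj i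
  have hD₂ : ∀ z i, D₂ z i = w i Y * z i := fun _ _ => rfl
  have h₂ : ∀ x, F.proj (D x) = D₂ (F.proj x) := fun x => funext fun i => by
    rw [hD₂, proj_apply, proj_apply]
    exact repr_eq_of_apply_eq b (fun i => F.basis.lie_apply Y i)
      (X := Submodule.inclusion F.lieOf_le x) (Z := Submodule.inclusion F.lieOf_le (D x))
      (by rw [Submodule.coe_inclusion, Submodule.coe_inclusion, hD]; rfl) i
  have h₁ : ∀ x, (D₁ x : (lieOf p H).toSubmodule) = D x := fun x => Subtype.ext (by
    have h3 := F.basis.lie_eq_smul (Y := Y - Yn) (c := 0) h0 (F.mem_wspan_of_proj_eq_zero x.2)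
    rw [zero_smul, Submodule.coe_sub, sub_lie, sub_eq_zero] at h3
    rw [hD₁, hD, h3])
  have hσ' : ∀ z, F.proj (σ z) = z := LinearMap.congr_fun hσ
  rw [trace_eq_trace_ker_add hσ' h₁ h₂, htr, zero_add,
    trace_eq_sum_of_eigenbasis (M := {i | w i y₀ < 0} → ℝ) (Pi.basisFun ℝ {i | w i y₀ < 0})
      (f := D₂) (μ := fun i : {i | w i y₀ < 0} => w i Y) fun i => ?_]
  · convert F.sum_weight_neg (Y := Y) ?_
    have h4 := F.sum_weight_eq_zero (Y := Yn) (S := {i | w i y₀ = 0})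
      (fun i hi j hj k hk => add_mem_levi i j k hi hj hk) hYn
    have h5 : ∀ i : {i | w i y₀ = 0}, w i Y = w i Yn := fun i => by
      rw [← sub_eq_zero, ← map_sub]
      exact h0 i i.2
    simp only [h5]
    exact h4
  · refine funext fun k => ?_
    rw [hD₂, Pi.basisFun_apply, Pi.smul_apply, smul_eq_mul]
    rcases eq_or_ne k i with rfl | hk
    · rfl
    · rw [Pi.single_eq_of_ne hk, mul_zero, mul_zero]

theorem exists_aeval_rootPoly (F : IsSphericalFrame p H 𝔞 x₀ y₀ b w τ) (Y : 𝔞) :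
    ∃ s : Finset ℝ, Polynomial.aeval (Y : Mat n) (rootPoly s) = 0 := by
  obtain ⟨g, d, h⟩ := F.adapted.maximal_split.prop.2.1 Y Y.2
  exact ⟨_, aeval_rootPoly_of_eq_conj_diagonal h⟩

theorem modularCharacterFun_eq_one [LocallyCompactSpace G]
    (F : IsSphericalFrame p H 𝔞 x₀ y₀ b w τ) (Y : 𝔞) :
    Measure.modularCharacterFun (gexp p (Y : Mat n)) = 1 := by
  obtain ⟨s, hs⟩ := F.exists_aeval_rootPoly Y
  obtain ⟨f, hf⟩ := exists_end_of_mapsTo (lieOf p ⊤).toSubmodule.injective_subtype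
    (F := LieModule.toEnd ℝ (Mat n) (Mat n) (Y : Mat n)) fun X => by
      rw [Submodule.range_subtype]
      exact (lieOf p ⊤).lie_mem (F.le_top Y.2) X.2
  have h := F.hom.modularCharacterFun_gexp rfl (F.le_top Y.2) hs hf
  rw [F.trace_ad_eq_zero Y.2 hf, Real.exp_zero] at h
  exact_mod_cast h

/-- Unimodularity of `G/H` forces `ρ` to vanish on `𝔞 ∩ 𝔥`. -/
theorem rho_eq_zero [LocallyCompactSpace G] [SecondCountableTopology G] [MeasurableSpace G]
    [BorelSpace G] (F : IsSphericalFrame p H 𝔞 x₀ y₀ b w τ) (μZ : Measure (G ⧸ H)) [μZ.Regular]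
    [SMulInvariantMeasure G (G ⧸ H) μZ] (hμZ : μZ ≠ 0) {Y : 𝔞} (hY : (Y : Mat n) ∈ lieOf p H) :
    rho p 𝔞 y₀ Y = 0 := by
  have : LocallyCompactSpace H := F.closed.isClosedEmbedding_subtypeVal.locallyCompactSpace
  obtain ⟨s, hs⟩ := F.exists_aeval_rootPoly Y
  obtain ⟨f, hf⟩ := exists_end_of_mapsTo (lieOf p H).toSubmodule.injective_subtype
    (F := LieModule.toEnd ℝ (Mat n) (Mat n) (Y : Mat n)) fun X => by
      rw [Submodule.range_subtype]
      exact (lieOf p H).lie_mem hY X.2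
  -- The modular function of `H` at `exp Y` is `e^{-2ρ(Y)}`; by invariance of `μZ` it equals that of
  -- `G`, which is `1` on `exp 𝔞`.
  have h := (F.hom.comp_subtype F.closed).modularCharacterFun_gexp (lieOf_comp_subtype H) hY hs hf
  rw [modularCharacterFun_subgroup_eq μZ F.closed hμZ, coe_gexp_comp_subtype F.hom F.closed hY,
    F.modularCharacterFun_eq_one, F.trace_lieOf hf] at h
  have h1 := Real.exp_eq_one_iff _ |>.1 (h.symm.trans NNReal.coe_one)
  linarith

/-- `Ad(exp Y)` does not expand on `𝔮` if `Y` is negative on the nilradical. -/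
theorem norm_conjAlgHom_le (F : IsSphericalFrame p H 𝔞 x₀ y₀ b w τ) {Y : 𝔞}
    (hY : ∀ i, 0 ≤ w i y₀ → w i Y ≤ 0) {V : (lieOf p ⊤).toSubmodule}
    (hV : (V : Mat n) ∈ wspan b {i | 0 ≤ w i y₀}) :
    ‖conjAlgHom (expGL (Y : Mat n)) (V : Mat n)‖ ≤ ∑ i, ‖b.repr V i‖ * ‖(b i : Mat n)‖ := by
  conv_lhs => rw [← sum_repr_coe b V, map_sum]
  refine (norm_sum_le _ _).trans (Finset.sum_le_sum fun i _ => ?_)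
  rw [map_smul, conjAlgHom_expGL_eq_smul (F.basis i Y), norm_smul, norm_smul]
  by_cases hi : 0 ≤ w i y₀
  · refine mul_le_mul_of_nonneg_left (mul_le_of_le_one_left (norm_nonneg _) ?_) (norm_nonneg _)
    rw [Real.norm_eq_abs, Real.abs_exp]
    exact Real.exp_le_one_iff.2 (hY i hi)
  · rw [(mem_wspan b V).1 hV i hi, norm_zero, zero_mul, zero_mul]

open Classical in
/-- An endomorphism of `𝔥` with determinant `e^{2ρ(Y)}` that is bounded, and is bounded after
composition with `Ad(exp Y)`, uniformly in `Y`. -/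
theorem exists_bounded_end (F : IsSphericalFrame p H 𝔞 x₀ y₀ b w τ) : ∃ K : ℝ, ∀ Y : 𝔞,
    (∀ i, w i y₀ = 0 → w i Y = 0) → (∀ i, 0 < w i y₀ → w i Y ≤ 0) →
      ∃ f : Module.End ℝ (lieOf p H).toSubmodule,
        LinearMap.det f = Real.exp (2 * rho p 𝔞 y₀ Y) ∧
        (∀ X, ‖(f X : Mat n)‖ ≤ K * ‖(X : Mat n)‖) ∧
        ∀ X, ‖conjAlgHom (expGL (Y : Mat n)) (f X : Mat n)‖ ≤ K * ‖(X : Mat n)‖ := by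
  obtain ⟨σ, hσ⟩ := LinearMap.exists_rightInverse_of_surjective F.proj
    (LinearMap.range_eq_top.2 F.surjective_proj)
  have hσ' : ∀ z, F.proj (σ z) = z := LinearMap.congr_fun hσ
  let j : ({i | w i y₀ < 0} → ℝ) →ₗ[ℝ] (lieOf p ⊤).toSubmodule :=
    Fintype.linearCombination ℝ fun i : {i | w i y₀ < 0} => b i
  have hj : ∀ z, (j z : Mat n) = ∑ i, z i • (b i : Mat n) := fun z => by
    change (lieOf p ⊤).toSubmodule.subtype (j z) = _
    rw [Fintype.linearCombination_apply, map_sum]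
    rfl
  have hjr : ∀ z (i : {i | w i y₀ < 0}), b.repr (j z) i = z i := fun z i => by
    rw [Fintype.linearCombination_apply, map_sum, Finsupp.finsetSum_apply]
    rw [Finset.sum_eq_single i]
    · simp
    · intro k _ hk
      rw [map_smul, Module.Basis.repr_self, Finsupp.smul_apply,
        Finsupp.single_eq_of_ne (fun h => hk (Subtype.ext h).symm), smul_zero]
    · simp
  -- The error of the section `σ` relative to the naive lift `j` into `𝔲̄`. It takes values in `𝔮`,
  -- where `Ad(exp Y)` does not expand.
  let R : ({i | w i y₀ < 0} → ℝ) →ₗ[ℝ] (lieOf p ⊤).toSubmodule :=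
    Submodule.inclusion F.lieOf_le ∘ₗ σ - j
  have hRc : ∀ z, (R z : Mat n) = σ z - j z := fun z => by
    rw [LinearMap.sub_apply, Submodule.coe_sub, LinearMap.comp_apply, Submodule.coe_inclusion]
  have hR : ∀ z, (R z : Mat n) ∈ wspan b {i | 0 ≤ w i y₀} := fun z => by
    refine (mem_wspan b _).2 fun i hi => ?_
    have hi' : w i y₀ < 0 := lt_of_not_ge fun h => hi h
    have h1 := congrFun (hσ' z) ⟨i, hi'⟩
    rw [proj_apply] at h1
    rw [LinearMap.sub_apply, map_sub, Finsupp.sub_apply, hjr z ⟨i, hi'⟩, ← h1]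
    exact sub_self _
  obtain ⟨P, hP⟩ := exists_norm_map_le F.proj
  obtain ⟨S, hS⟩ := exists_norm_map_le σ
  obtain ⟨J, hJ⟩ := exists_norm_map_le j
  have hM := fun i => exists_norm_map_le (b.coord i ∘ₗ R)
  choose M hM using hM
  let N : ℝ := ∑ i, M i * ‖(b i : Mat n)‖
  have hN : 0 ≤ N := Finset.sum_nonneg fun i _ => mul_nonneg (M i).2 (norm_nonneg _)
  refine ⟨1 + S * P + N * P + J * P, fun Y h0 hpos => ?_⟩
  have hneg : ∀ i, w i y₀ < 0 → 0 ≤ w i Y := fun i hi => by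
    obtain ⟨k, hk⟩ := F.exists_weight_eq_neg i
    have := hpos k (by rw [hk]; exact neg_pos.2 hi)
    rw [hk] at this
    exact neg_nonpos.1 this
  have hle : ∀ i, 0 ≤ w i y₀ → w i Y ≤ 0 := fun i hi => by
    rcases hi.eq_or_lt with h | h
    · exact (h0 i h.symm).le
    · exact hpos i h
  -- The inverse of `Ad(exp Y)` on `𝔲̄`: a contraction, since the weights there are nonnegative on
  -- `Y`.
  let A : Module.End ℝ ({i | w i y₀ < 0} → ℝ) :=
    LinearMap.pi fun i => Real.exp (-w i Y) • LinearMap.proj i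
  have hA : ∀ z i, A z i = Real.exp (-w i Y) * z i := fun _ _ => rfl
  have hexp : ∀ i : {i | w i y₀ < 0}, Real.exp (-w i Y) ≤ 1 := fun i =>
    Real.exp_le_one_iff.2 (neg_nonpos.2 (hneg i i.2))
  have hAz : ∀ z, ‖A z‖ ≤ ‖z‖ := fun z => by
    refine (pi_norm_le_iff_of_nonneg (norm_nonneg _)).2 fun i => ?_
    rw [hA, norm_mul, Real.norm_eq_abs, Real.abs_exp]
    exact (mul_le_of_le_one_left (norm_nonneg _) (hexp i)).trans (norm_le_pi_norm z i)
  have hAz' : ∀ z, ‖A z - z‖ ≤ ‖z‖ := fun z => by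
    refine (pi_norm_le_iff_of_nonneg (norm_nonneg _)).2 fun i => ?_
    have h1 : (A z - z) i = (Real.exp (-w i Y) - 1) * z i := by
      rw [Pi.sub_apply, hA, sub_mul, one_mul]
    rw [h1, norm_mul, Real.norm_eq_abs, abs_sub_comm]
    refine (mul_le_of_le_one_left (norm_nonneg _) ?_).trans (norm_le_pi_norm z i)
    rw [abs_of_nonneg (sub_nonneg.2 (hexp i))]
    linarith [Real.exp_pos (-w i Y)]
  have hdet : LinearMap.det A = Real.exp (2 * rho p 𝔞 y₀ Y) := by
    rw [det_eq_prod_of_eigenbasis (Pi.basisFun ℝ {i | w i y₀ < 0})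
      (μ := fun i => Real.exp (-w i Y)) fun i => ?_, ← Real.exp_sum, Finset.sum_neg_distrib]
    · have h1 := F.sum_weight_neg (Y := Y) (Finset.sum_eq_zero fun i _ => h0 i i.2)
      congr 1
      have h2 : ∑ i : {i | w i y₀ < 0}, w i Y = -2 * rho p 𝔞 y₀ Y := by convert h1
      rw [h2]
      ring
    · refine funext fun k => ?_
      rw [hA, Pi.basisFun_apply, Pi.smul_apply, smul_eq_mul]
      rcases eq_or_ne k i with rfl | hk
      · rfl
      · rw [Pi.single_eq_of_ne hk, mul_zero, mul_zero]
  -- `f` applies `A` to the coordinates in `𝔲̄`, along the section `σ`, and is the identity on the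
  -- kernel of the projection.
  let f : Module.End ℝ (lieOf p H).toSubmodule :=
    LinearMap.id + (σ ∘ₗ (A - LinearMap.id)) ∘ₗ F.proj
  have hf : ∀ X, f X = X + σ (A (F.proj X) - F.proj X) := fun _ => rfl
  refine ⟨f, ?_, fun X => ?_, fun X => ?_⟩
  · rw [det_id_add_comp_comm, ← LinearMap.comp_assoc, hσ, LinearMap.id_comp, add_sub_cancel, hdet]
  · have hπ : ‖F.proj X‖ ≤ P * ‖(X : Mat n)‖ := hP X
    have h1 : ‖(f X : Mat n)‖ ≤ ‖(X : Mat n)‖ + S * ‖A (F.proj X) - F.proj X‖ := by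
      rw [hf]
      exact (norm_add_le _ _).trans (add_le_add_right (hS _) _)
    have h2 : (S : ℝ) * ‖A (F.proj X) - F.proj X‖ ≤ S * (P * ‖(X : Mat n)‖) :=
      mul_le_mul_of_nonneg_left ((hAz' _).trans hπ) S.2
    have h3 : 0 ≤ (N * P + J * P) * ‖(X : Mat n)‖ := by positivity
    linarith
  · set z := F.proj X
    have hπ : ‖z‖ ≤ P * ‖(X : Mat n)‖ := hP X
    have hker : F.proj (X - σ z) = 0 := by rw [map_sub, hσ', sub_self]
    have h1 : conjAlgHom (expGL (Y : Mat n)) ((X - σ z : (lieOf p H).toSubmodule) : Mat n) =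
        (X - σ z : (lieOf p H).toSubmodule) := by
      rw [conjAlgHom_expGL_eq_smul (c := 0), Real.exp_zero, one_smul]
      exact F.basis.lie_eq_smul h0 (F.mem_wspan_of_proj_eq_zero hker)
    have h2 : conjAlgHom (expGL (Y : Mat n)) (j (A z) : Mat n) = j z := by
      rw [hj, hj, map_sum]
      refine Finset.sum_congr rfl fun i _ => ?_
      rw [map_smul, conjAlgHom_expGL_eq_smul (F.basis i Y), smul_smul, hA, mul_right_comm,
        ← Real.exp_add, neg_add_cancel, Real.exp_zero, one_mul]
    -- Three pieces under `Ad(exp Y)`: the first lies in `𝔩` and is fixed, the second lies in `𝔮`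
    -- and is not expanded, and on the third the contraction `A` is exactly undone.
    have h3 : (f X : Mat n) = (X - σ z : (lieOf p H).toSubmodule) + (R (A z) : Mat n) +
        (j (A z) : Mat n) := by
      rw [hf, map_sub]
      rw [hRc, Submodule.coe_add, Submodule.coe_sub, Submodule.coe_sub]
      abel
    have h4 : ‖conjAlgHom (expGL (Y : Mat n)) (R (A z) : Mat n)‖ ≤ N * ‖z‖ := by
      refine (F.norm_conjAlgHom_le hle (hR _)).trans ?_
      rw [Finset.sum_mul]
      refine Finset.sum_le_sum fun i _ => ?_
      rw [mul_right_comm]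
      exact mul_le_mul_of_nonneg_right ((hM i (A z)).trans
        (mul_le_mul_of_nonneg_left (hAz z) (M i).2)) (norm_nonneg _)
    rw [h3, map_add, map_add, h1, h2]
    have h5 : ‖((X - σ z : (lieOf p H).toSubmodule) : Mat n)‖ ≤ ‖(X : Mat n)‖ + S * ‖z‖ :=
      (norm_sub_le _ _).trans (add_le_add_right (hS _) _)
    have h6 : ‖(j z : Mat n)‖ ≤ J * ‖z‖ := hJ z
    have h7 : (S + N + J) * ‖z‖ ≤ (S + N + J) * (P * ‖(X : Mat n)‖) :=
      mul_le_mul_of_nonneg_left hπ (by positivity)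
    refine (norm_add₃_le).trans ?_
    linarith

end IsSphericalFrame

end Structure

end RealSpherical
end

noncomputable section

open MeasureTheory NormedSpace Filter
open scoped Pointwise Topology Matrix.Norms.Operator

set_option linter.unusedSectionVars false

namespace RealSpherical

attribute [local instance 100] LieRing.ofAssociativeRing

/-! ### The volume estimates -/

section Volumes

variable {n : ℕ} {G : Type*} [Group G] [TopologicalSpace G] [IsTopologicalGroup G] [T2Space G]
  [LocallyCompactSpace G] [SecondCountableTopology G] [MeasurableSpace G] [BorelSpace G]
  {p : G →* GL (Fin n) ℝ} {H : Subgroup G} {𝔞 : Submodule ℝ (Mat n)} {x₀ y₀ : 𝔞} {ι : Type}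
  [Fintype ι] [DecidableEq ι] {b : Module.Basis ι ℝ (lieOf p ⊤).toSubmodule}
  {w : ι → Module.Dual ℝ 𝔞} {τ : Mat n →ₗ[ℝ] Mat n}

/-- Replacing `a` by `a h₀` conjugates the subset of `H` by `h₀`; left invariance and modular
function `1` absorb the two translations. -/
theorem measure_conj_mem_mul [LocallyCompactSpace H] (μH : Measure H) [μH.IsHaarMeasure]
    {B₁ : Set G} (hB₁ : IsClosed B₁) (a : G) {h₀ : H} (h₁ : Measure.modularCharacterFun h₀ = 1) :
    μH {h : H | a * h₀ * h * (a * h₀)⁻¹ ∈ B₁} = μH {h : H | a * h * a⁻¹ ∈ B₁} := by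
  have hmeas : MeasurableSet {h : H | a * h * a⁻¹ ∈ B₁} :=
    (hB₁.preimage (f := fun h : H => a * h * a⁻¹) (by fun_prop)).measurableSet
  have h2 := measure_preimage_mul_right_eq μH h₀⁻¹ hmeas
  have h3 : Measure.modularCharacterFun h₀⁻¹ = 1 := by
    have := Measure.modularCharacterFun_map_mul h₀⁻¹ h₀
    rwa [inv_mul_cancel, Measure.modularCharacterFun_map_one, h₁, mul_one, eq_comm] at this
  rw [h3, ENNReal.coe_one, one_mul] at h2
  rw [← h2]
  refine Eq.trans ?_ (measure_preimage_mul μH h₀ _)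
  congr 1
  ext h
  simp [mul_assoc]

/-- The wavefront property supplies an element of the negative chamber up to `𝔞 ∩ 𝔥`, and the
component of that element along `leviSplit` also lies in `𝔥`. Both corrections are collected in
`Y₂`. -/
theorem IsSphericalFrame.exists_levi_reduction (F : IsSphericalFrame p H 𝔞 x₀ y₀ b w τ)
    (hwavefront : IsWavefront p H 𝔞 x₀ y₀) {Y : 𝔞} (hY : Y ∈ compressionCone p H 𝔞 y₀) :
    ∃ Y₁ Y₂ : 𝔞, Y = Y₁ + Y₂ ∧ (Y₂ : Mat n) ∈ lieOf p H ∧ (∀ i, w i y₀ = 0 → w i Y₁ = 0) ∧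
      ∀ i, 0 < w i y₀ → w i Y₁ ≤ 0 := by
  rw [← hwavefront] at hY
  obtain ⟨Z, hZ, Z', hZ', rfl⟩ := Set.mem_add.1 hY
  obtain ⟨N, hN, h0⟩ := F.exists_sub_mem_leviSplit Z
  exact ⟨Z - N, N + Z', by abel, (lieOf p H).add_mem (F.mem_lieOf_of_mem_leviSplit hN) hZ', h0,
    fun i hi => F.weight_sub_nonpos hZ hN h0 hi⟩

/-- The bound is proved for the reduced part `Y₁`, where `exists_bounded_end` applies; adding `Y₂ ∈
𝔞 ∩ 𝔥` changes neither `ρ` nor the measure. -/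
theorem IsSphericalFrame.exists_le_measure (F : IsSphericalFrame p H 𝔞 x₀ y₀ b w τ)
    (hwavefront : IsWavefront p H 𝔞 x₀ y₀) (μH : Measure H) [μH.IsHaarMeasure]
    (μZ : Measure (G ⧸ H)) [μZ.Regular] [SMulInvariantMeasure G (G ⧸ H) μZ] (hμZ : μZ ≠ 0)
    {B₁ : Set G} (hB₁ : IsClosed B₁) (hB₁_nhds : B₁ ∈ 𝓝 (1 : G)) :
    ∃ C : ℝ, 0 < C ∧ ∀ Y ∈ compressionCone p H 𝔞 y₀,
      ENNReal.ofReal (C * Real.exp (2 * rho p 𝔞 y₀ Y)) ≤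
        μH {h : H | gexp p (Y : Mat n) * (h : G) * (gexp p (Y : Mat n))⁻¹ ∈ B₁} := by
  have : LocallyCompactSpace H := F.closed.isClosedEmbedding_subtypeVal.locallyCompactSpace
  obtain ⟨K, hK⟩ := F.exists_bounded_end
  obtain ⟨C, hC, h⟩ := exists_le_measure_conj_mem F.hom F.closed μH hB₁_nhds K
  refine ⟨C, hC, fun Y hY => ?_⟩
  obtain ⟨Y₁, Y₂, rfl, hY₂, h0, hpos⟩ := F.exists_levi_reduction hwavefront hY
  obtain ⟨f, hdet, hf, hf'⟩ := hK Y₁ h0 hpos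
  have h1 := h (gexp p (Y₁ : Mat n)) f hf fun X => by
    rw [map_gexp F.hom (F.le_top Y₁.2), ← conjAlgHom_apply]
    exact hf' X
  have hρ : rho p 𝔞 y₀ (Y₁ + Y₂) = rho p 𝔞 y₀ Y₁ := by
    have h2 := F.rho_eq_zero μZ hμZ hY₂
    classical
    rw [F.rho_eq] at h2 ⊢
    rw [F.rho_eq]
    simp only [map_add, Finset.sum_add_distrib]
    rw [mul_add, h2, add_zero]
  rw [hdet, abs_of_pos (Real.exp_pos _)] at h1
  have hcomm : Commute (Y₁ : Mat n) (Y₂ : Mat n) := by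
    have := F.lie_eq_zero _ Y₁.2 _ Y₂.2
    rwa [Ring.lie_def, sub_eq_zero] at this
  have hcoe := coe_gexp_comp_subtype F.hom F.closed hY₂
  rw [hρ, Submodule.coe_add, gexp_add F.hom (F.le_top Y₁.2) (F.le_top Y₂.2) hcomm, ← hcoe,
    measure_conj_mem_mul μH hB₁]
  · exact h1
  · rw [modularCharacterFun_subgroup_eq μZ F.closed hμZ, hcoe, F.modularCharacterFun_eq_one]

theorem IsSphericalFrame.exists_measure_orbitSet_le (F : IsSphericalFrame p H 𝔞 x₀ y₀ b w τ)
    (μG : Measure G) [μG.IsHaarMeasure] (μH : Measure H) [μH.IsHaarMeasure]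
    (μZ : Measure (G ⧸ H)) [μZ.Regular] [SMulInvariantMeasure G (G ⧸ H) μZ] {B₁ : Set G}
    {S : Set 𝔞} {C : ℝ} (hC : 0 < C) (h : ∀ Y ∈ S,
      ENNReal.ofReal (C * Real.exp (2 * rho p 𝔞 y₀ Y)) ≤
        μH {h : H | gexp p (Y : Mat n) * (h : G) * (gexp p (Y : Mat n))⁻¹ ∈ B₁}) :
    ∃ C : ℝ, 0 < C ∧ ∀ Y ∈ S, ∀ E ⊆ B₁,
      μZ (orbitSet H E (gexp p (Y : Mat n))) ≤
        ENNReal.ofReal (C * Real.exp (-2 * rho p 𝔞 y₀ Y)) *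
          μG (pullbackSet H B₁ E (gexp p (Y : Mat n))) := by
  obtain ⟨c, hc⟩ := exists_mul_measure_orbitSet_le μG μH μZ F.closed
  -- Weil's constant divided by that of the lower bound; `c + 1` replaces `c` to make the result
  -- positive.
  refine ⟨(c + 1) / C, by positivity, fun Y hY E hE => ?_⟩
  have h1 := hc _ B₁ _ (F.modularCharacterFun_eq_one Y) (h Y hY) E hE
  have h2 : 0 < C * Real.exp (2 * rho p 𝔞 y₀ Y) := by positivity
  have h3 : ENNReal.ofReal ((c + 1) / C * Real.exp (-2 * rho p 𝔞 y₀ Y)) *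
      ENNReal.ofReal (C * Real.exp (2 * rho p 𝔞 y₀ Y)) = ENNReal.ofReal (c + 1) := by
    rw [← ENNReal.ofReal_mul (by positivity), neg_mul, Real.exp_neg]
    congr 1
    field_simp
  have h4 : (c : ENNReal) ≤ ENNReal.ofReal (c + 1) := by
    rw [← ENNReal.ofReal_coe_nnreal]
    exact ENNReal.ofReal_le_ofReal (by linarith)
  refine (ENNReal.mul_le_mul_iff_right (ENNReal.ofReal_pos.2 h2).ne' ENNReal.ofReal_ne_top).1 ?_
  refine h1.trans ?_
  rw [← mul_assoc, mul_comm (ENNReal.ofReal (C * _)), h3]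
  gcongr

end Volumes

end RealSpherical
end

theorem mainTheorem9 {n : ℕ} {G : Type*} [Group G] [TopologicalSpace G] [IsTopologicalGroup G]
    [T2Space G] [MeasurableSpace G] [BorelSpace G]
    (p : G →* GL (Fin n) ℝ) (hp : RealSpherical.IsRealReductive p)
    (H : Subgroup G) (hH : IsClosed (H : Set G)) (hHfin : Finite (ConnectedComponents H))
    (hHalg : ∃ S : Subgroup (GL (Fin n) ℝ),
      RealSpherical.IsRealAlgebraic S ∧ RealSpherical.lieAlg S = RealSpherical.lieOf p H)
    (μG : Measure G) [μG.IsHaarMeasure] (μH : Measure H) [μH.IsHaarMeasure]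
    (μZ : Measure (G ⧸ H)) [μZ.Regular] [SMulInvariantMeasure G (G ⧸ H) μZ] (hμZ : μZ ≠ 0)
    (𝔞 : Submodule ℝ (RealSpherical.Mat n)) (x₀ y₀ : 𝔞)
    (hadapted : RealSpherical.IsAdapted p H 𝔞 x₀ y₀)
    (hwavefront : RealSpherical.IsWavefront p H 𝔞 x₀ y₀)
    (B₁ : Set G) (hB₁ : IsCompact B₁) (hB₁_nhds : B₁ ∈ 𝓝 (1 : G)) :
    (∃ C : ℝ, 0 < C ∧ ∀ Y ∈ RealSpherical.compressionCone p H 𝔞 y₀,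
      ∀ E ⊆ B₁, NullMeasurableSet E μG →
        μZ (RealSpherical.orbitSet H E (RealSpherical.gexp p (Y : RealSpherical.Mat n))) ≤
          ENNReal.ofReal (C * Real.exp (-2 * RealSpherical.rho p 𝔞 y₀ Y)) *
            μG (RealSpherical.pullbackSet H B₁ E
              (RealSpherical.gexp p (Y : RealSpherical.Mat n)))) ∧
    (∃ C : ℝ, 0 < C ∧ ∀ Y ∈ RealSpherical.compressionCone p H 𝔞 y₀,
      ENNReal.ofReal (C * Real.exp (2 * RealSpherical.rho p 𝔞 y₀ Y)) ≤
        μH {h : H | RealSpherical.gexp p (Y : RealSpherical.Mat n) * (h : G) *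
          (RealSpherical.gexp p (Y : RealSpherical.Mat n))⁻¹ ∈ B₁}) := by

  -- The compact neighbourhood `B₁` makes `G` locally compact, and the map to `GL(n, ℝ)` makes it
  -- second countable, as the measure theory requires.
  have : LocallyCompactSpace G := hB₁.locallyCompactSpace_of_mem_nhds_of_group hB₁_nhds
  have : SecondCountableTopology G := hp.isFiniteClosedHom.secondCountableTopology
  obtain ⟨ι, _, _, b, w, τ, F⟩ := hadapted.exists_frame hp hH
  obtain ⟨C, hC, h⟩ := F.exists_le_measure hwavefront μH μZ hμZ hB₁.isClosed hB₁_nhds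
  obtain ⟨C', hC', h'⟩ := F.exists_measure_orbitSet_le μG μH μZ hC h
  exact ⟨⟨C', hC', fun Y hY E hE _ => h' Y hY E hE⟩, C, hC, h⟩
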